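/- **Setting.** Let $N\ge1$, let $\tau$ be a partition of $N$ with first row $\tau_1$ and length $\ell(\tau)$, and put $h_\tau=\tau_1+\ell(\tau)-1\ (\le N)$. Let $\mathbb K$ be a field and let $q,t\in\mathbb K\setminus\{0\}$ satisfy $q^at^b\ne1$ for all integers $(a,b)\ne(0,0)$ with $|b|\le h_\tau$ (for instance $\mathbb K=\mathbb Q(q,t)$). Operators act on the right. Let $\mathcal Y(\tau)$ be the set of reverse standard Young tableaux of shape $\tau$ (fillings by $1,\dots,N$ decreasing along rows and columns), $c(i,S)=\mathrm{col}(i,S)-\mathrm{row}(i,S)$ the content of the entry $i$ of $S$, and $S^{(i)}$ the tableau $S$ with $i,i+1$ exchanged. The space $V_\tau$ with basis $\mathcal Y(\tau)$ carries the representation of the Hecke algebra given, with $b=c(i,S)-c(i+1,S)$, by $S\tau(T_i)=tS$ if $i,i+1$ are in the same row, $S\tau(T_i)=-S$ if they are in the same column, $S\tau(T_i)=S^{(i)}+\frac{t-1}{1-t^{-b}}S$ if $b\ge2$, and $S\tau(T_i)=\frac{t(t^{b+1}-1)(t^{b-1}-1)}{(t^b-1)^2}S^{(i)}+\frac{t^b(t-1)}{t^b-1}S$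 if $b\le-2$. Put $\omega=T_1T_2\cdots T_{N-1}$, $u(z)=\frac{(t-z)(1-tz)}{(1-z)^2}$, and define $\langle S,S'\rangle_0=0$ for $S\ne S'$ and $\|S\|_0^2=\langle S,S\rangle_0=\prod_{i<j,\ c(j,S)-c(i,S)\ge2}u(t^{c(i,S)-c(j,S)})$. On $\mathcal P_\tau=\mathbb K[x_1,\dots,x_N]\otimes V_\tau$ define, for $1\le i<N$, $$(p\otimes S)\boldsymbol T_i=(1-t)x_{i+1}\frac{p(x)-p(x.s_i)}{x_i-x_{i+1}}\otimes S+p(x.s_i)\otimes S\tau(T_i),\qquad (p\otimes S)\boldsymbol w=p(qx_N,x_1,\dots,x_{N-1})\otimes S\tau(\omega),$$ where $s_i$ exchanges the entries $i$ and $i+1$; further $\boldsymbol T_i^{-1}=t^{-1}(\boldsymbol T_i+1-t)$, $\boldsymbol\xi_i=t^{i-N}\boldsymbol T_{i-1}^{-1}\cdots\boldsymbol T_1^{-1}\boldsymbol w\boldsymbol T_{N-1}\cdots\boldsymbol T_i$ for $1\le i\le N$, $f\mathcal D_N=(f-f\boldsymbol\xi_N)/x_N$, and $\boldsymbol w^*=\boldsymbol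 T_{N-1}^{-1}\cdots\boldsymbol T_1^{-1}\boldsymbol w\boldsymbol T_{N-1}\cdots\boldsymbol T_1$. For $\alpha\in\mathbb N_0^N$ let $\alpha^+$ be its nonincreasing rearrangement, $r_\alpha(i)=\#\{j:\alpha_j>\alpha_i\}+\#\{j\le i:\alpha_j=\alpha_i\}$, $\alpha\Phi=(\alpha_2,\dots,\alpha_N,\alpha_1+1)$ and $\zeta_{\alpha,S}(i)=q^{\alpha_i}t^{c(r_\alpha(i),S)}$. The Macdonald polynomials $M_{\alpha,S}$ are produced by the Yang–Baxter graph: $M_{\mathbf 0,S}=1\otimes S$; $M_{\alpha\Phi,S}=x_N(M_{\alpha,S}\boldsymbol w)$; and $M_{\alpha,S}\boldsymbol T_i+\frac{t-1}{\zeta_{\alpha,S}(i+1)/\zeta_{\alpha,S}(i)-1}M_{\alpha,S}$ equals $M_{\alpha.s_i,S}$ if $\alpha_i<\alpha_{i+1}$, and equals $M_{\alpha,S^{(j)}}$ if $\alpha_i=\alpha_{i+1}$, $j=r_\alpha(i)$ and $c(j,S)-c(j+1,S)\ge2$. Put $(z;q)_m=\prod_{i=1}^m(1-zq^{i-1})$,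 $k(\lambda)=\sum_{i=1}^N(N-2i+1)\lambda_i$ and $$\mathcal E(\alpha,S)=\prod_{i<j,\ \alpha_i<\alpha_j}u\bigl(q^{\alpha_j-\alpha_i}t^{c(r_\alpha(j),S)-c(r_\alpha(i),S)}\bigr).$$ **Theorem.** Every label $(\alpha,S)\in\mathbb N_0^N\times\mathcal Y(\tau)$ is reached in the Yang–Baxter graph, and all paths to it produce the same polynomial $M_{\alpha,S}$; $M_{\alpha,S}\boldsymbol\xi_i=\zeta_{\alpha,S}(i)M_{\alpha,S}$ for $1\le i\le N$; the $M_{\alpha,S}$ form a basis of $\mathcal P_\tau$; and $f-f\boldsymbol\xi_N$ is divisible by $x_N$ for every $f\in\mathcal P_\tau$. Hence there is exactly one bilinear form $\langle\cdot,\cdot\rangle$ on $\mathcal P_\tau$ (write $\|f\|^2=\langle f,f\rangle$) such that for all partitions $\lambda=\lambda^+$, all $\alpha$ and all $S$ $$\|M_{\lambda,S}\|^2=t^{k(\lambda)}\|S\|_0^2(1-q)^{-|\lambda|}\prod_{i=1}^N(qt^{c(i,S)};q)_{\lambda_i}\prod_{1\le i<j\le N}\frac{(qt^{c(i,S)-c(j,S)-1};q)_{\lambda_i-\lambda_j}(qt^{c(i,S)-c(j,S)+1};q)_{\lambda_i-\lambda_j}}{(qt^{c(i,S)-c(j,S)};q)_{\lambda_i-\lambda_j}^2},$$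 $\|M_{\alpha,S}\|^2=\mathcal E(\alpha,S)^{-1}\|M_{\alpha^+,S}\|^2$, and $\langle M_{\alpha,S},M_{\beta,S'}\rangle=0$ whenever $(\alpha,S)\ne(\beta,S')$. This form is symmetric and satisfies, for all $f,g\in\mathcal P_\tau$, $S,S'\in\mathcal Y(\tau)$ and $1\le i<N$, 1. $\langle1\otimes S,1\otimes S'\rangle=\langle S,S'\rangle_0$; 2. $\langle f\boldsymbol T_i,g\rangle=\langle f,g\boldsymbol T_i\rangle$; 3. $\langle f\boldsymbol\xi_N,g\rangle=\langle f,g\boldsymbol\xi_N\rangle$; 4. $\langle f\mathcal D_N,g\rangle=(1-q)\langle f,x_N(g\boldsymbol w^*\boldsymbol w)\rangle$. Moreover, for all $\alpha,S$, $$\|M_{\alpha\Phi,S}\|^2=\frac{1-q^{\alpha_1+1}t^{c(r_\alpha(1),S)}}{1-q}\|M_{\alpha,S}\|^2,$$ and if $\alpha_i=\alpha_{i+1}$, $j=r_\alpha(i)$ and $m=c(j,S)-c(j+1,S)\ge2$, then $\|M_{\alpha,S^{(j)}}\|^2=\frac{(1-t^{1-m})(t-t^{-m})}{(1-t^{-m})^2}\|M_{\alpha,S}\|^2$.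 -/

import Mathlib

open scoped TensorProduct

namespace VVMac

/-! Throughout, the number of variables is `N = n + 1`; variables, entries of tableaux and
positions in compositions are indexed from `0` by `Fin (n + 1)`, and the adjacent transposition
`s_i` and the generator `T_i` of the Hecke algebra (`1 ≤ i < N`) are indexed from `0` by `Fin n`,
so that the index `i : Fin n` refers to the positions `i.castSucc` and `i.succ`.
All operators act on the right: `f A B` is `B (A f)`. -/

section Tableaux

variable {n : ℕ} {μ : YoungDiagram}

/-- The filling that puts the number `k` in the box `e k` decreases along rows and columns. -/
def IsReverseStandard (e : Fin (n + 1) ≃ {c // c ∈ μ.cells}) : Prop :=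
  (∀ a b, (e a).1.1 = (e b).1.1 → (e a).1.2 < (e b).1.2 → b < a) ∧
  (∀ a b, (e a).1.2 = (e b).1.2 → (e a).1.1 < (e b).1.1 → b < a)

variable (n μ) in
/-- Reverse standard Young tableaux of shape `μ`; `S.1 k` is the box of the entry `k`. -/
def RSYT : Type := {e : Fin (n + 1) ≃ {c // c ∈ μ.cells} // IsReverseStandard e}

namespace RSYT

/-- The row of the entry `k`. -/
def row (S : RSYT n μ) (k : Fin (n + 1)) : ℕ := (S.1 k).1.1

/-- The column of the entry `k`. -/
def col (S : RSYT n μ) (k : Fin (n + 1)) : ℕ := (S.1 k).1.2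

/-- The content `c(k, S)` of the entry `k`. -/
def content (S : RSYT n μ) (k : Fin (n + 1)) : ℤ := (S.col k : ℤ) - (S.row k : ℤ)

end RSYT

theorem lt_of_swap_lt (i : Fin n) {a b : Fin (n + 1)}
    (h : Equiv.swap i.castSucc i.succ b < Equiv.swap i.castSucc i.succ a)
    (hab : ¬ (a = i.castSucc ∧ b = i.succ)) : b < a := by
  rw [Equiv.swap_apply_def, Equiv.swap_apply_def] at h
  rw [Fin.lt_def] at h ⊢
  simp only [Fin.ext_iff] at hab
  split_ifs at h <;> simp_all [Fin.ext_iff] <;> omega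

theorem isReverseStandard_swap (S : RSYT n μ) (i : Fin n)
    (hr : S.row i.castSucc ≠ S.row i.succ) (hc : S.col i.castSucc ≠ S.col i.succ) :
    IsReverseStandard ((Equiv.swap i.castSucc i.succ).trans S.1) := by
  refine ⟨fun a b h1 h2 => lt_of_swap_lt i (S.2.1 _ _ h1 h2) ?_,
    fun a b h1 h2 => lt_of_swap_lt i (S.2.2 _ _ h1 h2) ?_⟩
  · rintro ⟨rfl, rfl⟩
    simp only [Equiv.trans_apply, Equiv.swap_apply_left, Equiv.swap_apply_right] at h1
    exact hr h1.symm
  · rintro ⟨rfl, rfl⟩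
    simp only [Equiv.trans_apply, Equiv.swap_apply_left, Equiv.swap_apply_right] at h1
    exact hc h1.symm

open Classical in
/-- `S^{(i)}`: the entries `i` and `i + 1` of `S` are exchanged. This is used only when these
entries lie in different rows and columns (otherwise the value is `S`). -/
noncomputable def RSYT.exch (S : RSYT n μ) (i : Fin n) : RSYT n μ :=
  if h : S.row i.castSucc ≠ S.row i.succ ∧ S.col i.castSucc ≠ S.col i.succ then
    ⟨(Equiv.swap i.castSucc i.succ).trans S.1, isReverseStandard_swap S i h.1 h.2⟩
  else S

end Tableaux

section Compositions

variable {n : ℕ}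

/-- The rank function `r_α(i) = #{j : α_j > α_i} + #{j ≤ i : α_j = α_i}`, shifted to start
from `0`. -/
def rank (α : Fin (n + 1) → ℕ) (i : Fin (n + 1)) : Fin (n + 1) :=
  ⟨(Finset.univ.filter fun j => α i < α j).card +
    (Finset.univ.filter fun j => j < i ∧ α j = α i).card, by
    rw [← Finset.card_union_of_disjoint]
    · refine lt_of_lt_of_eq (Finset.card_lt_univ_of_notMem (x := i) ?_) (by simp)
      simp
    · rw [Finset.disjoint_left]
      intro j h1 h2
      simp only [Finset.mem_filter, Finset.mem_univ, true_and] at h1 h2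
      omega⟩

/-- The nonincreasing rearrangement `α⁺`. -/
def plus (α : Fin (n + 1) → ℕ) : Fin (n + 1) → ℕ := fun i => α (Tuple.sort α i.rev)

/-- `α.s_i`. -/
def swapAt (α : Fin (n + 1) → ℕ) (i : Fin n) : Fin (n + 1) → ℕ :=
  fun j => α (Equiv.swap i.castSucc i.succ j)

/-- `αΦ = (α_2, …, α_N, α_1 + 1)`. -/
def affine (α : Fin (n + 1) → ℕ) : Fin (n + 1) → ℕ :=
  Fin.snoc (α := fun _ => ℕ) (fun i : Fin n => α i.succ) (α 0 + 1)

/-- `k(λ) = ∑ (N - 2 i + 1) λ_i`. -/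
def kExp (lam : Fin (n + 1) → ℕ) : ℤ := ∑ i : Fin (n + 1), ((n : ℤ) - 2 * (i : ℕ)) * lam i

end Compositions

variable {K : Type*} [Field K] {n : ℕ} {μ : YoungDiagram}

section DividedDifference

open MvPolynomial

theorem X_sub_X_dvd (i : Fin n) (p : MvPolynomial (Fin (n + 1)) K) :
    (X i.castSucc - X i.succ : MvPolynomial (Fin (n + 1)) K) ∣
      p - rename (Equiv.swap i.castSucc i.succ) p := by
  induction p using MvPolynomial.induction_on with
  | C a => simp
  | add p r hp hr =>
    have h := dvd_add hp hr
    rw [map_add]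
    convert h using 1
    ring
  | mul_X p j hp =>
    rw [map_mul, rename_X]
    have hj : (X i.castSucc - X i.succ : MvPolynomial (Fin (n + 1)) K) ∣
        X j - X (Equiv.swap i.castSucc i.succ j) := by
      rw [Equiv.swap_apply_def]
      split_ifs with h1 h2
      · subst h1
        exact dvd_rfl
      · subst h2
        exact ⟨-1, by ring⟩
      · simp
    have h := dvd_add (Dvd.dvd.mul_right hp (X j))
      (Dvd.dvd.mul_left hj (rename (Equiv.swap i.castSucc i.succ) p))
    convert h using 1
    ring

theorem X_sub_X_ne_zero (i : Fin n) :
    (X i.castSucc - X i.succ : MvPolynomial (Fin (n + 1)) K) ≠ 0 := by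
  rw [sub_ne_zero]
  intro h
  exact absurd (X_injective h) (by simp [Fin.ext_iff])

/-- The divided difference `p ↦ (p(x) - p(x.s_i)) / (x_i - x_{i+1})`. -/
noncomputable def divDiff (i : Fin n) :
    MvPolynomial (Fin (n + 1)) K →ₗ[K] MvPolynomial (Fin (n + 1)) K where
  toFun p := (X_sub_X_dvd i p).choose
  map_add' p r := by
    apply mul_left_cancel₀ (X_sub_X_ne_zero (K := K) i)
    rw [mul_add, ← (X_sub_X_dvd i (p + r)).choose_spec, ← (X_sub_X_dvd i p).choose_spec,
      ← (X_sub_X_dvd i r).choose_spec, map_add]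
    ring
  map_smul' a p := by
    apply mul_left_cancel₀ (X_sub_X_ne_zero (K := K) i)
    rw [RingHom.id_apply, mul_smul_comm, ← (X_sub_X_dvd i (a • p)).choose_spec,
      ← (X_sub_X_dvd i p).choose_spec, map_smul, smul_sub]

theorem X_sub_X_mul_divDiff (i : Fin n) (p : MvPolynomial (Fin (n + 1)) K) :
    (X i.castSucc - X i.succ) * divDiff i p = p - rename (Equiv.swap i.castSucc i.succ) p :=
  (X_sub_X_dvd i p).choose_spec.symm

end DividedDifference

section Operators

variable (K n μ) in
/-- `V_τ`, the vector space with basis the reverse standard tableaux of shape `τ`. -/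
abbrev V : Type _ := RSYT n μ →₀ K

variable (K n μ) in
/-- `P_τ = P ⊗ V_τ`. -/
abbrev PV : Type _ := MvPolynomial (Fin (n + 1)) K ⊗[K] V K n μ

/-- The composition `A_1 A_2 ⋯ A_k` of operators acting on the right (`A_1` acts first). -/
def rightProd {W : Type*} [AddCommGroup W] [Module K W] (l : List (W →ₗ[K] W)) : W →ₗ[K] W :=
  l.foldl (fun acc A => A ∘ₗ acc) LinearMap.id

/-- The vector `S τ(T_i)`. -/
noncomputable def tauBasis (t : K) (i : Fin n) (S : RSYT n μ) : V K n μ :=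
  if S.row i.castSucc = S.row i.succ then Finsupp.single S t
  else if S.col i.castSucc = S.col i.succ then Finsupp.single S (-1)
  else if 2 ≤ S.content i.castSucc - S.content i.succ then
    Finsupp.single (S.exch i) 1 +
      Finsupp.single S ((t - 1) / (1 - t ^ (S.content i.succ - S.content i.castSucc)))
  else
    let b : ℤ := S.content i.castSucc - S.content i.succ
    Finsupp.single (S.exch i)
        (t * (t ^ (b + 1) - 1) * (t ^ (b - 1) - 1) / (t ^ b - 1) ^ 2) +
      Finsupp.single S (t ^ b * (t - 1) / (t ^ b - 1))

/-- The action `τ(T_i)` on `V_τ`. -/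
noncomputable def tauT (t : K) (i : Fin n) : V K n μ →ₗ[K] V K n μ :=
  Finsupp.linearCombination K (tauBasis t i)

/-- `τ(ω)`, where `ω = T_1 T_2 ⋯ T_{N-1}`. -/
noncomputable def tauOmega (t : K) : V K n μ →ₗ[K] V K n μ :=
  rightProd ((List.finRange n).map (tauT t))

/-- The operator `𝑻_i` on `P_τ`:
`p ⊗ S ↦ (1 - t) x_{i+1} (p - p s_i) / (x_i - x_{i+1}) ⊗ S + p s_i ⊗ S τ(T_i)`. -/
noncomputable def opT (t : K) (i : Fin n) : PV K n μ →ₗ[K] PV K n μ :=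
  TensorProduct.map
      ((1 - t) • (LinearMap.mulLeft K (MvPolynomial.X i.succ) ∘ₗ divDiff i)) LinearMap.id +
    TensorProduct.map
      (MvPolynomial.rename (Equiv.swap i.castSucc i.succ)).toLinearMap (tauT t i)

/-- `𝑻_i⁻¹ = t⁻¹ (𝑻_i + 1 - t)`. -/
noncomputable def opTinv (t : K) (i : Fin n) : PV K n μ →ₗ[K] PV K n μ :=
  t⁻¹ • (opT t i + (1 - t) • LinearMap.id)

/-- The operator `𝒘`: `p ⊗ S ↦ p(q x_N, x_1, …, x_{N-1}) ⊗ S τ(ω)`. -/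
noncomputable def opW (q t : K) : PV K n μ →ₗ[K] PV K n μ :=
  TensorProduct.map
    (MvPolynomial.aeval (Fin.cons (α := fun _ => MvPolynomial (Fin (n + 1)) K)
      (MvPolynomial.C q * MvPolynomial.X (Fin.last n))
      (fun k : Fin n => MvPolynomial.X k.castSucc))).toLinearMap
    (tauOmega t)

/-- The Cherednik operator
`𝝃_i = t^{i-N} 𝑻_{i-1}⁻¹ ⋯ 𝑻_1⁻¹ 𝒘 𝑻_{N-1} ⋯ 𝑻_i`. -/
noncomputable def opXi (q t : K) (i : Fin (n + 1)) : PV K n μ →ₗ[K] PV K n μ :=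
  t ^ ((i : ℤ) - (n : ℤ)) • rightProd
    ((((List.finRange n).filter fun k => k.val < i.val).reverse.map (opTinv t)) ++ [opW q t] ++
      (((List.finRange n).filter fun k => i.val ≤ k.val).reverse.map (opT t)))

/-- `𝒘* = 𝑻_{N-1}⁻¹ ⋯ 𝑻_1⁻¹ 𝒘 𝑻_{N-1} ⋯ 𝑻_1`. -/
noncomputable def opWstar (q t : K) : PV K n μ →ₗ[K] PV K n μ :=
  rightProd (((List.finRange n).reverse.map (opTinv t)) ++ [opW q t] ++
    ((List.finRange n).reverse.map (opT t)))

variable (K n μ) in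
/-- Multiplication by `x_N`. -/
noncomputable def mulXN : PV K n μ →ₗ[K] PV K n μ :=
  TensorProduct.map (LinearMap.mulLeft K (MvPolynomial.X (Fin.last n))) LinearMap.id

variable (K n μ) in
/-- Division by `x_N` (the monomials that `x_N` does not divide are dropped). -/
noncomputable def divXN : PV K n μ →ₗ[K] PV K n μ :=
  TensorProduct.map
    { toFun := fun p : MvPolynomial (Fin (n + 1)) K =>
        p.divMonomial (Finsupp.single (Fin.last n) 1)
      map_add' := fun p r => MvPolynomial.add_divMonomial p r _
      map_smul' := fun a p => by
        ext s
        simp [MvPolynomial.coeff_divMonomial] }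
    LinearMap.id

/-- The Dunkl operator `𝓓_N : f ↦ (f - f 𝝃_N) / x_N`. -/
noncomputable def opD (q t : K) : PV K n μ →ₗ[K] PV K n μ :=
  divXN K n μ ∘ₗ (LinearMap.id - opXi q t (Fin.last n))

/-- The element `1 ⊗ S` of `P_τ`. -/
noncomputable def const (S : RSYT n μ) : PV K n μ := 1 ⊗ₜ[K] Finsupp.single S 1

end Operators

section Macdonald

/-- The spectral vector `ζ_{α,S}(i) = q^{α_i} t^{c(r_α(i), S)}`. -/
def zeta (q t : K) (α : Fin (n + 1) → ℕ) (S : RSYT n μ) (i : Fin (n + 1)) : K :=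
  q ^ α i * t ^ S.content (rank α i)

/-- The polynomial
`f 𝑻_i + (t - 1) / (ζ_{α,S}(i+1) / ζ_{α,S}(i) - 1) f` attached to a step. -/
noncomputable def stepPoly (q t : K) (α : Fin (n + 1) → ℕ) (S : RSYT n μ) (i : Fin n)
    (f : PV K n μ) : PV K n μ :=
  opT t i f + ((t - 1) / (zeta q t α S i.succ / zeta q t α S i.castSucc - 1)) • f

/-- The nodes of the Yang–Baxter graph: `YBNode q t α S f` says that some path in the graph
produces the polynomial `f` at the label `(α, S)`. -/
inductive YBNode (q t : K) : (Fin (n + 1) → ℕ) → RSYT n μ → PV K n μ → Prop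
  | root (S : RSYT n μ) : YBNode q t (fun _ => 0) S (const S)
  | step (α : Fin (n + 1) → ℕ) (S : RSYT n μ) (f : PV K n μ) (i : Fin n)
      (hi : α i.castSucc < α i.succ) (hf : YBNode q t α S f) :
      YBNode q t (swapAt α i) S (stepPoly q t α S i f)
  | exch (α : Fin (n + 1) → ℕ) (S : RSYT n μ) (f : PV K n μ) (i j : Fin n)
      (hi : α i.castSucc = α i.succ) (hj : rank α i.castSucc = j.castSucc)
      (hc : 2 ≤ S.content j.castSucc - S.content j.succ) (hf : YBNode q t α S f) :
      YBNode q t α (S.exch j) (stepPoly q t α S i f)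
  | affine (α : Fin (n + 1) → ℕ) (S : RSYT n μ) (f : PV K n μ) (hf : YBNode q t α S f) :
      YBNode q t (affine α) S (mulXN K n μ (opW q t f))

/-- The vector-valued nonsymmetric Macdonald polynomial `M_{α,S}`: the polynomial that the
Yang–Baxter graph produces at the label `(α, S)`. -/
noncomputable def macdonald (q t : K) (α : Fin (n + 1) → ℕ) (S : RSYT n μ) : PV K n μ :=
  Classical.epsilon fun f => YBNode q t α S f

end Macdonald

section Norms

/-- `u(z) = (t - z)(1 - t z) / (1 - z)²`. -/
def u (t z : K) : K := (t - z) * (1 - t * z) / (1 - z) ^ 2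

/-- `(z; q)_m = ∏_{i=1}^m (1 - z q^{i-1})`. -/
def qPoch (q z : K) (m : ℕ) : K := ∏ i ∈ Finset.range m, (1 - z * q ^ i)

/-- `‖S‖₀²`. -/
def normS (t : K) (S : RSYT n μ) : K :=
  ∏ p ∈ (Finset.univ : Finset (Fin (n + 1) × Fin (n + 1))).filter
    (fun p => p.1 < p.2 ∧ 2 ≤ S.content p.2 - S.content p.1),
    u t (t ^ (S.content p.1 - S.content p.2))

/-- `𝓔(α, S)`. -/
def scrE (q t : K) (α : Fin (n + 1) → ℕ) (S : RSYT n μ) : K :=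
  ∏ p ∈ (Finset.univ : Finset (Fin (n + 1) × Fin (n + 1))).filter
    (fun p => p.1 < p.2 ∧ α p.1 < α p.2),
    u t (q ^ (α p.2 - α p.1) * t ^ (S.content (rank α p.2) - S.content (rank α p.1)))

/-- The value prescribed for `‖M_{λ,S}‖²` when `λ` is a partition. -/
def normPart (q t : K) (lam : Fin (n + 1) → ℕ) (S : RSYT n μ) : K :=
  t ^ kExp lam * normS t S * ((1 - q) ^ (∑ i, lam i))⁻¹ *
    (∏ i, qPoch q (q * t ^ S.content i) (lam i)) *
    ∏ p ∈ (Finset.univ : Finset (Fin (n + 1) × Fin (n + 1))).filter (fun p => p.1 < p.2),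
      qPoch q (q * t ^ (S.content p.1 - S.content p.2 - 1)) (lam p.1 - lam p.2) *
        qPoch q (q * t ^ (S.content p.1 - S.content p.2 + 1)) (lam p.1 - lam p.2) /
        qPoch q (q * t ^ (S.content p.1 - S.content p.2)) (lam p.1 - lam p.2) ^ 2

end Norms

section Forms

/-- The values that define the form on the Macdonald polynomials. -/
structure IsMacdonaldForm (q t : K) (B : LinearMap.BilinForm K (PV K n μ)) : Prop where
  partition : ∀ (lam : Fin (n + 1) → ℕ) (S : RSYT n μ), Antitone lam →
    B (macdonald q t lam S) (macdonald q t lam S) = normPart q t lam S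
  composition : ∀ (α : Fin (n + 1) → ℕ) (S : RSYT n μ),
    B (macdonald q t α S) (macdonald q t α S) =
      (scrE q t α S)⁻¹ * B (macdonald q t (plus α) S) (macdonald q t (plus α) S)
  orthogonal : ∀ (α β : Fin (n + 1) → ℕ) (S S' : RSYT n μ), (α, S) ≠ (β, S') →
    B (macdonald q t α S) (macdonald q t β S') = 0

/-- The postulates for the symmetric bilinear form on `P_τ`. -/
structure FormPostulates (q t : K) (B : LinearMap.BilinForm K (PV K n μ)) : Prop where
  symm : ∀ f g, B f g = B g f
  const_self : ∀ S : RSYT n μ, B (const S) (const S) = normS t S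
  const_ne : ∀ S S' : RSYT n μ, S ≠ S' → B (const S) (const S') = 0
  selfAdjoint_T : ∀ (i : Fin n) (f g), B (opT t i f) g = B f (opT t i g)
  selfAdjoint_xi : ∀ f g, B (opXi q t (Fin.last n) f) g = B f (opXi q t (Fin.last n) g)
  dunkl : ∀ f g, B (opD q t f) g =
    (1 - q) * B f (mulXN K n μ (opW q t (opWstar q t g)))

end Forms

end VVMac

/-! A label (α, S) is encoded by its exponent vector `zvec α S`, the sequence of pairs (α_i,
c(r_α(i), S)). Contents determine a tableau, so this vector determines the label, and by genericity
so does the vector of spectral values. The two finite kinds of arrow of the Yang–Baxter graph become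
one operation, the exchange of two neighbouring pairs that increase for `Prec`; the affine arrow
becomes a rotation.

On the operator side, the exchange is the intertwiner T_i + b, which interchanges the eigenvalues of
ξ_i and ξ_{i+1} (`AffineHeckeRel.inter_eigen`), and f ↦ x_N (f w) permutes the ξ_i cyclically up to
one factor q (`AffineHeckeRel.xi_mul_xw`, `AffineHeckeRel.xi_last_mul_xw`). Both rest on the
relations collected in `affineHeckeRel`. These are verified on constants, where they are relations
for τ, and carried to all of P_τ by multiplication with the variables.

Path independence is a confluence argument by induction on labels (`label_induction`). Two different
last arrows into a label are completed downwards to a common source: by commuting intertwiners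
(`swap_swap_far`), by a Yang–Baxter hexagon (`swap_swap_near`), or by moving an intertwiner through
the rotation (`swap_affine`). The polynomials are nonzero because an exchange followed by its
reverse multiplies by some u ≠ 0. Being joint eigenvectors with distinct spectra they are
independent, and a count in bounded degree shows that they span (`span_macdonald`).

The prescribed norm is `normS` times a function `specNorm` of the exponent vector alone
(`macNorm_eq`). Along an exchange it is multiplied by the same u that arises from composing the two
opposite intertwiners, so the intertwiners, and with them the T_i, are self-adjoint. If the
exchanged vector belongs to no label, the intertwiner vanishes, since its value would be a joint
eigenvector whose spectrum no basis vector has (`inter_macdonald_eq_zero`). The ξ_i are diagonal, w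
is a product of the T_i and ξ_N, and so w* is its adjoint. Finally D_N either kills a basis vector
or undoes the affine arrow, and the norm ratio along that arrow gives the Dunkl identity. -/

namespace VVMac

/-! ### Contents of reverse standard tableaux -/

section Combinatorics

variable {n : ℕ} {μ : YoungDiagram}

namespace RSYT

theorem box_mem (S : RSYT n μ) (k : Fin (n + 1)) : (S.row k, S.col k) ∈ μ := (S.1 k).2

theorem exists_box (S : RSYT n μ) {r c : ℕ} (h : (r, c) ∈ μ) :
    ∃ k, S.row k = r ∧ S.col k = c := by
  refine ⟨S.1.symm ⟨(r, c), h⟩, ?_, ?_⟩ <;> simp [row, col]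

theorem eq_of_box (S : RSYT n μ) {a b : Fin (n + 1)} (hr : S.row a = S.row b)
    (hc : S.col a = S.col b) : a = b :=
  S.1.injective (Subtype.ext (Prod.ext hr hc))

theorem ext_box {S S' : RSYT n μ} (hr : ∀ k, S.row k = S'.row k) (hc : ∀ k, S.col k = S'.col k) :
    S = S' :=
  Subtype.ext (Equiv.ext fun k => Subtype.ext (Prod.ext (hr k) (hc k)))

theorem lt_of_row_lt (S : RSYT n μ) {a b : Fin (n + 1)} (hc : S.col a = S.col b)
    (hr : S.row a < S.row b) : b < a := S.2.2 a b hc hr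

theorem lt_of_col_lt (S : RSYT n μ) {a b : Fin (n + 1)} (hr : S.row a = S.row b)
    (hc : S.col a < S.col b) : b < a := S.2.1 a b hr hc

/-- Compare both entries with the one in the row of `a` and the column of `b`, a box that lies
weakly above that of `b` and hence in the diagram. -/
theorem le_of_box_le (S : RSYT n μ) {a b : Fin (n + 1)} (hr : S.row a ≤ S.row b)
    (hc : S.col a ≤ S.col b) : b ≤ a := by
  obtain ⟨k, hk1, hk2⟩ := S.exists_box (r := S.row a) (c := S.col b)
    (μ.up_left_mem hr le_rfl (S.box_mem b))
  have h1 : b ≤ k := by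
    rcases hr.lt_or_eq with h | h
    · exact (S.lt_of_row_lt hk2 (hk1.trans_lt h)).le
    · exact (S.eq_of_box (hk1.trans h) hk2).ge
  have h2 : k ≤ a := by
    rcases hc.lt_or_eq with h | h
    · exact (S.lt_of_col_lt hk1.symm (h.trans_eq hk2.symm)).le
    · exact (S.eq_of_box hk1 (hk2.trans h.symm)).le
  exact h1.trans h2

theorem lt_of_box_le (S : RSYT n μ) {a b : Fin (n + 1)} (hr : S.row a ≤ S.row b)
    (hc : S.col a ≤ S.col b) (hne : S.row a < S.row b ∨ S.col a < S.col b) : b < a := by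
  refine lt_of_le_of_ne (S.le_of_box_le hr hc) ?_
  rintro rfl
  omega

/-- The greatest entry occupies the corner. This matches the fact that ξ_N acts as the identity on
constants. -/
theorem content_last (S : RSYT n μ) : S.content (Fin.last n) = 0 := by
  obtain ⟨k, h1, h2⟩ := S.exists_box (r := 0) (c := 0)
    (μ.up_left_mem (Nat.zero_le _) (Nat.zero_le _) (S.box_mem 0))
  have h : Fin.last n ≤ k := S.le_of_box_le (by omega) (by omega)
  obtain rfl : k = Fin.last n := le_antisymm (Fin.le_last _) h
  simp [content, h1, h2]

/-- Between two entries of equal content lie the entries of two further boxes. -/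
theorem exists_between (S : RSYT n μ) {a b : Fin (n + 1)} (hab : a < b)
    (h : S.content a = S.content b) :
    ∃ k l, k ≠ l ∧ a < k ∧ k < b ∧ a < l ∧ l < b := by
  simp only [content] at h
  have hlt : S.row b < S.row a := by
    by_contra hcon
    have := S.le_of_box_le (a := a) (b := b) (by omega) (by omega)
    omega
  -- The neighbours of the box of `b` to the right and below; both lie between the two boxes on the
  -- diagonal, so their entries lie between `a` and `b`.
  obtain ⟨k, hk1, hk2⟩ := S.exists_box (r := S.row b) (c := S.col b + 1)
    (μ.up_left_mem (by omega) (by omega) (S.box_mem a))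
  obtain ⟨l, hl1, hl2⟩ := S.exists_box (r := S.row b + 1) (c := S.col b)
    (μ.up_left_mem (by omega) (by omega) (S.box_mem a))
  refine ⟨k, l, ?_, S.lt_of_box_le ?_ ?_ ?_, S.lt_of_box_le ?_ ?_ ?_, S.lt_of_box_le ?_ ?_ ?_,
    S.lt_of_box_le ?_ ?_ ?_⟩ <;> (try omega)
  rintro rfl
  omega

/-- Entries at distance at most two leave no room for the two entries of `exists_between`. Distance
two is what the braid relation needs. -/
theorem content_ne_of_sub_le_two (S : RSYT n μ) {a b : Fin (n + 1)} (hab : a < b)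
    (h : (b : ℕ) ≤ a + 2) : S.content a ≠ S.content b := by
  intro hc
  obtain ⟨k, l, hkl, h1, h2, h3, h4⟩ := S.exists_between hab hc
  simp only [Fin.lt_def, ne_eq, Fin.ext_iff] at *
  omega

/-- Otherwise either the two entries are in the wrong order, or some box lies strictly between
theirs and its entry would lie strictly between consecutive integers. Together with the next three
lemmas this makes "same row" and "same column" synonymous with content difference 1 and -1. -/
theorem row_eq_of_content (S : RSYT n μ) (j : Fin n)
    (h : S.content j.castSucc - S.content j.succ = 1) : S.row j.castSucc = S.row j.succ := by
  simp only [content] at h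
  rcases lt_trichotomy (S.row j.castSucc) (S.row j.succ) with hlt | heq | hlt
  · have := S.le_of_box_le (a := j.castSucc) (b := j.succ) (by omega) (by omega)
    simp [Fin.le_def] at this
  · exact heq
  · obtain ⟨k, hk1, hk2⟩ := S.exists_box (r := S.row j.succ) (c := S.col j.succ + 1)
      (μ.up_left_mem (by omega) (by omega) (S.box_mem j.castSucc))
    have h1 : j.castSucc < k := S.lt_of_box_le (by omega) (by omega) (by omega)
    have h2 : k < j.succ := S.lt_of_box_le (by omega) (by omega) (by omega)
    simp [Fin.lt_def] at h1 h2
    omega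

theorem col_eq_of_content (S : RSYT n μ) (j : Fin n)
    (h : S.content j.castSucc - S.content j.succ = -1) : S.col j.castSucc = S.col j.succ := by
  simp only [content] at h
  rcases lt_trichotomy (S.col j.castSucc) (S.col j.succ) with hlt | heq | hlt
  · have := S.le_of_box_le (a := j.castSucc) (b := j.succ) (by omega) (by omega)
    simp [Fin.le_def] at this
  · exact heq
  · obtain ⟨k, hk1, hk2⟩ := S.exists_box (r := S.row j.succ + 1) (c := S.col j.succ)
      (μ.up_left_mem (by omega) (by omega) (S.box_mem j.castSucc))
    have h1 : j.castSucc < k := S.lt_of_box_le (by omega) (by omega) (by omega)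
    have h2 : k < j.succ := S.lt_of_box_le (by omega) (by omega) (by omega)
    simp [Fin.lt_def] at h1 h2
    omega

theorem content_of_row_eq (S : RSYT n μ) (j : Fin n) (h : S.row j.castSucc = S.row j.succ) :
    S.content j.castSucc - S.content j.succ = 1 := by
  have hlt : S.col j.succ < S.col j.castSucc := by
    by_contra hcon
    have := S.le_of_box_le (a := j.castSucc) (b := j.succ) (by omega) (by omega)
    simp [Fin.le_def] at this
  by_contra hne
  simp only [content] at hne
  obtain ⟨k, hk1, hk2⟩ := S.exists_box (r := S.row j.succ) (c := S.col j.succ + 1)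
    (μ.up_left_mem (by omega) (by omega) (S.box_mem j.castSucc))
  have h1 : j.castSucc < k := S.lt_of_box_le (by omega) (by omega) (by omega)
  have h2 : k < j.succ := S.lt_of_box_le (by omega) (by omega) (by omega)
  simp [Fin.lt_def] at h1 h2
  omega

theorem content_of_col_eq (S : RSYT n μ) (j : Fin n) (h : S.col j.castSucc = S.col j.succ) :
    S.content j.castSucc - S.content j.succ = -1 := by
  have hlt : S.row j.succ < S.row j.castSucc := by
    by_contra hcon
    have := S.le_of_box_le (a := j.castSucc) (b := j.succ) (by omega) (by omega)
    simp [Fin.le_def] at this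
  by_contra hne
  simp only [content] at hne
  obtain ⟨k, hk1, hk2⟩ := S.exists_box (r := S.row j.succ + 1) (c := S.col j.succ)
    (μ.up_left_mem (by omega) (by omega) (S.box_mem j.castSucc))
  have h1 : j.castSucc < k := S.lt_of_box_le (by omega) (by omega) (by omega)
  have h2 : k < j.succ := S.lt_of_box_le (by omega) (by omega) (by omega)
  simp [Fin.lt_def] at h1 h2
  omega

theorem content_sub_ne_zero (S : RSYT n μ) (j : Fin n) :
    S.content j.castSucc - S.content j.succ ≠ 0 := by
  rw [sub_ne_zero]
  exact S.content_ne_of_sub_le_two (by simp [Fin.lt_def]) (by simp)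

theorem row_ne_col_ne (S : RSYT n μ) (j : Fin n)
    (h : 2 ≤ |S.content j.castSucc - S.content j.succ|) :
    S.row j.castSucc ≠ S.row j.succ ∧ S.col j.castSucc ≠ S.col j.succ := by
  refine ⟨fun h' => ?_, fun h' => ?_⟩
  · rw [S.content_of_row_eq j h'] at h
    norm_num at h
  · rw [S.content_of_col_eq j h'] at h
    norm_num at h

theorem exch_eq (S : RSYT n μ) (j : Fin n)
    (h : 2 ≤ |S.content j.castSucc - S.content j.succ|) :
    (S.exch j).1 = (Equiv.swap j.castSucc j.succ).trans S.1 :=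
  congrArg Subtype.val (dif_pos (S.row_ne_col_ne j h))

theorem content_exch (S : RSYT n μ) (j : Fin n)
    (h : 2 ≤ |S.content j.castSucc - S.content j.succ|) (k : Fin (n + 1)) :
    (S.exch j).content k = S.content (Equiv.swap j.castSucc j.succ k) := by
  simp only [content, row, col, exch_eq S j h, Equiv.trans_apply]

theorem exch_eq_self (S : RSYT n μ) (j : Fin n)
    (h : ¬ 2 ≤ |S.content j.castSucc - S.content j.succ|) : S.exch j = S := by
  have h0 := S.content_sub_ne_zero j
  refine dif_neg ?_
  rintro ⟨h1, h2⟩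
  have h3 := abs_lt.1 (not_le.1 h)
  rcases lt_or_gt_of_ne h0 with h4 | h4
  · exact h2 (S.col_eq_of_content j (by omega))
  · exact h1 (S.row_eq_of_content j (by omega))

theorem exch_exch (S : RSYT n μ) (j : Fin n) : (S.exch j).exch j = S := by
  by_cases h : 2 ≤ |S.content j.castSucc - S.content j.succ|
  · have h' : 2 ≤ |(S.exch j).content j.castSucc - (S.exch j).content j.succ| := by
      rw [content_exch S j h, content_exch S j h, Equiv.swap_apply_left, Equiv.swap_apply_right,
        abs_sub_comm]
      exact h
    apply Subtype.ext
    rw [exch_eq _ j h', exch_eq S j h]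
    ext k <;> simp
  · rw [exch_eq_self S j h, exch_eq_self S j h]

/-- The content vector determines the position on the diagonal. -/
theorem card_content_eq (S : RSYT n μ) (k : Fin (n + 1)) :
    (Finset.univ.filter fun l => k < l ∧ S.content l = S.content k).card =
      min (S.row k) (S.col k) := by
  rw [← Finset.card_range (min (S.row k) (S.col k))]
  -- The greater entries of equal content are those further up the diagonal; each is indexed by its
  -- distance minus one.
  refine Finset.card_bij (fun l _ => S.row k - S.row l - 1) ?_ ?_ ?_
  · intro l hl
    obtain ⟨hl1, hl2⟩ := (Finset.mem_filter.1 hl).2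
    simp only [content] at hl2
    rw [Finset.mem_range]
    have : S.row l < S.row k := by
      by_contra hcon
      have := S.le_of_box_le (a := k) (b := l) (by omega) (by omega)
      omega
    omega
  · intro l hl l' hl' h
    obtain ⟨hl1, hl2⟩ := (Finset.mem_filter.1 hl).2
    obtain ⟨hl3, hl4⟩ := (Finset.mem_filter.1 hl').2
    simp only [content] at hl2 hl4
    have h1 : S.row l < S.row k := by
      by_contra hcon
      have := S.le_of_box_le (a := k) (b := l) (by omega) (by omega)
      omega
    have h2 : S.row l' < S.row k := by
      by_contra hcon
      have := S.le_of_box_le (a := k) (b := l') (by omega) (by omega)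
      omega
    exact S.eq_of_box (by omega) (by omega)
  · intro m hm
    rw [Finset.mem_range] at hm
    obtain ⟨l, hl1, hl2⟩ := S.exists_box (r := S.row k - m - 1) (c := S.col k - m - 1)
      (μ.up_left_mem (by omega) (by omega) (S.box_mem k))
    refine ⟨l, ?_, by omega⟩
    rw [Finset.mem_filter]
    refine ⟨Finset.mem_univ _, S.lt_of_box_le (by omega) (by omega) (by omega), ?_⟩
    simp only [content]
    omega

/-- The content is column minus row, and by `card_content_eq` the minimum of row and column is a
count of contents; the two numbers give the box. -/
theorem content_injective {S S' : RSYT n μ} (h : ∀ k, S.content k = S'.content k) : S = S' := by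
  have key : ∀ k, min (S.row k) (S.col k) = min (S'.row k) (S'.col k) := by
    intro k
    rw [← card_content_eq, ← card_content_eq]
    simp [h]
  refine ext_box (fun k => ?_) (fun k => ?_) <;>
  · have h1 := key k
    have h2 := h k
    simp only [content] at h2
    omega

/-- Exchanging two adjacent entries of a tableau in neighbouring boxes never gives the content
vector of a tableau. -/
theorem two_le_of_content_swap {S S' : RSYT n μ} (j : Fin n)
    (h : ∀ k, S'.content k = S.content (Equiv.swap j.castSucc j.succ k)) :
    2 ≤ |S.content j.castSucc - S.content j.succ| := by
  have a1 : S'.content j.castSucc = S.content j.succ := by rw [h, Equiv.swap_apply_left]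
  have a2 : S'.content j.succ = S.content j.castSucc := by rw [h, Equiv.swap_apply_right]
  -- Counting only the entries beyond `j + 1` makes the count blind to the exchange. Hence `S'`
  -- fills the same two boxes as `S`, with the entries exchanged.
  have hcard : ∀ (R : RSYT n μ) (hR : R.content j.castSucc ≠ R.content j.succ) (x : ℤ) (k),
      (k = j.castSucc ∨ k = j.succ) → x = R.content k →
      (Finset.univ.filter fun l => j.succ < l ∧ R.content l = x).card =
        min (R.row k) (R.col k) := by
    intro R hR x k hk hx
    rw [← card_content_eq]
    congr 1
    ext l
    simp only [Finset.mem_filter, Finset.mem_univ, true_and, hx]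
    refine and_congr_left fun hl => ?_
    rcases hk with rfl | rfl
    · constructor
      · intro h1
        exact lt_trans (by simp [Fin.lt_def]) h1
      · intro h1
        refine lt_of_le_of_ne (by simpa [Fin.le_def, Fin.lt_def] using h1) ?_
        rintro rfl
        exact hR hl.symm
    · rfl
  have hSS : ∀ x, (Finset.univ.filter fun l => j.succ < l ∧ S'.content l = x).card =
      (Finset.univ.filter fun l => j.succ < l ∧ S.content l = x).card := by
    intro x
    congr 1
    ext l
    simp only [Finset.mem_filter, Finset.mem_univ, true_and]
    refine and_congr_right fun hl => ?_
    rw [h, Equiv.swap_apply_of_ne_of_ne]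
    · rintro rfl
      simp [Fin.lt_def] at hl
    · rintro rfl
      simp at hl
  have n1 := S.content_sub_ne_zero j
  have n2 := S'.content_sub_ne_zero j
  have b1 := hcard S (sub_ne_zero.1 n1) _ _ (Or.inl rfl) rfl
  have b2 := hcard S (sub_ne_zero.1 n1) _ _ (Or.inr rfl) rfl
  have b3 := hcard S' (sub_ne_zero.1 n2) _ _ (Or.inl rfl) rfl
  have b4 := hcard S' (sub_ne_zero.1 n2) _ _ (Or.inr rfl) rfl
  rw [hSS, a1] at b3
  rw [hSS, a2] at b4
  rw [b2] at b3
  rw [b1] at b4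
  by_contra hlt
  have h3 := abs_lt.1 (not_le.1 hlt)
  have hcases : S.content j.castSucc - S.content j.succ = 1 ∨
      S.content j.castSucc - S.content j.succ = -1 := by omega
  -- The same two boxes would have to share a row for one tableau and a column for the other.
  rcases hcases with hc | hc
  · have r1 := S.row_eq_of_content j hc
    have r2 := S'.col_eq_of_content j (by omega)
    simp only [content] at *
    omega
  · have r1 := S.col_eq_of_content j hc
    have r2 := S'.row_eq_of_content j (by omega)
    simp only [content] at *
    omega

/-- The extra unit on the left leaves room for the zeros of u at t and t⁻¹: excluding them means
applying genericity to content differences shifted by one. -/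
theorem content_sub_content_lt (S S' : RSYT n μ) (k l : Fin (n + 1)) :
    |S.content k - S'.content l| + 1 ≤ (μ.rowLen 0 : ℤ) + (μ.colLen 0 : ℤ) - 1 := by
  have h1 : ∀ (R : RSYT n μ) (m), R.col m < μ.rowLen 0 := fun R m =>
    (YoungDiagram.mem_iff_lt_rowLen).1 (μ.up_left_mem (Nat.zero_le _) le_rfl (R.box_mem m))
  have h2 : ∀ (R : RSYT n μ) (m), R.row m < μ.colLen 0 := fun R m =>
    (YoungDiagram.mem_iff_lt_colLen).1 (μ.up_left_mem le_rfl (Nat.zero_le _) (R.box_mem m))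
  have := h1 S k
  have := h1 S' l
  have := h2 S k
  have := h2 S' l
  simp only [content]
  have : |((S.col k : ℤ) - S.row k) - (S'.col l - S'.row l)| ≤
    (μ.rowLen 0 : ℤ) + (μ.colLen 0 : ℤ) - 2 := by
    rw [abs_le]
    omega
  omega

instance : Finite (RSYT n μ) := by
  unfold RSYT
  infer_instance

end RSYT

end Combinatorics

end VVMac

namespace VVMac

/-! ### The rank function under exchanges and the affine step -/

section Ranks

variable {n : ℕ}

/-- The strict order on positions that `rank α` enumerates. -/
def Beats (α : Fin (n + 1) → ℕ) (k i : Fin (n + 1)) : Prop :=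
  α i < α k ∨ (α k = α i ∧ k < i)

instance (α : Fin (n + 1) → ℕ) (k i : Fin (n + 1)) : Decidable (Beats α k i) := by
  unfold Beats
  infer_instance

theorem rank_val (α : Fin (n + 1) → ℕ) (i : Fin (n + 1)) :
    (rank α i : ℕ) = (Finset.univ.filter fun k => Beats α k i).card := by
  change (Finset.univ.filter fun j => α i < α j).card +
    (Finset.univ.filter fun j => j < i ∧ α j = α i).card = _
  rw [← Finset.card_union_of_disjoint]
  · congr 1
    ext k
    simp only [Finset.mem_union, Finset.mem_filter, Finset.mem_univ, true_and]
    simp only [Beats, and_comm]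
  · rw [Finset.disjoint_left]
    intro j h1 h2
    simp only [Finset.mem_filter, Finset.mem_univ, true_and] at h1 h2
    omega

theorem rank_lt_rank {α : Fin (n + 1) → ℕ} {i j : Fin (n + 1)} (h : Beats α i j) :
    rank α i < rank α j := by
  rw [Fin.lt_def, rank_val, rank_val]
  refine Finset.card_lt_card ⟨fun k hk => ?_, fun hsub => ?_⟩
  · simp only [Finset.mem_filter, Finset.mem_univ, true_and] at hk ⊢
    simp only [Beats, Fin.lt_def] at hk h ⊢
    omega
  · have := hsub (x := i) (by simpa using h)
    simp only [Finset.mem_filter, Finset.mem_univ, true_and] at this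
    simp [Beats] at this

theorem rank_injective (α : Fin (n + 1) → ℕ) : Function.Injective (rank α) := by
  intro i j h
  by_contra hne
  rcases lt_trichotomy (α i) (α j) with h1 | h1 | h1
  · exact (rank_lt_rank (Or.inl h1)).ne' h
  · rcases lt_or_gt_of_ne hne with h2 | h2
    · exact (rank_lt_rank (Or.inr ⟨h1, h2⟩)).ne h
    · exact (rank_lt_rank (Or.inr ⟨h1.symm, h2⟩)).ne' h
  · exact (rank_lt_rank (Or.inl h1)).ne h

/-- The rank function as a permutation of the positions. -/
noncomputable def rankEquiv (α : Fin (n + 1) → ℕ) : Equiv.Perm (Fin (n + 1)) :=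
  Equiv.ofBijective (rank α) (Finite.injective_iff_bijective.1 (rank_injective α))

@[simp] theorem rankEquiv_apply (α : Fin (n + 1) → ℕ) (i : Fin (n + 1)) :
    rankEquiv α i = rank α i := rfl

theorem rank_eq_of_perm {α β : Fin (n + 1) → ℕ} (σ : Equiv.Perm (Fin (n + 1)))
    (h : ∀ k i, Beats β (σ k) (σ i) ↔ Beats α k i) (i : Fin (n + 1)) :
    rank β (σ i) = rank α i := by
  apply Fin.ext
  rw [rank_val, rank_val]
  refine (Finset.card_equiv σ fun k => ?_).symm
  simp [h]

theorem swap_lt_swap_iff (i : Fin n) {a b : Fin (n + 1)}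
    (h1 : ¬ (a = i.castSucc ∧ b = i.succ)) (h2 : ¬ (a = i.succ ∧ b = i.castSucc)) :
    Equiv.swap i.castSucc i.succ a < Equiv.swap i.castSucc i.succ b ↔ a < b := by
  rw [Equiv.swap_apply_def, Equiv.swap_apply_def]
  simp only [Fin.ext_iff, Fin.lt_def] at *
  split_ifs <;> simp_all <;> omega

theorem rank_swapAt {α : Fin (n + 1) → ℕ} {i : Fin n} (h : α i.castSucc ≠ α i.succ)
    (k : Fin (n + 1)) :
    rank (swapAt α i) k = rank α (Equiv.swap i.castSucc i.succ k) := by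
  have := rank_eq_of_perm (α := α) (β := swapAt α i) (Equiv.swap i.castSucc i.succ) (fun k l => by
    simp only [Beats, swapAt, Equiv.swap_apply_self]
    refine or_congr_right (and_congr_right fun hkl => swap_lt_swap_iff i ?_ ?_)
    · rintro ⟨rfl, rfl⟩
      exact h hkl
    · rintro ⟨rfl, rfl⟩
      exact h hkl.symm) (Equiv.swap i.castSucc i.succ k)
  rwa [Equiv.swap_apply_self] at this

@[simp] theorem affine_castSucc (α : Fin (n + 1) → ℕ) (k : Fin n) :
    affine α k.castSucc = α k.succ := by simp [affine]

@[simp] theorem affine_last (α : Fin (n + 1) → ℕ) : affine α (Fin.last n) = α 0 + 1 := by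
  simp [affine]

theorem finRotate_symm_zero : (finRotate (n + 1)).symm 0 = Fin.last n := by
  rw [Equiv.symm_apply_eq, finRotate_last]

theorem finRotate_symm_succ (k : Fin n) : (finRotate (n + 1)).symm k.succ = k.castSucc := by
  rw [Equiv.symm_apply_eq]
  apply Fin.ext
  rw [coe_finRotate_of_ne_last (by simp [Fin.ext_iff]; omega)]
  simp

/-- The first position wins all its ties. Moved to the end it would lose them, but the added 1
restores the wins; an entry greater by exactly 1 becomes tied and still wins by standing earlier. -/
theorem rank_affine (α : Fin (n + 1) → ℕ) (k : Fin (n + 1)) :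
    rank (affine α) ((finRotate (n + 1)).symm k) = rank α k := by
  refine rank_eq_of_perm (finRotate (n + 1)).symm (fun k l => ?_) k
  refine Fin.cases ?_ (fun k => ?_) k <;> refine Fin.cases ?_ (fun l => ?_) l <;>
    simp only [Beats, finRotate_symm_zero, finRotate_symm_succ, affine_castSucc, affine_last,
      Fin.lt_def, Fin.val_succ, Fin.val_castSucc, Fin.val_last, Fin.val_zero] <;> omega

theorem rank_affine_castSucc (α : Fin (n + 1) → ℕ) (k : Fin n) :
    rank (affine α) k.castSucc = rank α k.succ := by
  rw [← rank_affine α, finRotate_symm_succ]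

theorem rank_affine_last (α : Fin (n + 1) → ℕ) :
    rank (affine α) (Fin.last n) = rank α 0 := by
  rw [← rank_affine α, finRotate_symm_zero]

theorem rank_of_antitone {lam : Fin (n + 1) → ℕ} (h : Antitone lam) (i : Fin (n + 1)) :
    rank lam i = i := by
  have : (Finset.univ.filter fun k => Beats lam k i) = Finset.Iio i := by
    ext k
    simp only [Finset.mem_filter, Finset.mem_univ, true_and, Finset.mem_Iio]
    simp only [Beats]
    constructor
    · rintro (h1 | h1)
      · by_contra h2
        exact absurd (h (not_lt.1 h2)) (by omega)
      · exact h1.2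
    · intro h1
      exact (h h1.le).lt_or_eq.imp_right fun h2 => ⟨h2.symm, h1⟩
  apply Fin.ext
  rw [rank_val, this, Fin.card_Iio]

theorem rank_succ {α : Fin (n + 1) → ℕ} {i : Fin n} (h : α i.castSucc = α i.succ) :
    (rank α i.succ : ℕ) = rank α i.castSucc + 1 := by
  have : (Finset.univ.filter fun k => Beats α k i.succ) =
      insert i.castSucc (Finset.univ.filter fun k => Beats α k i.castSucc) := by
    ext k
    simp only [Finset.mem_filter, Finset.mem_univ, true_and, Finset.mem_insert]
    simp only [Beats, h, Fin.lt_def, Fin.val_succ, Fin.val_castSucc, Fin.ext_iff]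
    constructor
    · omega
    · rintro (h1 | h1)
      · obtain rfl : k = i.castSucc := Fin.ext h1
        simp [h]
      · omega
  rw [rank_val, rank_val, this, Finset.card_insert_of_notMem]
  rw [Finset.mem_filter]
  simp [Beats]

theorem rank_succ_eq {α : Fin (n + 1) → ℕ} {i j : Fin n} (h : α i.castSucc = α i.succ)
    (hj : rank α i.castSucc = j.castSucc) : rank α i.succ = j.succ := by
  apply Fin.ext
  rw [rank_succ h, hj]
  simp

theorem exists_rank_eq {α : Fin (n + 1) → ℕ} {i : Fin n} (h : α i.castSucc = α i.succ) :
    ∃ j : Fin n, rank α i.castSucc = j.castSucc := by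
  have h1 := rank_succ h
  have h2 := (rank α i.succ).isLt
  exact ⟨⟨rank α i.castSucc, by omega⟩, rfl⟩

/-- `plus` is defined by sorting, while ranks give another permutation that makes α monotone; the
monotone rearrangement of a tuple is unique. -/
theorem plus_rank (α : Fin (n + 1) → ℕ) (i : Fin (n + 1)) : plus α (rank α i) = α i := by
  have h := Tuple.unique_monotone (f := α) (σ := Tuple.sort α)
    (τ := Fin.revPerm.trans (rankEquiv α).symm) (Tuple.monotone_sort α) (by
      intro a b hab
      by_contra hlt
      have := rank_lt_rank (α := α) (i := (rankEquiv α).symm (Fin.rev a))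
        (j := (rankEquiv α).symm (Fin.rev b)) (Or.inl (not_le.1 hlt))
      rw [← rankEquiv_apply, ← rankEquiv_apply, Equiv.apply_symm_apply, Equiv.apply_symm_apply,
        Fin.rev_lt_rev] at this
      exact absurd hab (not_le.2 this))
  have h2 := congrFun h (Fin.rev (rank α i))
  simp only [Function.comp_apply, Equiv.trans_apply, Fin.revPerm_apply, Fin.rev_rev] at h2
  rw [plus, h2, ← rankEquiv_apply, Equiv.symm_apply_apply]

theorem plus_antitone (α : Fin (n + 1) → ℕ) : Antitone (plus α) := fun _ _ h =>
  Tuple.monotone_sort α (Fin.rev_le_rev.2 h)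

theorem plus_of_antitone {lam : Fin (n + 1) → ℕ} (h : Antitone lam) : plus lam = lam := by
  funext i
  conv_lhs => rw [← rank_of_antitone h i]
  exact plus_rank lam i

theorem swapAt_swapAt (α : Fin (n + 1) → ℕ) (i : Fin n) : swapAt (swapAt α i) i = α := by
  funext k
  simp [swapAt]

theorem exists_affine_eq {α : Fin (n + 1) → ℕ} (h : 0 < α (Fin.last n)) :
    ∃ β, affine β = α := by
  refine ⟨Fin.cons (α := fun _ => ℕ) (α (Fin.last n) - 1) fun k => α k.castSucc, ?_⟩
  funext k
  refine Fin.lastCases ?_ (fun k => ?_) k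
  · simp
    omega
  · simp

theorem affine_injective : Function.Injective (affine (n := n)) := by
  intro α β h
  funext k
  refine Fin.cases ?_ (fun k => ?_) k
  · simpa using congrFun h (Fin.last n)
  · simpa using congrFun h k.castSucc

theorem sum_affine (α : Fin (n + 1) → ℕ) : ∑ i, affine α i = ∑ i, α i + 1 := by
  rw [Fin.sum_univ_castSucc, Fin.sum_univ_succ]
  simp
  ring

end Ranks

/-! ### Exponent vectors and induction on labels -/

section SpectralLabels

variable {n : ℕ} {μ : YoungDiagram}

/-- The exponents of `q` and `t` in the spectral vector of `(α, S)`. -/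
def zvec (α : Fin (n + 1) → ℕ) (S : RSYT n μ) (i : Fin (n + 1)) : ℕ × ℤ :=
  (α i, S.content (rank α i))

/-- The order of neighbouring spectral exponents along the arrows of the Yang–Baxter graph. -/
def Prec (x y : ℕ × ℤ) : Prop := x.1 < y.1 ∨ (x.1 = y.1 ∧ 2 ≤ x.2 - y.2)

theorem Prec.trans {x y z : ℕ × ℤ} (h : Prec x y) (h' : Prec y z) : Prec x z := by
  simp only [Prec] at *
  omega

theorem zvec_injective {α β : Fin (n + 1) → ℕ} {S S' : RSYT n μ} (h : zvec α S = zvec β S') :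
    α = β ∧ S = S' := by
  have h1 : α = β := funext fun i => congrArg Prod.fst (congrFun h i)
  subst h1
  refine ⟨rfl, RSYT.content_injective fun k => ?_⟩
  have := congrArg Prod.snd (congrFun h ((rankEquiv α).symm k))
  simp only [zvec] at this
  rwa [← rankEquiv_apply, Equiv.apply_symm_apply] at this

theorem zvec_swapAt {α : Fin (n + 1) → ℕ} {i : Fin n} (h : α i.castSucc ≠ α i.succ)
    (S : RSYT n μ) : zvec (swapAt α i) S = zvec α S ∘ Equiv.swap i.castSucc i.succ := by
  funext k
  simp only [zvec, rank_swapAt h, Function.comp_apply]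
  rfl

theorem apply_swap_eq {α : Fin (n + 1) → ℕ} {i : Fin n} (h : α i.castSucc = α i.succ)
    (k : Fin (n + 1)) : α (Equiv.swap i.castSucc i.succ k) = α k := by
  rw [Equiv.swap_apply_def]
  split_ifs with h1 h2
  · rw [h1, h]
  · rw [h2, h]
  · rfl

theorem rank_swap_apply {α : Fin (n + 1) → ℕ} {i j : Fin n} (h : α i.castSucc = α i.succ)
    (hj : rank α i.castSucc = j.castSucc) (k : Fin (n + 1)) :
    rank α (Equiv.swap i.castSucc i.succ k) = Equiv.swap j.castSucc j.succ (rank α k) := by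
  rw [← hj, ← rank_succ_eq h hj]
  exact ((rankEquiv α).injective.swap_apply _ _ _).symm

theorem zvec_comp_swap {α : Fin (n + 1) → ℕ} {i j : Fin n} (h : α i.castSucc = α i.succ)
    (hj : rank α i.castSucc = j.castSucc) (S : RSYT n μ) (k : Fin (n + 1)) :
    zvec α S (Equiv.swap i.castSucc i.succ k) =
      (α k, S.content (Equiv.swap j.castSucc j.succ (rank α k))) := by
  rw [zvec, rank_swap_apply h hj, apply_swap_eq h]

theorem zvec_exch {α : Fin (n + 1) → ℕ} {i j : Fin n} (h : α i.castSucc = α i.succ)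
    (hj : rank α i.castSucc = j.castSucc) (S : RSYT n μ)
    (hS : 2 ≤ |S.content j.castSucc - S.content j.succ|) :
    zvec α (S.exch j) = zvec α S ∘ Equiv.swap i.castSucc i.succ := by
  funext k
  rw [Function.comp_apply, zvec_comp_swap h hj, zvec, RSYT.content_exch S j hS]

theorem zvec_affine_castSucc (α : Fin (n + 1) → ℕ) (S : RSYT n μ) (k : Fin n) :
    zvec (affine α) S k.castSucc = zvec α S k.succ := by
  rw [zvec, zvec, affine_castSucc, rank_affine_castSucc]

theorem zvec_affine_last (α : Fin (n + 1) → ℕ) (S : RSYT n μ) :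
    zvec (affine α) S (Fin.last n) = ((zvec α S 0).1 + 1, (zvec α S 0).2) := by
  rw [zvec, zvec, affine_last, rank_affine_last]

theorem abs_zvec_sub (α β : Fin (n + 1) → ℕ) (S S' : RSYT n μ) (i j : Fin (n + 1)) :
    |(zvec α S i).2 - (zvec β S' j).2| + 1 ≤ (μ.rowLen 0 : ℤ) + (μ.colLen 0 : ℤ) - 1 :=
  RSYT.content_sub_content_lt _ _ _ _

/-- Comparable neighbours always come from an arrow or a reversed arrow: of the composition if its
two parts differ, of the tableau if they agree. -/
theorem exists_zvec_swap {α : Fin (n + 1) → ℕ} {S : RSYT n μ} {i : Fin n}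
    (h : Prec (zvec α S i.castSucc) (zvec α S i.succ) ∨
      Prec (zvec α S i.succ) (zvec α S i.castSucc)) :
    ∃ β, ∃ S' : RSYT n μ, zvec β S' = zvec α S ∘ Equiv.swap i.castSucc i.succ := by
  by_cases hα : α i.castSucc = α i.succ
  · obtain ⟨j, hj⟩ := exists_rank_eq hα
    refine ⟨α, S.exch j, zvec_exch hα hj S ?_⟩
    simp only [zvec, Prec, hα, hj, rank_succ_eq hα hj] at h
    rw [le_abs]
    omega
  · exact ⟨_, _, zvec_swapAt hα S⟩

/-- If two neighbouring entries of the spectral vector are not comparable, exchanging them does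
not give the spectral vector of a label. -/
theorem prec_of_zvec_swap {α β : Fin (n + 1) → ℕ} {S S' : RSYT n μ} {i : Fin n}
    (h : zvec β S' = zvec α S ∘ Equiv.swap i.castSucc i.succ) :
    Prec (zvec α S i.castSucc) (zvec α S i.succ) ∨
      Prec (zvec α S i.succ) (zvec α S i.castSucc) := by
  by_cases hα : α i.castSucc = α i.succ
  · obtain ⟨j, hj⟩ := exists_rank_eq hα
    have hβ : β = α := by
      funext k
      have := congrArg Prod.fst (congrFun h k)
      rwa [Function.comp_apply, zvec_comp_swap hα hj] at this
    subst hβ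
    have h2 : 2 ≤ |S.content j.castSucc - S.content j.succ| := by
      refine RSYT.two_le_of_content_swap (S' := S') j fun k => ?_
      have := congrArg Prod.snd (congrFun h ((rankEquiv β).symm k))
      rw [Function.comp_apply, zvec_comp_swap hα hj, zvec, ← rankEquiv_apply,
        Equiv.apply_symm_apply] at this
      exact this
    have e1 : (zvec β S i.castSucc).2 = S.content j.castSucc := by rw [zvec, hj]
    have e2 : (zvec β S i.succ).2 = S.content j.succ := by rw [zvec, rank_succ_eq hα hj]
    rcases le_abs.1 h2 with h2 | h2
    · exact Or.inl (Or.inr ⟨hα, by omega⟩)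
    · exact Or.inr (Or.inr ⟨hα.symm, by omega⟩)
  · simp only [zvec, Prec]
    omega

/-- A strictly monotone weight for `Prec`. -/
def weight (C : ℕ) (x : ℕ × ℤ) : ℤ := x.1 * (2 * C + 1) + C - x.2

/-- The factor 2C + 1 lets one unit of degree outweigh any difference of contents bounded by C. -/
theorem weight_lt_weight {C : ℕ} {x y : ℕ × ℤ} (hx : |x.2| ≤ C) (hy : |y.2| ≤ C)
    (h : Prec x y) : weight C x < weight C y := by
  simp only [weight]
  rw [abs_le] at hx hy
  rcases h with h | ⟨h1, h2⟩
  · have h3 : (x.1 : ℤ) + 1 ≤ y.1 := by exact_mod_cast h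
    have : ((x.1 : ℤ) + 1) * (2 * C + 1) ≤ y.1 * (2 * C + 1) :=
      mul_le_mul_of_nonneg_right h3 (by omega)
    linarith
  · rw [h1]
    omega

/-- The arrows are well-founded. An affine arrow raises the degree. An exchange preserves the degree
but raises `W`, because it moves the heavier pair to the earlier position, whose coefficient is
greater by one. -/
theorem label_induction {P : (Fin (n + 1) → ℕ) → RSYT n μ → Prop}
    (h : ∀ α S, (∀ α' S' (i : Fin n), Prec (zvec α' S' i.castSucc) (zvec α' S' i.succ) →
      zvec α S = zvec α' S' ∘ Equiv.swap i.castSucc i.succ → P α' S') →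
      (∀ α', α = affine α' → P α' S) → P α S) (α : Fin (n + 1) → ℕ) (S : RSYT n μ) : P α S := by
  obtain ⟨C, hC⟩ : ∃ C : ℕ, ∀ (α : Fin (n + 1) → ℕ) (S : RSYT n μ) i, |(zvec α S i).2| ≤ C := by
    refine ⟨μ.rowLen 0 + μ.colLen 0, fun α S i => ?_⟩
    have := RSYT.content_sub_content_lt S S (rank α i) (Fin.last n)
    rw [RSYT.content_last, sub_zero] at this
    push_cast
    simp only [zvec]
    omega
  let W : (Fin (n + 1) → ℕ) → RSYT n μ → ℤ := fun α S =>
    ∑ j : Fin (n + 1), ((n : ℤ) - (j : ℕ)) * weight C (zvec α S j)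
  have hW0 : ∀ α S, 0 ≤ W α S := by
    intro α S
    refine Finset.sum_nonneg fun j _ => mul_nonneg ?_ ?_
    · have := j.isLt
      omega
    · have h1 := hC α S j
      rw [abs_le] at h1
      have : (0 : ℤ) ≤ (zvec α S j).1 * (2 * C + 1) := by positivity
      simp only [weight]
      linarith
  have hW : ∀ α S α' S' (i : Fin n), Prec (zvec α' S' i.castSucc) (zvec α' S' i.succ) →
      zvec α S = zvec α' S' ∘ Equiv.swap i.castSucc i.succ → W α' S' < W α S := by
    intro α S α' S' i hp hz
    have e1 : W α S = ∑ j : Fin (n + 1), ((n : ℤ) -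
        (Equiv.swap i.castSucc i.succ j : ℕ)) * weight C (zvec α' S' j) := by
      simp only [W]
      rw [← Equiv.sum_comp (Equiv.swap i.castSucc i.succ)]
      simp [hz]
    have e2 : W α S - W α' S' =
        weight C (zvec α' S' i.succ) - weight C (zvec α' S' i.castSucc) := by
      rw [e1, ← Finset.sum_sub_distrib, Fintype.sum_eq_add i.castSucc i.succ (by simp [Fin.ext_iff])]
      · simp only [Equiv.swap_apply_left, Equiv.swap_apply_right, Fin.val_castSucc, Fin.val_succ]
        push_cast
        ring
      · rintro x ⟨h1, h2⟩
        rw [Equiv.swap_apply_of_ne_of_ne h1 h2, sub_self]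
    have := weight_lt_weight (hC _ _ _) (hC _ _ _) hp
    omega
  obtain ⟨m, hm⟩ : ∃ m, ∑ i, α i = m := ⟨_, rfl⟩
  induction m using Nat.strong_induction_on generalizing α S with
  | _ m ihm =>
    obtain ⟨w, hw⟩ : ∃ w, (W α S).toNat = w := ⟨_, rfl⟩
    induction w using Nat.strong_induction_on generalizing α S with
    | _ w ihw =>
      refine h α S (fun α' S' i hp hz => ?_) fun α' hα => ?_
      · refine ihw _ ?_ α' S' ?_ rfl
        · have := hW _ _ _ _ _ hp hz
          have := hW0 α' S'
          omega
        · rw [← hm, ← Equiv.sum_comp (Equiv.swap i.castSucc i.succ) α']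
          refine Finset.sum_congr rfl fun k _ => ?_
          exact (congrArg Prod.fst (congrFun hz k)).symm
      · refine ihm (∑ i, α' i) ?_ α' S rfl
        rw [← hm, hα, sum_affine]
        omega

end SpectralLabels

end VVMac

namespace VVMac

/-! ### Abstract Hecke relations and Cherednik operators -/

section HeckeRings

variable {K A : Type*} [Field K] [Ring A] [Algebra K A]

/-- Elements `T 0, …, T (n - 1)` satisfying the relations of the Hecke algebra. -/
structure HeckeRel (n : ℕ) (t : K) (T : ℕ → A) : Prop where
  quad : ∀ i < n, T i * T i = (t - 1) • T i + t • 1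
  braid : ∀ i, i + 1 < n → T i * T (i + 1) * T i = T (i + 1) * T i * T (i + 1)
  comm : ∀ i j, i + 1 < j → j < n → T i * T j = T j * T i

/-- The inverse generators. -/
def genInv (t : K) (T : ℕ → A) (i : ℕ) : A := t⁻¹ • (T i + (1 - t) • 1)

/-- `T (k - 1) * ⋯ * T 0`. -/
def chainP (T : ℕ → A) : ℕ → A
  | 0 => 1
  | k + 1 => T k * chainP T k

/-- `T 0 * ⋯ * T (k - 1)`. -/
def chainQ (T : ℕ → A) : ℕ → A
  | 0 => 1
  | k + 1 => chainQ T k * T k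

namespace HeckeRel

variable {n : ℕ} {t : K} {T : ℕ → A} (H : HeckeRel n t T) (ht : t ≠ 0)

include H

/-- The Coxeter-type product shifts the index of a generator: the braid relation at the two factors
involved, commutation at all others. -/
theorem mul_chainP {i k : ℕ} (h : i + 1 < k) (hk : k ≤ n) :
    T i * chainP T k = chainP T k * T (i + 1) := by
  induction k, h using Nat.le_induction with
  | base =>
    have h1 : T (i + 1) * chainP T i = chainP T i * T (i + 1) := by
      have : ∀ m, m ≤ i → T (i + 1) * chainP T m = chainP T m * T (i + 1) := by
        intro m hm
        induction m with
        | zero => simp [chainP]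
        | succ m ih =>
          rw [chainP, mul_assoc, ← ih (by omega), ← mul_assoc, ← mul_assoc,
            H.comm m (i + 1) (by omega) (by omega)]
      exact this i le_rfl
    calc T i * (T (i + 1) * (T i * chainP T i))
        = (T i * T (i + 1) * T i) * chainP T i := by simp only [mul_assoc]
      _ = T (i + 1) * T i * (T (i + 1) * chainP T i) := by
        rw [H.braid i (by omega)]
        simp only [mul_assoc]
      _ = T (i + 1) * (T i * chainP T i) * T (i + 1) := by
        rw [h1]
        simp only [mul_assoc]
  | succ k hik ih =>
    rw [chainP, mul_assoc, ← ih (by omega), ← mul_assoc, ← mul_assoc,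
      H.comm i k (by omega) (by omega)]

theorem chainP_mul_chainP {k : ℕ} (hk : k + 1 ≤ n) :
    chainP T k * chainP T n * T 0 = chainP T n * chainP T (k + 1) := by
  induction k with
  | zero => simp [chainP]
  | succ k ih =>
    calc T k * chainP T k * chainP T n * T 0 = T k * (chainP T k * chainP T n * T 0) := by
          simp only [mul_assoc]
      _ = (T k * chainP T n) * chainP T (k + 1) := by
        rw [ih (by omega), mul_assoc]
      _ = chainP T n * (T (k + 1) * chainP T (k + 1)) := by
        rw [H.mul_chainP (by omega) le_rfl, mul_assoc]

/-- The last generator cannot be shifted by one product, but the square carries it round to `T 0`.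
The induction behind this is `chainP_mul_chainP`. -/
theorem mul_chainP_sq {m : ℕ} (hm : n = m + 1) :
    T m * (chainP T n * chainP T n) = chainP T n * chainP T n * T 0 := by
  have h := H.chainP_mul_chainP (k := m) (by omega)
  rw [← hm] at h
  have hP : chainP T n = T m * chainP T m := by rw [hm, chainP]
  calc T m * (chainP T n * chainP T n) = (T m * chainP T m) * chainP T n * T 0 := by
        rw [← h]
        simp only [mul_assoc]
    _ = _ := by rw [← hP]

include ht

theorem mul_genInv {i : ℕ} (hi : i < n) : T i * genInv t T i = 1 := by
  rw [genInv, mul_smul_comm, mul_add, H.quad i hi, mul_smul_comm, mul_one, add_right_comm,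
    ← add_smul]
  simp [smul_smul, ht]

theorem genInv_mul {i : ℕ} (hi : i < n) : genInv t T i * T i = 1 := by
  rw [genInv, smul_mul_assoc, add_mul, H.quad i hi, smul_mul_assoc, one_mul, add_right_comm,
    ← add_smul]
  simp [smul_smul, ht]

end HeckeRel

/-- `T 0⁻¹ * ⋯ * T (k - 1)⁻¹`. -/
def chainR (t : K) (T : ℕ → A) (k : ℕ) : A := chainQ (genInv t T) k

theorem chainR_succ (t : K) (T : ℕ → A) (k : ℕ) :
    chainR t T (k + 1) = chainR t T k * genInv t T k := rfl

theorem genInv_comm (t : K) {T : ℕ → A} {i : ℕ} {a b : A} (h : T i * a = b * T i)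
    (h0 : a = b) : genInv t T i * a = b * genInv t T i := by
  subst h0
  simp only [genInv, smul_mul_assoc, add_mul, mul_smul_comm, mul_add, h, one_mul, mul_one]

theorem genInv_shift (t : K) {T : ℕ → A} {i j : ℕ} {a : A} (h : T i * a = a * T j) :
    genInv t T i * a = a * genInv t T j := by
  simp only [genInv, smul_mul_assoc, add_mul, mul_smul_comm, mul_add, h, one_mul, mul_one]

theorem HeckeRel.chainR_mul_chainP {n : ℕ} {t : K} {T : ℕ → A} (H : HeckeRel n t T) (ht : t ≠ 0)
    {k : ℕ} (hk : k ≤ n) : chainR t T k * chainP T k = 1 := by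
  induction k with
  | zero => simp [chainR, chainP, chainQ]
  | succ k ih =>
    rw [chainR_succ, chainP, mul_assoc, ← mul_assoc (genInv t T k), H.genInv_mul ht (by omega),
      one_mul, ih (by omega)]

theorem HeckeRel.chainP_mul_chainR {n : ℕ} {t : K} {T : ℕ → A} (H : HeckeRel n t T) (ht : t ≠ 0)
    {k : ℕ} (hk : k ≤ n) : chainP T k * chainR t T k = 1 := by
  induction k with
  | zero => simp [chainR, chainP, chainQ]
  | succ k ih =>
    rw [chainR_succ, chainP, mul_assoc, ← mul_assoc (chainP T k), ih (by omega), one_mul,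
      H.mul_genInv ht (by omega)]

/-- The relations between the generators `T i`, the rotation `w`, the multiplications `x i` by the
variables and the Cherednik operators `ξ i`. -/
structure AffineHeckeRel (n : ℕ) (q t : K) (T : ℕ → A) (w : A) (x ξ : ℕ → A) : Prop
    extends HeckeRel n t T where
  ht : t ≠ 0
  mul_w : ∀ i, i + 1 < n → T i * w = w * T (i + 1)
  mul_ww : ∀ m, n = m + 1 → T m * (w * w) = w * w * T 0
  xi_last : ξ n = w * chainR t T n
  xi_step : ∀ i < n, ξ i = t⁻¹ • (T i * ξ (i + 1) * T i)
  inv_x : ∀ i < n, genInv t T i * x (i + 1) = t⁻¹ • (x i * T i)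
  x_comm : ∀ i, i + 1 < n → T i * x n = x n * T i
  xx_comm : ∀ m, n = m + 1 → T m * (x n * x m) = x n * x m * T m
  w_x_zero : w * x 0 = q • (x n * w)
  w_x_succ : ∀ i < n, w * x (i + 1) = x i * w

namespace AffineHeckeRel

variable {n : ℕ} {q t : K} {T : ℕ → A} {w : A} {x ξ : ℕ → A}
  (H : AffineHeckeRel n q t T w x ξ)

include H

theorem mul_xi_mul {i : ℕ} (hi : i < n) : T i * ξ (i + 1) * T i = t • ξ i := by
  rw [H.xi_step i hi, smul_smul, mul_inv_cancel₀ H.ht, one_smul]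

/-- The rotation `w` shifts the index up by one and the inverse chain shifts it back. -/
theorem mul_xi_last {i : ℕ} (hi : i + 1 < n) : T i * ξ n = ξ n * T i := by
  have h1 : T (i + 1) * chainR t T n = chainR t T n * T i := by
    calc T (i + 1) * chainR t T n
        = (chainR t T n * chainP T n) * (T (i + 1) * chainR t T n) := by
          rw [H.chainR_mul_chainP H.ht le_rfl, one_mul]
      _ = chainR t T n * (chainP T n * T (i + 1)) * chainR t T n := by simp only [mul_assoc]
      _ = chainR t T n * T i * (chainP T n * chainR t T n) := by
        rw [← H.mul_chainP hi le_rfl]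
        simp only [mul_assoc]
      _ = chainR t T n * T i := by rw [H.chainP_mul_chainR H.ht le_rfl, mul_one]
  rw [H.xi_last, ← mul_assoc, H.mul_w i hi, mul_assoc, h1, mul_assoc]

theorem mul_xi_of_lt {i j : ℕ} (hij : i + 1 < j) (hj : j ≤ n) : T i * ξ j = ξ j * T i := by
  induction hj using Nat.decreasingInduction with
  | self => exact H.mul_xi_last hij
  | of_succ j hj ih =>
    rw [H.xi_step j hj, mul_smul_comm, smul_mul_assoc]
    congr 1
    calc T i * (T j * ξ (j + 1) * T j) = (T i * T j) * ξ (j + 1) * T j := by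
          simp only [mul_assoc]
      _ = T j * (T i * ξ (j + 1)) * T j := by
        rw [H.comm i j hij hj]
        simp only [mul_assoc]
      _ = T j * ξ (j + 1) * (T i * T j) := by
        rw [ih (by omega)]
        simp only [mul_assoc]
      _ = T j * ξ (j + 1) * T j * T i := by
        rw [H.comm i j hij hj]
        simp only [mul_assoc]

/-- For i = j + 1, ξ_j is a multiple of T_j T_{j+1} ξ_{j+2} T_{j+1} T_j, and T_{j+1} passes through
by a braid move on either side of ξ_{j+2}, which commutes with T_j. Smaller j follow by descent. -/
theorem mul_xi_of_gt {i j : ℕ} (hij : j < i) (hi : i < n) : T i * ξ j = ξ j * T i := by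
  obtain ⟨k, rfl⟩ : ∃ k, i = k + 1 := ⟨i - 1, by omega⟩
  have hj : j ≤ k := by omega
  clear hij
  induction hj using Nat.decreasingInduction with
  | self =>
    rw [H.xi_step k (by omega), mul_smul_comm, smul_mul_assoc, H.xi_step (k + 1) hi]
    congr 1
    simp only [mul_smul_comm, smul_mul_assoc]
    congr 1
    calc T (k + 1) * (T k * (T (k + 1) * ξ (k + 1 + 1) * T (k + 1)) * T k)
        = (T (k + 1) * T k * T (k + 1)) * (ξ (k + 1 + 1) * T (k + 1) * T k) := by
          simp only [mul_assoc]
      _ = T k * T (k + 1) * (T k * ξ (k + 1 + 1)) * T (k + 1) * T k := by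
        rw [← H.braid k hi]
        simp only [mul_assoc]
      _ = T k * T (k + 1) * ξ (k + 1 + 1) * (T k * T (k + 1) * T k) := by
        rw [H.mul_xi_of_lt (by omega) (by omega)]
        simp only [mul_assoc]
      _ = T k * (T (k + 1) * ξ (k + 1 + 1) * T (k + 1)) * T k * T (k + 1) := by
        rw [H.braid k hi]
        simp only [mul_assoc]
  | of_succ j hj ih =>
    have hc := H.comm j (k + 1) (by omega) hi
    rw [H.xi_step j (by omega), mul_smul_comm, smul_mul_assoc]
    congr 1
    calc T (k + 1) * (T j * ξ (j + 1) * T j) = (T (k + 1) * T j) * ξ (j + 1) * T j := by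
          simp only [mul_assoc]
      _ = T j * (T (k + 1) * ξ (j + 1)) * T j := by
        rw [← hc]
        simp only [mul_assoc]
      _ = T j * ξ (j + 1) * (T (k + 1) * T j) := by
        rw [ih]
        simp only [mul_assoc]
      _ = T j * ξ (j + 1) * T j * T (k + 1) := by
        rw [← hc]
        simp only [mul_assoc]

theorem mul_xi {i j : ℕ} (hi : i < n) (hj : j ≤ n) (h1 : j ≠ i) (h2 : j ≠ i + 1) :
    T i * ξ j = ξ j * T i := by
  rcases lt_or_gt_of_ne h1 with h | h
  · exact H.mul_xi_of_gt h hi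
  · exact H.mul_xi_of_lt (by omega) hj

theorem mul_xw {i : ℕ} (hi : i + 1 < n) : T i * (x n * w) = x n * w * T (i + 1) := by
  rw [← mul_assoc, H.x_comm i hi, mul_assoc, H.mul_w i hi, mul_assoc]

theorem mul_xw_sq {m : ℕ} (hm : n = m + 1) :
    T m * (x n * w * (x n * w)) = x n * w * (x n * w) * T 0 := by
  have h : x n * w * (x n * w) = x n * x m * (w * w) := by
    calc x n * w * (x n * w) = x n * (w * x (m + 1)) * w := by
          rw [hm]
          simp only [mul_assoc]
      _ = _ := by
        rw [H.w_x_succ m (by omega)]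
        simp only [mul_assoc]
  rw [h, ← mul_assoc, H.xx_comm m hm, mul_assoc, H.mul_ww m hm]
  simp only [mul_assoc]

/-- Since `ξ 0` has nonzero eigenvalues, this shows later that `w` kills no joint eigenvector. -/
theorem chainQ_mul_w : chainQ T n * w = t ^ n • ξ 0 := by
  have h2 : ∀ k ≤ n, chainQ T k * ξ k * chainP T k = t ^ k • ξ 0 := by
    intro k hk
    induction k with
    | zero => simp [chainP, chainQ]
    | succ k ih =>
      calc chainQ T k * T k * ξ (k + 1) * (T k * chainP T k)
          = chainQ T k * (T k * ξ (k + 1) * T k) * chainP T k := by simp only [mul_assoc]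
        _ = t • (chainQ T k * ξ k * chainP T k) := by
          rw [H.mul_xi_mul (by omega), mul_smul_comm, smul_mul_assoc]
        _ = _ := by rw [ih (by omega), smul_smul, pow_succ']
  rw [← h2 n le_rfl, H.xi_last, mul_assoc, mul_assoc w, H.chainR_mul_chainP H.ht le_rfl, mul_one]

/-- Moving `x n` through the inverse chain turns it into `x 0` and the inverses into generators; `w`
then sends `x 0` back to `x n` at the cost of q, and the remaining factors reassemble to `ξ 0`. -/
theorem xi_last_mul_xw : ξ n * (x n * w) = q • (x n * w * ξ 0) := by
  have h1 : ∀ k ≤ n, chainR t T k * x k = (t⁻¹) ^ k • (x 0 * chainQ T k) := by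
    intro k hk
    induction k with
    | zero => simp [chainR, chainQ]
    | succ k ih =>
      rw [chainR_succ, mul_assoc, H.inv_x k (by omega), mul_smul_comm, ← mul_assoc,
        ih (by omega), smul_mul_assoc, smul_smul, ← pow_succ', chainQ]
      simp only [mul_assoc]
  calc ξ n * (x n * w) = w * (chainR t T n * x n) * w := by
        rw [H.xi_last]
        simp only [mul_assoc]
    _ = (t⁻¹) ^ n • ((w * x 0) * (chainQ T n * w)) := by
      rw [h1 n le_rfl, mul_smul_comm, smul_mul_assoc]
      simp only [mul_assoc]
    _ = q • (x n * w * ξ 0) := by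
      rw [H.w_x_zero, H.chainQ_mul_w, smul_mul_assoc, mul_smul_comm, smul_comm q, smul_smul,
        inv_pow, inv_mul_cancel₀ (pow_ne_zero n H.ht), one_smul]

theorem chainR_comm_x {k : ℕ} (hk : k < n) : chainR t T k * x n = x n * chainR t T k := by
  induction k with
  | zero => simp [chainR, chainQ]
  | succ k ih =>
    rw [chainR_succ, mul_assoc, genInv_comm t (H.x_comm k hk) rfl, ← mul_assoc, ih (by omega),
      mul_assoc]

/-- The starting point for `xi_mul_xw`, where no generator can be shifted through a single `w`; the
relation of `T m` and `T 0` through the square of `w` takes its place. -/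
theorem xi_penultimate_mul_xw {m : ℕ} (hm : n = m + 1) :
    ξ m * (x n * w) = x n * w * ξ n := by
  have h1 : ∀ k ≤ m, w * w * chainR t T (k + 1) = genInv t T m * w * chainR t T k * w := by
    intro k hk
    induction k with
    | zero =>
      simp only [chainR, chainQ, one_mul, mul_one]
      rw [← genInv_shift t (H.mul_ww m hm), mul_assoc]
    | succ k ih =>
      rw [chainR_succ, ← mul_assoc, ih (by omega), chainR_succ, mul_assoc,
        ← genInv_shift t (H.mul_w k (by omega))]
      simp only [mul_assoc]
  have h2 : chainR t T n * T m = chainR t T m := by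
    rw [hm, chainR_succ, mul_assoc, H.genInv_mul H.ht (by omega), mul_one]
  have h3 : T m * x m = t • (x n * genInv t T m) := by
    have h := H.inv_x m (by omega)
    calc T m * x m = T m * (x m * T m) * genInv t T m := by
          simp only [mul_assoc]
          rw [H.mul_genInv H.ht (by omega), mul_one]
      _ = t • (T m * (t⁻¹ • (x m * T m)) * genInv t T m) := by
        rw [mul_smul_comm, smul_mul_assoc, smul_smul, mul_inv_cancel₀ H.ht, one_smul]
      _ = t • (x n * genInv t T m) := by
        rw [← h, ← mul_assoc, H.mul_genInv H.ht (by omega), one_mul, hm]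
  calc ξ m * (x n * w) = t⁻¹ • (T m * w * (chainR t T n * T m) * x n * w) := by
        rw [H.xi_step m (by omega), ← hm, H.xi_last, smul_mul_assoc]
        simp only [mul_assoc]
    _ = t⁻¹ • (T m * (w * x (m + 1)) * chainR t T m * w) := by
      rw [h2, ← hm]
      congr 1
      rw [mul_assoc (T m * w), H.chainR_comm_x (by omega)]
      simp only [mul_assoc]
    _ = t⁻¹ • (T m * x m * (w * chainR t T m * w)) := by
      rw [H.w_x_succ m (by omega)]
      simp only [mul_assoc]
    _ = x n * (genInv t T m * w * chainR t T m * w) := by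
      rw [h3, smul_mul_assoc, smul_smul, inv_mul_cancel₀ H.ht, one_smul]
      simp only [mul_assoc]
    _ = x n * w * ξ n := by
      rw [← h1 m le_rfl, H.xi_last, ← hm]
      simp only [mul_assoc]

theorem xi_mul_xw {i : ℕ} (hi : i < n) : ξ i * (x n * w) = x n * w * ξ (i + 1) := by
  obtain ⟨m, rfl⟩ : ∃ m, n = m + 1 := ⟨n - 1, by omega⟩
  have hi' : i ≤ m := by omega
  clear hi
  induction hi' using Nat.decreasingInduction with
  | self => exact H.xi_penultimate_mul_xw rfl
  | of_succ i hi ih =>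
    calc ξ i * (x (m + 1) * w)
        = t⁻¹ • (T i * ξ (i + 1) * (T i * (x (m + 1) * w))) := by
          rw [H.xi_step i (by omega), smul_mul_assoc]
          simp only [mul_assoc]
      _ = t⁻¹ • (T i * (ξ (i + 1) * (x (m + 1) * w)) * T (i + 1)) := by
        rw [H.mul_xw (by omega)]
        simp only [mul_assoc]
      _ = t⁻¹ • ((T i * (x (m + 1) * w)) * ξ (i + 1 + 1) * T (i + 1)) := by
        rw [ih]
        simp only [mul_assoc]
      _ = x (m + 1) * w * ξ (i + 1) := by
        rw [H.mul_xw (by omega), H.xi_step (i + 1) (by omega), mul_smul_comm]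
        simp only [mul_assoc]

end AffineHeckeRel

section Eigenvectors

variable {W : Type*} [AddCommGroup W] [Module K W] {n : ℕ} {q t : K} {T : ℕ → Module.End K W}
  {w : Module.End K W} {x ξ : ℕ → Module.End K W}

/-- By T_i ξ_{i+1} T_i = t ξ_i and the quadratic relation, ξ_i and ξ_{i+1} act by triangular
formulas on f and T_i f. The added multiple of f is the one that removes the off-diagonal term of
both. -/
theorem AffineHeckeRel.inter_eigen (H : AffineHeckeRel n q t T w x ξ) {i : ℕ} (hi : i < n)
    {f : W} {a b : K} (ha : a ≠ 0) (hab : b / a ≠ 1) (h1 : ξ i f = a • f)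
    (h2 : ξ (i + 1) f = b • f) :
    ξ i (T i f + ((t - 1) / (b / a - 1)) • f) = b • (T i f + ((t - 1) / (b / a - 1)) • f) ∧
      ξ (i + 1) (T i f + ((t - 1) / (b / a - 1)) • f) =
        a • (T i f + ((t - 1) / (b / a - 1)) • f) := by
  have hT : T i (T i f) = (t - 1) • T i f + t • f := LinearMap.congr_fun (H.quad i hi) f
  have hX : ∀ g, T i (ξ (i + 1) (T i g)) = t • ξ i g :=
    fun g => LinearMap.congr_fun (H.mul_xi_mul hi) g
  have hne : b - a ≠ 0 := by
    rw [sub_ne_zero]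
    rintro rfl
    exact hab (div_self ha)
  have hc : (t - 1) / (b / a - 1) = (t - 1) * a / (b - a) := by
    rw [div_sub_one ha, div_div_eq_mul_div]
  rw [hc]
  have ht := H.ht
  have e1 : ξ (i + 1) (T i f) = a • (T i f + (1 - t) • f) := by
    have h := hX f
    rw [h1] at h
    have h3 := congrArg (fun g => (genInv t T i : Module.End K W) g) h
    have h4 : ∀ g, (genInv t T i : Module.End K W) (T i g) = g :=
      fun g => LinearMap.congr_fun (H.genInv_mul ht hi) g
    simp only [h4] at h3
    rw [h3]
    simp only [genInv, LinearMap.smul_apply, LinearMap.add_apply, Module.End.one_apply, map_smul,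
      smul_smul]
    congr 1
    field_simp
  have e2 : ξ i (T i f) = (t - 1) • (a • f) + b • T i f := by
    have h := hX (T i f)
    rw [hT, map_add, map_smul, map_smul, h2, map_add, map_smul, map_smul, map_smul, hX, h1] at h
    have h5 := congrArg (fun g => t⁻¹ • g) h
    simp only [smul_smul, inv_mul_cancel₀ ht, one_smul, smul_add] at h5
    rw [← h5, smul_smul]
    congr 2 <;> field_simp
  constructor
  · rw [map_add, map_smul, e2, h1, ← sub_eq_zero]
    have : (t - 1) * a + (t - 1) * a / (b - a) * a - b * ((t - 1) * a / (b - a)) = 0 := by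
      field_simp
      ring
    calc _ = ((t - 1) * a + (t - 1) * a / (b - a) * a - b * ((t - 1) * a / (b - a))) • f := by
          module
      _ = 0 := by rw [this, zero_smul]
  · rw [map_add, map_smul, e1, h2, ← sub_eq_zero]
    have : a * (1 - t) + (t - 1) * a / (b - a) * b - a * ((t - 1) * a / (b - a)) = 0 := by
      field_simp
      ring
    calc _ = (a * (1 - t) + (t - 1) * a / (b - a) * b - a * ((t - 1) * a / (b - a))) • f := by
          module
      _ = 0 := by rw [this, zero_smul]

end Eigenvectors

end HeckeRings

/-! ### Intertwiners and the Yang–Baxter equation -/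

section Intertwiners

variable {K W : Type*} [Field K] [AddCommGroup W] [Module K W]

/-- The parameter of the intertwiner at the ratio `r`. -/
def bpar (t r : K) : K := (t - 1) / (r - 1)

/-- The intertwiner of the Hecke algebra. -/
def inter (t : K) (T : W →ₗ[K] W) (r : K) (f : W) : W := T f + bpar t r • f

theorem inter_smul (t : K) (T : W →ₗ[K] W) (r a : K) (f : W) :
    inter t T r (a • f) = a • inter t T r f := by
  simp [inter, smul_add, smul_smul, mul_comm]

/-- The parameters at r and r⁻¹ add up to 1 - t, so the terms in T f cancel and only the scalar t +
b(r) b(r⁻¹) = u(r) remains. -/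
theorem inter_inter_inv {t r : K} {T : W →ₗ[K] W} {f : W} (hr0 : r ≠ 0) (hr : r ≠ 1)
    (hT : T (T f) = (t - 1) • T f + t • f) : inter t T r⁻¹ (inter t T r f) = u t r • f := by
  have h1 : r - 1 ≠ 0 := sub_ne_zero.2 hr
  have h2 : 1 - r ≠ 0 := sub_ne_zero.2 hr.symm
  have e : r⁻¹ - 1 ≠ 0 := by
    rw [sub_ne_zero]
    simpa using hr
  have hb : bpar t r⁻¹ = -(t - 1) - bpar t r := by
    rw [bpar, bpar]
    field_simp
    ring
  have hu : u t r = t + bpar t r * bpar t r⁻¹ := by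
    rw [hb, bpar, u, show (1 - r) ^ 2 = (r - 1) ^ 2 by ring]
    field_simp
    ring
  simp only [inter, map_add, map_smul, hT, hu, hb]
  module

/-- In the difference of the two sides the lower terms cancel by the addition law `hb` of the
parameters, and the two braid words remain. Both directions are used: equal intertwiner products
prove the braid relation for τ, and the braid relation on P_τ closes the hexagon of the graph. -/
theorem yang_baxter_iff {t r₁ r₂ : K} (h1 : r₁ ≠ 1) (h2 : r₂ ≠ 1) (h3 : r₁ * r₂ ≠ 1)
    {T₁ T₂ : W →ₗ[K] W} {f : W} (hT1 : T₁ (T₁ f) = (t - 1) • T₁ f + t • f)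
    (hT2 : T₂ (T₂ f) = (t - 1) • T₂ f + t • f) :
    inter t T₁ r₂ (inter t T₂ (r₁ * r₂) (inter t T₁ r₁ f)) =
        inter t T₂ r₁ (inter t T₁ (r₁ * r₂) (inter t T₂ r₂ f)) ↔
      T₁ (T₂ (T₁ f)) = T₂ (T₁ (T₂ f)) := by
  have e1 : r₁ - 1 ≠ 0 := sub_ne_zero.2 h1
  have e2 : r₂ - 1 ≠ 0 := sub_ne_zero.2 h2
  have e3 : r₁ * r₂ - 1 ≠ 0 := sub_ne_zero.2 h3
  have hb : bpar t (r₁ * r₂) * (t - 1 + bpar t r₁ + bpar t r₂) = bpar t r₁ * bpar t r₂ := by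
    simp only [bpar]
    field_simp
    ring
  have key : inter t T₁ r₂ (inter t T₂ (r₁ * r₂) (inter t T₁ r₁ f)) -
        inter t T₂ r₁ (inter t T₁ (r₁ * r₂) (inter t T₂ r₂ f)) =
      T₁ (T₂ (T₁ f)) - T₂ (T₁ (T₂ f)) +
        (bpar t (r₁ * r₂) * (t - 1 + bpar t r₁ + bpar t r₂) - bpar t r₁ * bpar t r₂) •
          (T₁ f - T₂ f) := by
    simp only [inter, map_add, map_smul, hT1, hT2]
    module
  rw [hb, sub_self, zero_smul, add_zero] at key
  rw [← sub_eq_zero, key, sub_eq_zero]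

end Intertwiners

end VVMac

namespace VVMac

/-! ### Operator lists as ordered products -/

section Extension

variable {A : Type*}

/-- The extension by `1` of a family indexed by `Fin m`. -/
def natExt [One A] {m : ℕ} (F : Fin m → A) (k : ℕ) : A := if h : k < m then F ⟨k, h⟩ else 1

theorem natExt_of_lt [One A] {m : ℕ} (F : Fin m → A) {k : ℕ} (h : k < m) :
    natExt F k = F ⟨k, h⟩ := dif_pos h

theorem natExt_val [One A] {m : ℕ} (F : Fin m → A) (k : Fin m) : natExt F k = F k :=
  dif_pos k.isLt

theorem filter_lt_finRange (n i : ℕ) :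
    ((List.finRange n).filter fun k => k.val < i) = (List.finRange n).take i := by
  conv_lhs => rw [← List.take_append_drop i (List.finRange n)]
  rw [List.filter_append, List.filter_eq_self.2, List.filter_eq_nil_iff.2, List.append_nil]
  · intro a ha
    obtain ⟨j, hj, rfl⟩ := List.mem_drop_iff_getElem.1 ha
    simp
  · intro a ha
    obtain ⟨j, hj, rfl⟩ := List.mem_take_iff_getElem.1 ha
    simp at hj ⊢
    omega

theorem filter_ge_finRange (n i : ℕ) :
    ((List.finRange n).filter fun k => i ≤ k.val) = (List.finRange n).drop i := by
  conv_lhs => rw [← List.take_append_drop i (List.finRange n)]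
  rw [List.filter_append, List.filter_eq_nil_iff.2, List.filter_eq_self.2, List.nil_append]
  rotate_left
  · intro a ha
    obtain ⟨j, hj, rfl⟩ := List.mem_take_iff_getElem.1 ha
    simp at hj ⊢
    omega
  · intro a ha
    obtain ⟨j, hj, rfl⟩ := List.mem_drop_iff_getElem.1 ha
    simp

variable {K W : Type*} [Field K] [AddCommGroup W] [Module K W]

theorem rightProd_append (l l' : List (W →ₗ[K] W)) :
    rightProd (l ++ l') = (rightProd l' : Module.End K W) * rightProd l := by
  have h : ∀ (l : List (W →ₗ[K] W)) (B : W →ₗ[K] W),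
      l.foldl (fun acc A => A ∘ₗ acc) B = (rightProd l) ∘ₗ B := by
    intro l
    induction l with
    | nil => intro B; rfl
    | cons a l ih =>
      intro B
      rw [rightProd, List.foldl_cons, List.foldl_cons, ih, ih]
      rfl
  rw [rightProd, List.foldl_append, h]
  rfl

variable {n : ℕ}

theorem rightProd_take_map (F : Fin n → Module.End K W) {k : ℕ} (hk : k ≤ n) :
    rightProd (((List.finRange n).take k).map F) = chainP (natExt F) k := by
  induction k with
  | zero => rfl
  | succ k ih =>
    have : (List.finRange n).take (k + 1) = (List.finRange n).take k ++ [⟨k, hk⟩] := by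
      rw [List.take_succ_eq_append_getElem (by simpa using hk)]
      simp
    rw [this, List.map_append, rightProd_append, ih (by omega), chainP, natExt_of_lt F hk]
    rfl

theorem rightProd_reverse_take_map (F : Fin n → Module.End K W) {k : ℕ} (hk : k ≤ n) :
    rightProd (((List.finRange n).take k).reverse.map F) = chainQ (natExt F) k := by
  induction k with
  | zero => rfl
  | succ k ih =>
    have : (List.finRange n).take (k + 1) = (List.finRange n).take k ++ [⟨k, hk⟩] := by
      rw [List.take_succ_eq_append_getElem (by simpa using hk)]
      simp
    rw [this, List.reverse_append, List.map_append, rightProd_append, ih (by omega), chainQ,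
      natExt_of_lt F hk]
    rfl

theorem rightProd_reverse_drop_map (F : Fin n → Module.End K W) {k : ℕ} (hk : k < n) :
    rightProd (((List.finRange n).drop k).reverse.map F) =
      F ⟨k, hk⟩ * rightProd (((List.finRange n).drop (k + 1)).reverse.map F) := by
  have : (List.finRange n).drop k = ⟨k, hk⟩ :: (List.finRange n).drop (k + 1) := by
    rw [List.drop_eq_getElem_cons (by simpa using hk)]
    simp
  rw [this, List.reverse_cons, List.map_append, rightProd_append]
  rfl

theorem chainQ_congr {A : Type*} [Ring A] {T T' : ℕ → A} {k : ℕ} (h : ∀ i < k, T i = T' i) :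
    chainQ T k = chainQ T' k := by
  induction k with
  | zero => rfl
  | succ k ih => rw [chainQ, chainQ, ih fun i hi => h i (by omega), h k (by omega)]

end Extension

/-! ### Genericity of the parameters -/

section Generic

variable {K : Type*} [Field K]

/-- The genericity hypothesis on the parameters. -/
structure Generic (μ : YoungDiagram) (q t : K) : Prop where
  hq : q ≠ 0
  ht : t ≠ 0
  hqt : ∀ a b : ℤ, (a, b) ≠ (0, 0) →
    |b| ≤ (μ.rowLen 0 : ℤ) + (μ.colLen 0 : ℤ) - 1 → q ^ a * t ^ b ≠ 1

variable {n : ℕ} {μ : YoungDiagram} {q t : K}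

theorem Generic.zpow_ne_one (G : Generic μ q t) {b : ℤ} (hb : b ≠ 0)
    (h : |b| ≤ (μ.rowLen 0 : ℤ) + (μ.colLen 0 : ℤ) - 1) : t ^ b ≠ 1 := by
  simpa using G.hqt 0 b (by simpa using hb) h

/-- The tableau supplies a box, so that the bound on the exponents of t is at least 1. -/
theorem Generic.t_ne_one (G : Generic μ q t) (S : RSYT n μ) : t ≠ 1 := by
  have := RSYT.content_sub_content_lt S S 0 0
  simpa using G.zpow_ne_one (b := 1) one_ne_zero (by simpa using this)

theorem Generic.q_ne_one (G : Generic μ q t) (S : RSYT n μ) : q ≠ 1 := by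
  have := RSYT.content_sub_content_lt S S 0 0
  simp only [sub_self, abs_zero] at this
  simpa using G.hqt 1 0 (by simp) (by simpa using by omega)

theorem u_inv (t : K) {z : K} (hz : z ≠ 0) : u t z⁻¹ = u t z := by
  by_cases h : z = 1
  · simp [h]
  · have h1 : 1 - z ≠ 0 := sub_ne_zero.2 (Ne.symm h)
    have h2 : z - 1 ≠ 0 := sub_ne_zero.2 h
    have h3 : 1 - z⁻¹ ≠ 0 := by
      rw [sub_ne_zero]
      intro h'
      exact h (by simpa using h'.symm)
    simp only [u]
    rw [div_eq_div_iff (pow_ne_zero 2 h3) (pow_ne_zero 2 h1)]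
    field_simp
    ring

end Generic

/-! ### The Hecke algebra representation on tableaux -/

section TauAction

variable {K : Type*} [Field K] {n : ℕ} {μ : YoungDiagram} {q t : K}

/-- The coefficient of the exchanged tableau in the action of a generator. -/
noncomputable def exchCoef (t : K) (b : ℤ) : K := if 2 ≤ b then 1 else u t (t ^ b)

/-- u vanishes at t and t⁻¹. This absorbs the row and column cases into the general formula of
`tauBasis_eq`, where the exchanged tableau then drops out. -/
theorem exchCoef_of_abs (ht : t ≠ 0) {b : ℤ} (hb : b ≠ 0) (h : ¬ 2 ≤ |b|) :
    exchCoef t b = 0 := by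
  rw [exchCoef, if_neg (fun h' => h (h'.trans (le_abs_self b)))]
  have : b = 1 ∨ b = -1 := by
    rw [le_abs] at h
    omega
  rcases this with rfl | rfl
  · simp [u]
  · simp [u, ht]

theorem exchCoef_mul (ht : t ≠ 0) {b : ℤ} (h : 2 ≤ |b|) :
    exchCoef t b * exchCoef t (-b) = u t (t ^ (-b)) := by
  rcases le_abs.1 h with h1 | h1
  · rw [exchCoef, exchCoef, if_pos h1, if_neg (by omega), one_mul]
  · rw [exchCoef, exchCoef, if_pos h1, if_neg (by omega), mul_one, zpow_neg,
      u_inv t (zpow_ne_zero _ ht)]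

theorem tauBasis_eq (G : Generic μ q t) (i : Fin n) (S : RSYT n μ) :
    tauBasis t i S =
      exchCoef t (S.content i.castSucc - S.content i.succ) • Finsupp.single (S.exch i) 1 -
        bpar t (t ^ (-(S.content i.castSucc - S.content i.succ))) • Finsupp.single S 1 := by
  have ht := G.ht
  have h1 : t - 1 ≠ 0 := sub_ne_zero.2 (G.t_ne_one S)
  have h1' : 1 - t ≠ 0 := sub_ne_zero.2 (G.t_ne_one S).symm
  have h0 := S.content_sub_ne_zero i
  rw [tauBasis]
  split_ifs with hr hc hb
  · have hb := S.content_of_row_eq i hr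
    rw [exchCoef_of_abs ht h0 (by rw [hb]; norm_num), hb]
    have : -bpar t (t ^ (-1 : ℤ)) = t := by
      rw [bpar, zpow_neg_one]
      have : t⁻¹ - 1 ≠ 0 := by
        rw [sub_ne_zero]
        simpa using G.t_ne_one S
      field_simp
      ring
    rw [zero_smul, zero_sub, ← neg_smul, this, Finsupp.smul_single_one]
  · have hb := S.content_of_col_eq i hc
    rw [exchCoef_of_abs ht h0 (by rw [hb]; norm_num), hb]
    rw [zero_smul, zero_sub, ← neg_smul, bpar, neg_neg, zpow_one, div_self h1,
      Finsupp.smul_single_one]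
  · rw [exchCoef, if_pos hb, one_smul, sub_eq_add_neg (Finsupp.single _ _), ← neg_smul,
      Finsupp.smul_single_one, bpar, neg_sub, ← div_neg, neg_sub]
  · have hz : t ^ (S.content i.castSucc - S.content i.succ) ≠ 0 := zpow_ne_zero _ ht
    have hne : t ^ (S.content i.castSucc - S.content i.succ) ≠ 1 :=
      G.zpow_ne_one h0 (by
        have := RSYT.content_sub_content_lt S S i.castSucc i.succ
        omega)
    simp only
    rw [exchCoef, if_neg hb, sub_eq_add_neg (_ • _), ← neg_smul, Finsupp.smul_single_one,
      Finsupp.smul_single_one, zpow_neg, zpow_add_one₀ ht, zpow_sub_one₀ ht]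
    generalize t ^ (S.content i.castSucc - S.content i.succ) = z at hz hne
    have e1 : z - 1 ≠ 0 := sub_ne_zero.2 hne
    have e2 : 1 - z ≠ 0 := sub_ne_zero.2 hne.symm
    have e3 : z⁻¹ - 1 ≠ 0 := by
      rw [sub_ne_zero]
      simpa using hne
    congr 2
    · rw [u, show (1 - z) ^ 2 = (z - 1) ^ 2 by ring]
      field_simp
      ring
    · rw [bpar]
      field_simp
      ring

theorem tauT_single (t : K) (i : Fin n) (S : RSYT n μ) :
    tauT t i (Finsupp.single S 1) = tauBasis t i S := by
  simp [tauT]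

theorem inter_tauT (G : Generic μ q t) (i : Fin n) (S : RSYT n μ) {b : ℤ}
    (hb : b = S.content i.castSucc - S.content i.succ) :
    inter t (tauT t i) (t ^ (-b)) (Finsupp.single S 1) =
      exchCoef t b • Finsupp.single (S.exch i) 1 := by
  rw [inter, tauT_single, tauBasis_eq G, hb]
  simp

/-- If S has a genuine exchange, the generator is a 2 × 2 matrix on S and its exchange, and `hinv`
and `hprod` give its trace and determinant. Otherwise it is the scalar t or -1, a root of the
quadratic. -/
theorem tauT_quad (G : Generic μ q t) (i : Fin n) (v : V K n μ) :
    tauT t i (tauT t i v) = (t - 1) • tauT t i v + t • v := by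
  have h : tauT t i ∘ₗ tauT t i = (t - 1) • tauT t i + t • LinearMap.id (M := V K n μ) := by
    refine Finsupp.lhom_ext' fun S => LinearMap.ext_ring ?_
    simp only [LinearMap.comp_apply, LinearMap.add_apply, LinearMap.smul_apply,
      LinearMap.id_apply, Finsupp.lsingle_apply]
    have ht := G.ht
    have h0 := S.content_sub_ne_zero i
    have hle := RSYT.content_sub_content_lt S S i.castSucc i.succ
    obtain ⟨b, hb⟩ : ∃ b, b = S.content i.castSucc - S.content i.succ := ⟨_, rfl⟩
    rw [← hb] at h0 hle
    have hne : t ^ (-b) ≠ 1 := G.zpow_ne_one (by omega) (by rw [abs_neg]; omega)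
    have e1 : t ^ (-b) - 1 ≠ 0 := sub_ne_zero.2 hne
    have hz : t ^ (-b) ≠ 0 := zpow_ne_zero _ ht
    by_cases h2 : 2 ≤ |b|
    · have hb' : -b = (S.exch i).content i.castSucc - (S.exch i).content i.succ := by
        rw [RSYT.content_exch S i (hb ▸ h2), RSYT.content_exch S i (hb ▸ h2),
          Equiv.swap_apply_left, Equiv.swap_apply_right, hb]
        ring
      have hinv : bpar t (t ^ b) = -(t - 1) - bpar t (t ^ (-b)) := by
        rw [show t ^ b = (t ^ (-b))⁻¹ by rw [zpow_neg, inv_inv]]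
        have : (t ^ (-b))⁻¹ - 1 ≠ 0 := by
          rw [sub_ne_zero]
          simpa using hne
        generalize t ^ (-b) = z at *
        rw [bpar, bpar]
        field_simp
        ring
      have hprod : exchCoef t b * exchCoef t (-b) = t + bpar t (t ^ (-b)) * bpar t (t ^ b) := by
        rw [exchCoef_mul ht h2, hinv]
        generalize t ^ (-b) = z at *
        rw [bpar, u, show (1 - z) ^ 2 = (z - 1) ^ 2 by ring]
        field_simp
        ring
      rw [tauT_single, tauBasis_eq G, ← hb, map_sub, map_smul, map_smul, tauT_single, tauT_single,
        tauBasis_eq G, tauBasis_eq G, ← hb, ← hb', RSYT.exch_exch, neg_neg]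
      have : exchCoef t b • (exchCoef t (-b) • Finsupp.single S (1 : K) -
          bpar t (t ^ b) • Finsupp.single (S.exch i) 1) =
          (exchCoef t b * exchCoef t (-b)) • Finsupp.single S (1 : K) -
          (exchCoef t b * bpar t (t ^ b)) • Finsupp.single (S.exch i) 1 := by module
      rw [this, hprod, hinv]
      module
    · rw [tauT_single, tauBasis_eq G, ← hb, exchCoef_of_abs ht h0 h2, zero_smul, zero_sub,
        map_neg, map_smul, tauT_single, tauBasis_eq G, ← hb, exchCoef_of_abs ht h0 h2]
      have hcases : b = 1 ∨ b = -1 := by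
        rw [le_abs] at h2
        omega
      have : (bpar t (t ^ (-b)) + t) * (bpar t (t ^ (-b)) - 1) = 0 := by
        rw [mul_eq_zero]
        rcases hcases with rfl | rfl
        · left
          rw [zpow_neg_one, bpar, show t⁻¹ - 1 = (1 - t) / t by field_simp]
          have : 1 - t ≠ 0 := sub_ne_zero.2 (G.t_ne_one S).symm
          field_simp
          ring
        · right
          rw [neg_neg, zpow_one] at e1 ⊢
          rw [bpar, div_self e1, sub_self]
      have h3 : ((bpar t (t ^ (-b)) + t) * (bpar t (t ^ (-b)) - 1)) •
          Finsupp.single S (1 : K) = 0 := by rw [this, zero_smul]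
      rw [← sub_eq_zero, ← h3]
      module
  exact LinearMap.congr_fun h v

/-- One side of the Yang–Baxter equation on a basis tableau. The alternative in `hi` lets the same
computation serve both sides; if an exchange is impossible its coefficient is zero and the whole
chain vanishes. -/
theorem inter_tauT_chain (G : Generic μ q t) (S : RSYT n μ) {i j : Fin n}
    {a b c : Fin (n + 1)} (hi : (i.castSucc = a ∧ i.succ = b) ∧ j.castSucc = b ∧ j.succ = c ∨
      (i.castSucc = b ∧ i.succ = c) ∧ j.castSucc = a ∧ j.succ = b)
    {x y : ℤ} (hx : x = S.content i.castSucc - S.content i.succ)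
    (hy : y = S.content j.castSucc - S.content j.succ) :
    ∃ S' : RSYT n μ, (2 ≤ |x| → 2 ≤ |x + y| → 2 ≤ |y| →
        ∀ k, S'.content k = S.content (Equiv.swap a c k)) ∧
      inter t (tauT t i) (t ^ (-y)) (inter t (tauT t j) (t ^ (-(x + y)))
        (inter t (tauT t i) (t ^ (-x)) (Finsupp.single S 1))) =
      (exchCoef t x * exchCoef t (x + y) * exchCoef t y) • Finsupp.single S' 1 := by
  have hab : a ≠ b := by
    rintro rfl
    rcases hi with ⟨⟨h1, h2⟩, h3, h4⟩ | ⟨⟨h1, h2⟩, h3, h4⟩ <;>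
      simp only [Fin.ext_iff, Fin.val_succ, Fin.val_castSucc] at * <;> omega
  have hbc : b ≠ c := by
    rintro rfl
    rcases hi with ⟨⟨h1, h2⟩, h3, h4⟩ | ⟨⟨h1, h2⟩, h3, h4⟩ <;>
      simp only [Fin.ext_iff, Fin.val_succ, Fin.val_castSucc] at * <;> omega
  have hac : a < c ∧ (c : ℕ) ≤ a + 2 := by
    rcases hi with ⟨⟨h1, h2⟩, h3, h4⟩ | ⟨⟨h1, h2⟩, h3, h4⟩ <;>
      simp only [Fin.ext_iff, Fin.lt_def, Fin.val_succ, Fin.val_castSucc] at * <;> omega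
  have hx0 : x ≠ 0 := hx ▸ S.content_sub_ne_zero i
  have hy0 : y ≠ 0 := hy ▸ S.content_sub_ne_zero j
  have hxy : x + y = S.content a - S.content c := by
    rcases hi with ⟨⟨h1, h2⟩, h3, h4⟩ | ⟨⟨h1, h2⟩, h3, h4⟩ <;>
    · rw [hx, hy, h1, h2, h3, h4]
      ring
  have hxy0 : x + y ≠ 0 := by
    rw [hxy, sub_ne_zero]
    exact S.content_ne_of_sub_le_two hac.1 hac.2
  rw [inter_tauT G i S hx, inter_smul, inter_smul]
  by_cases h1 : 2 ≤ |x|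
  swap
  · exact ⟨S, fun h => absurd h h1, by simp [exchCoef_of_abs G.ht hx0 h1]⟩
  have c1 := RSYT.content_exch S i (hx ▸ h1)
  have e1 : x + y = (S.exch i).content j.castSucc - (S.exch i).content j.succ := by
    rw [c1, c1, hxy]
    rcases hi with ⟨⟨h1, h2⟩, h3, h4⟩ | ⟨⟨h1, h2⟩, h3, h4⟩
    · rw [h1, h2, h3, h4, Equiv.swap_apply_right, Equiv.swap_apply_of_ne_of_ne hac.1.ne' hbc.symm]
    · rw [h1, h2, h3, h4, Equiv.swap_apply_left, Equiv.swap_apply_of_ne_of_ne hab hac.1.ne]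
  rw [inter_tauT G j _ e1, inter_smul]
  by_cases h2 : 2 ≤ |x + y|
  swap
  · exact ⟨S, fun _ h => absurd h h2, by simp [exchCoef_of_abs G.ht hxy0 h2]⟩
  have c2 := RSYT.content_exch (S.exch i) j (e1 ▸ h2)
  have e2 : y = ((S.exch i).exch j).content i.castSucc - ((S.exch i).exch j).content i.succ := by
    rw [c2, c2, c1, c1, hy]
    rcases hi with ⟨⟨h1, h2⟩, h3, h4⟩ | ⟨⟨h1, h2⟩, h3, h4⟩
    · rw [h1, h2, h3, h4, Equiv.swap_apply_left, Equiv.swap_apply_of_ne_of_ne hab hac.1.ne,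
        Equiv.swap_apply_left, Equiv.swap_apply_of_ne_of_ne hac.1.ne' hbc.symm]
    · rw [h1, h2, h3, h4, Equiv.swap_apply_right,
        Equiv.swap_apply_of_ne_of_ne hac.1.ne' hbc.symm, Equiv.swap_apply_right,
        Equiv.swap_apply_of_ne_of_ne hab hac.1.ne]
  rw [inter_tauT G i _ e2, smul_smul, smul_smul]
  refine ⟨_, fun _ _ h3 k => ?_, rfl⟩
  rw [RSYT.content_exch _ i (e2 ▸ h3), c2, c1]
  congr 1
  have hs : Equiv.swap a c = Equiv.swap a b * Equiv.swap b c * Equiv.swap a b := by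
    rw [Equiv.swap_comm a b, Equiv.swap_comm b c,
      Equiv.swap_mul_swap_mul_swap hbc.symm hac.1.ne']
  have hs' : Equiv.swap a c = Equiv.swap b c * Equiv.swap a b * Equiv.swap b c := by
    rw [Equiv.swap_mul_swap_mul_swap hab hac.1.ne, Equiv.swap_comm]
  rcases hi with ⟨⟨h1, h2⟩, h3, h4⟩ | ⟨⟨h1, h2⟩, h3, h4⟩
  · rw [h1, h2, h3, h4, hs]
    rfl
  · rw [h1, h2, h3, h4, hs']
    rfl

/-- By `yang_baxter_iff` it suffices to compare the two chains of intertwiners. They have the same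
three coefficients, and unless one of these vanishes both end in the tableau with the outer two of
the three entries exchanged. -/
theorem tauT_braid (G : Generic μ q t) {i j : Fin n} (hij : i.succ = j.castSucc)
    (v : V K n μ) :
    tauT t i (tauT t j (tauT t i v)) = tauT t j (tauT t i (tauT t j v)) := by
  have h : tauT t i ∘ₗ tauT t j ∘ₗ tauT t i =
      (tauT t j ∘ₗ tauT t i ∘ₗ tauT t j : V K n μ →ₗ[K] V K n μ) := by
    refine Finsupp.lhom_ext' fun S => LinearMap.ext_ring ?_
    simp only [LinearMap.comp_apply, Finsupp.lsingle_apply]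
    obtain ⟨x, hx⟩ : ∃ x, x = S.content i.castSucc - S.content i.succ := ⟨_, rfl⟩
    obtain ⟨y, hy⟩ : ∃ y, y = S.content j.castSucc - S.content j.succ := ⟨_, rfl⟩
    obtain ⟨S₁, h1, e1⟩ := inter_tauT_chain G S (i := i) (j := j) (a := i.castSucc)
      (b := i.succ) (c := j.succ) (Or.inl ⟨⟨rfl, rfl⟩, hij.symm, rfl⟩) hx hy
    obtain ⟨S₂, h2, e2⟩ := inter_tauT_chain G S (i := j) (j := i) (a := i.castSucc)
      (b := i.succ) (c := j.succ) (Or.inr ⟨⟨hij.symm, rfl⟩, rfl, rfl⟩) hy hx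
    have hx0 : x ≠ 0 := hx ▸ S.content_sub_ne_zero i
    have hy0 : y ≠ 0 := hy ▸ S.content_sub_ne_zero j
    have hxy : x + y = S.content i.castSucc - S.content j.succ := by
      rw [hx, hy, hij]
      ring
    have hxy0 : x + y ≠ 0 := by
      rw [hxy, sub_ne_zero]
      have hv := congrArg Fin.val hij
      simp only [Fin.val_succ, Fin.val_castSucc] at hv
      exact S.content_ne_of_sub_le_two (by rw [Fin.lt_def]; simp; omega) (by simp; omega)
    have b1 := RSYT.content_sub_content_lt S S i.castSucc i.succ
    have b2 := RSYT.content_sub_content_lt S S j.castSucc j.succ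
    have b3 := RSYT.content_sub_content_lt S S i.castSucc j.succ
    rw [← hx] at b1
    rw [← hy] at b2
    rw [← hxy] at b3
    have hmul : t ^ (-x) * t ^ (-y) = t ^ (-(x + y)) := by
      rw [← zpow_add₀ G.ht]
      congr 1
      ring
    refine (yang_baxter_iff (t := t) (r₁ := t ^ (-x)) (r₂ := t ^ (-y))
      (G.zpow_ne_one (by omega) (by rw [abs_neg]; omega))
      (G.zpow_ne_one (by omega) (by rw [abs_neg]; omega))
      (by
        rw [hmul]
        exact G.zpow_ne_one (by omega) (by rw [abs_neg]; omega))
      (tauT_quad G i _) (tauT_quad G j _)).1 ?_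
    rw [hmul, e1]
    rw [add_comm y x] at e2 h2
    rw [e2, mul_right_comm, mul_comm (exchCoef t x), mul_right_comm]
    by_cases g1 : 2 ≤ |x|
    swap
    · simp [exchCoef_of_abs G.ht hx0 g1]
    by_cases g2 : 2 ≤ |x + y|
    swap
    · simp [exchCoef_of_abs G.ht hxy0 g2]
    by_cases g3 : 2 ≤ |y|
    swap
    · simp [exchCoef_of_abs G.ht hy0 g3]
    rw [RSYT.content_injective fun k => (h1 g1 g2 g3 k).trans (h2 g3 g2 g1 k).symm]
  exact LinearMap.congr_fun h v

theorem tauT_comm (G : Generic μ q t) {i j : Fin n} (hij : (i : ℕ) + 1 < j) (v : V K n μ) :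
    tauT t i (tauT t j v) = tauT t j (tauT t i v) := by
  have h : tauT t i ∘ₗ tauT t j = (tauT t j ∘ₗ tauT t i : V K n μ →ₗ[K] V K n μ) := by
    refine Finsupp.lhom_ext' fun S => LinearMap.ext_ring ?_
    simp only [LinearMap.comp_apply, Finsupp.lsingle_apply]
    have n1 : i.castSucc ≠ j.castSucc := by simp [Fin.ext_iff]; omega
    have n2 : i.castSucc ≠ j.succ := by simp [Fin.ext_iff]; omega
    have n3 : i.succ ≠ j.castSucc := by simp [Fin.ext_iff]; omega
    have n4 : i.succ ≠ j.succ := by simp [Fin.ext_iff]; omega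
    have k1 : ∀ {a b c : Fin n} (S : RSYT n μ), a.castSucc ≠ b.castSucc → a.castSucc ≠ b.succ →
        a.succ ≠ b.castSucc → a.succ ≠ b.succ → (S.exch b).content a.castSucc -
        (S.exch b).content a.succ = S.content a.castSucc - S.content a.succ := by
      intro a b c S h1 h2 h3 h4
      by_cases h : 2 ≤ |S.content b.castSucc - S.content b.succ|
      · rw [RSYT.content_exch S b h, RSYT.content_exch S b h,
          Equiv.swap_apply_of_ne_of_ne h1 h2, Equiv.swap_apply_of_ne_of_ne h3 h4]
      · rw [RSYT.exch_eq_self S b h]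
    have a1 := k1 (c := i) S n1 n2 n3 n4
    have a2 := k1 (c := i) S n1.symm n3.symm n2.symm n4.symm
    have a3 : (S.exch i).exch j = (S.exch j).exch i := by
      by_cases h : 2 ≤ |S.content j.castSucc - S.content j.succ|
      · by_cases h' : 2 ≤ |S.content i.castSucc - S.content i.succ|
        · refine RSYT.content_injective fun k => ?_
          rw [RSYT.content_exch (S.exch i) j (by rwa [a2]), RSYT.content_exch S i h',
            RSYT.content_exch (S.exch j) i (by rwa [a1]), RSYT.content_exch S j h]
          congr 1
          have hd : (Equiv.swap i.castSucc i.succ).Disjoint (Equiv.swap j.castSucc j.succ) := by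
            refine Equiv.Perm.disjoint_swap_swap ?_
            simp [n1, n2, n3, n4]
            simp [Fin.ext_iff]
          exact Equiv.congr_fun hd.commute.eq k
        · rw [RSYT.exch_eq_self S i h', RSYT.exch_eq_self (S.exch j) i (by rwa [a1])]
      · rw [RSYT.exch_eq_self S j h, RSYT.exch_eq_self (S.exch i) j (by rwa [a2])]
    rw [tauT_single, tauT_single, tauBasis_eq G, tauBasis_eq G]
    simp only [map_sub, map_smul, tauT_single, tauBasis_eq G, a1, a2, a3]
    module
  exact LinearMap.congr_fun h v

end TauAction

end VVMac

namespace VVMac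

/-! ### Relations of the operators on P_τ -/

section OperatorRelations

variable {K : Type*} [Field K] {n : ℕ} {μ : YoungDiagram} {q t : K}

open MvPolynomial

variable (K μ) in
/-- Multiplication by `x_j`. -/
noncomputable def mulX (j : Fin (n + 1)) : PV K n μ →ₗ[K] PV K n μ :=
  TensorProduct.map (LinearMap.mulLeft K (X j)) LinearMap.id

theorem mulX_last : mulX K μ (Fin.last n) = mulXN K n μ := rfl

theorem mulX_tmul (j : Fin (n + 1)) (p : MvPolynomial (Fin (n + 1)) K) (v : V K n μ) :
    mulX K μ j (p ⊗ₜ v) = (X j * p) ⊗ₜ v := rfl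

theorem mulX_comm (i j : Fin (n + 1)) (f : PV K n μ) :
    mulX K μ i (mulX K μ j f) = mulX K μ j (mulX K μ i f) := by
  induction f using TensorProduct.induction_on with
  | zero => simp
  | tmul p v => rw [mulX_tmul, mulX_tmul, mulX_tmul, mulX_tmul, mul_left_comm]
  | add f g hf hg => simp only [map_add, hf, hg]

/-- The variables generate P_τ from the constants. A relation between operators is thus reduced to
the same relation for τ together with commutation rules past each variable. -/
theorem linearMap_ext_mulX {W : Type*} [AddCommGroup W] [Module K W]
    {A B : PV K n μ →ₗ[K] W} (h1 : ∀ v, A (1 ⊗ₜ v) = B (1 ⊗ₜ v))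
    (hX : ∀ j f, A f = B f → A (mulX K μ j f) = B (mulX K μ j f)) : A = B := by
  refine TensorProduct.ext' fun p v => ?_
  induction p using MvPolynomial.induction_on with
  | C a =>
    have : (C a : MvPolynomial (Fin (n + 1)) K) = a • 1 := by rw [← C_mul', mul_one]
    rw [this, ← TensorProduct.smul_tmul', map_smul, map_smul, h1]
  | add p r hp hr => rw [TensorProduct.add_tmul, map_add, map_add, hp, hr]
  | mul_X p j hp => rw [mul_comm, ← mulX_tmul, hX _ _ hp]

theorem opT_tmul (t : K) (i : Fin n) (p : MvPolynomial (Fin (n + 1)) K) (v : V K n μ) :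
    opT t i (p ⊗ₜ v) = ((1 - t) • (X i.succ * divDiff i p)) ⊗ₜ v +
      rename (Equiv.swap i.castSucc i.succ) p ⊗ₜ tauT t i v := rfl

theorem divDiff_one (i : Fin n) : divDiff (K := K) i 1 = 0 := by
  apply mul_left_cancel₀ (X_sub_X_ne_zero (K := K) i)
  rw [X_sub_X_mul_divDiff, map_one, sub_self, mul_zero]

theorem opT_one_tmul (t : K) (i : Fin n) (v : V K n μ) :
    opT t i (1 ⊗ₜ v) = 1 ⊗ₜ tauT t i v := by
  rw [opT_tmul, divDiff_one, mul_zero, smul_zero, TensorProduct.zero_tmul, zero_add, map_one]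

theorem opT_mulX_castSucc (t : K) (i : Fin n) (f : PV K n μ) :
    opT t i (mulX K μ i.castSucc f) =
      mulX K μ i.succ (opT t i f) + (1 - t) • mulX K μ i.succ f := by
  induction f using TensorProduct.induction_on with
  | zero => simp
  | tmul p v =>
    have h : divDiff i (X i.castSucc * p) = p + X i.succ * divDiff i p := by
      apply mul_left_cancel₀ (X_sub_X_ne_zero (K := K) i)
      rw [X_sub_X_mul_divDiff, map_mul, rename_X, Equiv.swap_apply_left]
      linear_combination -X i.succ * X_sub_X_mul_divDiff i p
    rw [mulX_tmul, opT_tmul, opT_tmul, map_add, mulX_tmul, mulX_tmul, mulX_tmul, h, map_mul,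
      rename_X, Equiv.swap_apply_left, mul_smul_comm, TensorProduct.smul_tmul', mul_add, smul_add,
      TensorProduct.add_tmul]
    abel
  | add f g hf hg =>
    simp only [map_add, hf, hg, smul_add]
    abel

theorem opT_mulX_succ (t : K) (i : Fin n) (f : PV K n μ) :
    opT t i (mulX K μ i.succ f) =
      mulX K μ i.castSucc (opT t i f) - (1 - t) • mulX K μ i.succ f := by
  induction f using TensorProduct.induction_on with
  | zero => simp
  | tmul p v =>
    have h : divDiff i (X i.succ * p) = X i.castSucc * divDiff i p - p := by
      apply mul_left_cancel₀ (X_sub_X_ne_zero (K := K) i)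
      rw [X_sub_X_mul_divDiff, map_mul, rename_X, Equiv.swap_apply_right]
      linear_combination -X i.castSucc * X_sub_X_mul_divDiff i p
    rw [mulX_tmul, opT_tmul, opT_tmul, map_add, mulX_tmul, mulX_tmul, h, map_mul,
      rename_X, Equiv.swap_apply_right, mul_smul_comm, TensorProduct.smul_tmul', mul_sub, smul_sub,
      TensorProduct.sub_tmul, mul_left_comm]
    abel
  | add f g hf hg =>
    simp only [map_add, hf, hg, smul_add]
    abel

theorem opT_mulX_of_ne (t : K) {i : Fin n} {j : Fin (n + 1)} (h1 : j ≠ i.castSucc)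
    (h2 : j ≠ i.succ) (f : PV K n μ) :
    opT t i (mulX K μ j f) = mulX K μ j (opT t i f) := by
  induction f using TensorProduct.induction_on with
  | zero => simp
  | tmul p v =>
    have h : divDiff i (X j * p) = X j * divDiff i p := by
      apply mul_left_cancel₀ (X_sub_X_ne_zero (K := K) i)
      rw [X_sub_X_mul_divDiff, map_mul, rename_X, Equiv.swap_apply_of_ne_of_ne h1 h2]
      linear_combination -X j * X_sub_X_mul_divDiff i p
    rw [mulX_tmul, opT_tmul, opT_tmul, map_add, mulX_tmul, mulX_tmul, h, map_mul,
      rename_X, Equiv.swap_apply_of_ne_of_ne h1 h2, mul_smul_comm, mul_left_comm]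
  | add f g hf hg => simp only [map_add, hf, hg]

theorem opT_quad (G : Generic μ q t) (i : Fin n) (f : PV K n μ) :
    opT t i (opT t i f) = (t - 1) • opT t i f + t • f := by
  have h : opT t i ∘ₗ opT t i = (t - 1) • opT t i + t • LinearMap.id (M := PV K n μ) := by
    refine linearMap_ext_mulX (fun v => ?_) fun j f hf => ?_
    · simp only [LinearMap.comp_apply, LinearMap.add_apply, LinearMap.smul_apply,
        LinearMap.id_apply, opT_one_tmul, tauT_quad G, TensorProduct.tmul_add,
        TensorProduct.tmul_smul]
    · simp only [LinearMap.comp_apply, LinearMap.add_apply, LinearMap.smul_apply,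
        LinearMap.id_apply] at hf ⊢
      by_cases h1 : j = i.castSucc
      · subst h1
        simp only [opT_mulX_castSucc, opT_mulX_succ, map_add, map_smul, hf]
        module
      by_cases h2 : j = i.succ
      · subst h2
        simp only [opT_mulX_castSucc, opT_mulX_succ, map_sub, map_add, map_smul, hf]
        module
      · simp only [opT_mulX_of_ne t h1 h2, map_add, map_smul, hf]
  exact LinearMap.congr_fun h f

/-- `A`, `B`, `C` stand for the three consecutive variables that the two generators move. Commuting
either braid word past a variable leaves lower terms that match by the quadratic relations. -/
theorem braid_step {W : Type*} [AddCommGroup W] [Module K W] {T₁ T₂ A B C : W →ₗ[K] W}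
    (q1 : ∀ f, T₁ (T₁ f) = (t - 1) • T₁ f + t • f)
    (q2 : ∀ f, T₂ (T₂ f) = (t - 1) • T₂ f + t • f)
    (a1 : ∀ f, T₁ (A f) = B (T₁ f) + (1 - t) • B f) (b1 : ∀ f, T₁ (B f) = A (T₁ f) - (1 - t) • B f)
    (c1 : ∀ f, T₁ (C f) = C (T₁ f)) (a2 : ∀ f, T₂ (A f) = A (T₂ f))
    (b2 : ∀ f, T₂ (B f) = C (T₂ f) + (1 - t) • C f)
    (c2 : ∀ f, T₂ (C f) = B (T₂ f) - (1 - t) • C f) {f : W}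
    (h : T₁ (T₂ (T₁ f)) = T₂ (T₁ (T₂ f))) :
    T₁ (T₂ (T₁ (A f))) = T₂ (T₁ (T₂ (A f))) ∧ T₁ (T₂ (T₁ (B f))) = T₂ (T₁ (T₂ (B f))) ∧
      T₁ (T₂ (T₁ (C f))) = T₂ (T₁ (T₂ (C f))) := by
  refine ⟨?_, ?_, ?_⟩ <;>
  · simp only [a1, a2, b1, b2, c1, c2, map_add, map_sub, map_smul, q1, q2, h]
    module

theorem opT_braid (G : Generic μ q t) {i j : Fin n} (hij : i.succ = j.castSucc)
    (f : PV K n μ) :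
    opT t i (opT t j (opT t i f)) = opT t j (opT t i (opT t j f)) := by
  have hv := congrArg Fin.val hij
  simp only [Fin.val_succ, Fin.val_castSucc] at hv
  have n1 : j.succ ≠ i.castSucc := by simp [Fin.ext_iff]; omega
  have n2 : j.succ ≠ i.succ := by simp [Fin.ext_iff]; omega
  have n3 : i.castSucc ≠ j.castSucc := by simp [Fin.ext_iff]; omega
  have h : opT t i ∘ₗ opT t j ∘ₗ opT t i =
      (opT t j ∘ₗ opT t i ∘ₗ opT t j : PV K n μ →ₗ[K] PV K n μ) := by
    refine linearMap_ext_mulX (fun v => ?_) fun k f hf => ?_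
    · simp only [LinearMap.comp_apply, opT_one_tmul, tauT_braid G hij]
    · simp only [LinearMap.comp_apply] at hf ⊢
      obtain ⟨hA, hB, hC⟩ := braid_step (A := mulX K μ i.castSucc) (B := mulX K μ i.succ)
        (C := mulX K μ j.succ) (opT_quad G i) (opT_quad G j) (opT_mulX_castSucc t i)
        (opT_mulX_succ t i) (opT_mulX_of_ne t n1 n2) (opT_mulX_of_ne t n3 n1.symm)
        (by rw [hij]; exact opT_mulX_castSucc t j) (by rw [hij]; exact opT_mulX_succ t j) hf
      by_cases h1 : k = i.castSucc
      · rwa [h1]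
      by_cases h2 : k = i.succ
      · rwa [h2]
      by_cases h3 : k = j.succ
      · rwa [h3]
      have h2' : k ≠ j.castSucc := hij ▸ h2
      simp only [opT_mulX_of_ne t h1 h2, opT_mulX_of_ne t h2' h3, hf]
  exact LinearMap.congr_fun h f

theorem opT_comm (G : Generic μ q t) {i j : Fin n} (hij : (i : ℕ) + 1 < j) (f : PV K n μ) :
    opT t i (opT t j f) = opT t j (opT t i f) := by
  have n1 : i.castSucc ≠ j.castSucc := by simp [Fin.ext_iff]; omega
  have n2 : i.castSucc ≠ j.succ := by simp [Fin.ext_iff]; omega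
  have n3 : i.succ ≠ j.castSucc := by simp [Fin.ext_iff]; omega
  have n4 : i.succ ≠ j.succ := by simp [Fin.ext_iff]; omega
  have h : opT t i ∘ₗ opT t j = (opT t j ∘ₗ opT t i : PV K n μ →ₗ[K] PV K n μ) := by
    refine linearMap_ext_mulX (fun v => ?_) fun k f hf => ?_
    · simp only [LinearMap.comp_apply, opT_one_tmul, tauT_comm G hij]
    · simp only [LinearMap.comp_apply] at hf ⊢
      have a1 := opT_mulX_of_ne (μ := μ) t n1 n2
      have a2 := opT_mulX_of_ne (μ := μ) t n3 n4
      have a3 := opT_mulX_of_ne (μ := μ) t n1.symm n3.symm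
      have a4 := opT_mulX_of_ne (μ := μ) t n2.symm n4.symm
      by_cases h1 : k = i.castSucc
      · subst h1
        simp only [a1, a2, opT_mulX_castSucc, map_add, map_smul, hf]
      by_cases h2 : k = i.succ
      · subst h2
        simp only [a1, a2, opT_mulX_succ, map_sub, map_smul, hf]
      by_cases h3 : k = j.castSucc
      · subst h3
        simp only [a3, a4, opT_mulX_castSucc, map_add, map_smul, hf]
      by_cases h4 : k = j.succ
      · subst h4
        simp only [a3, a4, opT_mulX_succ, map_sub, map_smul, hf]
      simp only [opT_mulX_of_ne t h1 h2, opT_mulX_of_ne t h3 h4, hf]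
  exact LinearMap.congr_fun h f

theorem opW_one_tmul (q t : K) (v : V K n μ) :
    opW q t (1 ⊗ₜ v) = 1 ⊗ₜ tauOmega t v := by
  rw [opW, TensorProduct.map_tmul, AlgHom.toLinearMap_apply, map_one]

theorem opW_mulX_zero (q t : K) (f : PV K n μ) :
    opW q t (mulX K μ 0 f) = q • mulX K μ (Fin.last n) (opW q t f) := by
  induction f using TensorProduct.induction_on with
  | zero => simp
  | tmul p v =>
    rw [mulX_tmul, opW, TensorProduct.map_tmul, TensorProduct.map_tmul, mulX_tmul,
      AlgHom.toLinearMap_apply, map_mul, aeval_X, Fin.cons_zero, mul_assoc, ← smul_eq_C_mul,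
      TensorProduct.smul_tmul']
    rfl
  | add f g hf hg => simp only [map_add, hf, hg, smul_add]

theorem opW_mulX_succ (q t : K) (k : Fin n) (f : PV K n μ) :
    opW q t (mulX K μ k.succ f) = mulX K μ k.castSucc (opW q t f) := by
  induction f using TensorProduct.induction_on with
  | zero => simp
  | tmul p v =>
    rw [mulX_tmul, opW, TensorProduct.map_tmul, TensorProduct.map_tmul, mulX_tmul,
      AlgHom.toLinearMap_apply, map_mul, aeval_X, Fin.cons_succ]
    rfl
  | add f g hf hg => simp only [map_add, hf, hg]

theorem tauOmega_eq (t : K) : (tauOmega t : Module.End K (V K n μ)) =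
    chainP (natExt (tauT t : Fin n → Module.End K (V K n μ))) n := by
  rw [← rightProd_take_map _ le_rfl, List.take_of_length_le (by simp)]
  rfl

theorem heckeRel_tau (G : Generic μ q t) :
    HeckeRel n t (natExt (tauT t : Fin n → Module.End K (V K n μ))) where
  quad i hi := by
    rw [natExt_of_lt _ hi]
    exact LinearMap.ext fun v => tauT_quad G _ v
  braid i hi := by
    rw [natExt_of_lt _ hi, natExt_of_lt _ (show i < n by omega)]
    exact LinearMap.ext fun v => tauT_braid G rfl v
  comm i j hij hj := by
    rw [natExt_of_lt _ hj, natExt_of_lt _ (show i < n by omega)]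
    exact LinearMap.ext fun v => tauT_comm G hij v

theorem opT_opW (G : Generic μ q t) {i j : Fin n} (hij : i.succ = j.castSucc) (f : PV K n μ) :
    opT t i (opW q t f) = opW q t (opT t j f) := by
  have hv := congrArg Fin.val hij
  simp only [Fin.val_succ, Fin.val_castSucc] at hv
  have h : opT t i ∘ₗ opW q t = (opW q t ∘ₗ opT t j : PV K n μ →ₗ[K] PV K n μ) := by
    refine linearMap_ext_mulX (fun v => ?_) fun k f hf => ?_
    · have := LinearMap.congr_fun ((heckeRel_tau (n := n) G).mul_chainP (i := i) (k := n)
        (by omega) le_rfl) v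
      rw [← tauOmega_eq, hv, natExt_val, natExt_val] at this
      simp only [LinearMap.comp_apply, opT_one_tmul, opW_one_tmul]
      exact congrArg _ this
    · simp only [LinearMap.comp_apply] at hf ⊢
      refine Fin.cases ?_ (fun k => ?_) k
      · rw [opW_mulX_zero, map_smul, opT_mulX_of_ne, opT_mulX_of_ne, opW_mulX_zero, hf] <;>
          simp [Fin.ext_iff] <;> omega
      · rw [opW_mulX_succ]
        by_cases h1 : k = i
        · subst h1
          rw [hij, opT_mulX_castSucc, opT_mulX_castSucc, map_add, map_smul, opW_mulX_succ,
            opW_mulX_succ, ← hij, hf]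
        by_cases h2 : k = j
        · subst h2
          rw [← hij, opT_mulX_succ, opT_mulX_succ, map_sub, map_smul, opW_mulX_succ, ← hij,
            opW_mulX_succ, hf]
        · rw [opT_mulX_of_ne, opT_mulX_of_ne, opW_mulX_succ, hf] <;>
            simp only [ne_eq, Fin.ext_iff, Fin.val_succ, Fin.val_castSucc] at * <;> omega
  exact LinearMap.congr_fun h f

theorem opT_opW_opW (G : Generic μ q t) {i j : Fin n} (hi : (i : ℕ) + 1 = n) (hj : (j : ℕ) = 0)
    (f : PV K n μ) :
    opT t i (opW q t (opW q t f)) = opW q t (opW q t (opT t j f)) := by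
  have h : opT t i ∘ₗ opW q t ∘ₗ opW q t =
      (opW q t ∘ₗ opW q t ∘ₗ opT t j : PV K n μ →ₗ[K] PV K n μ) := by
    -- Two rotations carry the first two variables to the last two, each with exactly one factor q,
    -- so the rules for `j` and `i` correspond.
    have x0 : ∀ f, opW q t (opW q t (mulX K μ j.castSucc f)) =
        q • mulX K μ i.castSucc (opW q t (opW q t f)) := by
      intro f
      have e1 : j.castSucc = 0 := Fin.ext (by simpa using hj)
      have e2 : Fin.last n = i.succ := Fin.ext (by simp [hi])
      rw [e1, opW_mulX_zero, map_smul, e2, opW_mulX_succ]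
    have x1 : ∀ f, opW q t (opW q t (mulX K μ j.succ f)) =
        q • mulX K μ i.succ (opW q t (opW q t f)) := by
      intro f
      have e1 : j.castSucc = 0 := Fin.ext (by simpa using hj)
      have e2 : Fin.last n = i.succ := Fin.ext (by simp [hi])
      rw [opW_mulX_succ, e1, opW_mulX_zero, e2]
    refine linearMap_ext_mulX (fun v => ?_) fun k f hf => ?_
    · have := LinearMap.congr_fun ((heckeRel_tau (n := n) G).mul_chainP_sq (m := i) hi.symm) v
      rw [← tauOmega_eq, ← hj, natExt_val, natExt_val] at this
      simp only [LinearMap.comp_apply, opT_one_tmul, opW_one_tmul]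
      exact congrArg _ this
    · simp only [LinearMap.comp_apply] at hf ⊢
      by_cases h1 : k = j.castSucc
      · subst h1
        simp only [x0, x1, opT_mulX_castSucc, map_add, map_smul, hf]
        module
      by_cases h2 : k = j.succ
      · subst h2
        simp only [x0, x1, opT_mulX_succ, map_sub, map_smul, hf]
        module
      obtain ⟨l, hl⟩ : ∃ l : Fin n, k = l.succ := Fin.exists_succ_eq.2 (by
        rintro rfl
        exact h1 (Fin.ext (by simp [hj]))) |>.imp fun _ h => h.symm
      obtain ⟨m, hm⟩ : ∃ m : Fin n, l.castSucc = m.succ := Fin.exists_succ_eq.2 (by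
        intro h0
        apply h2
        rw [hl]
        have := congrArg Fin.val h0
        simp only [Fin.val_castSucc, Fin.val_zero] at this
        exact Fin.ext (by simp [hj, this])) |>.imp fun _ h => h.symm
      have hv := congrArg Fin.val hm
      simp only [Fin.val_succ, Fin.val_castSucc] at hv
      have hml : (l : ℕ) < n := l.isLt
      rw [opT_mulX_of_ne t h1 h2, hl, opW_mulX_succ, opW_mulX_succ, hm, opW_mulX_succ,
        opW_mulX_succ, opT_mulX_of_ne, hf] <;>
        simp only [ne_eq, Fin.ext_iff, Fin.val_succ, Fin.val_castSucc] <;> omega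
  exact LinearMap.congr_fun h f

theorem natExt_opTinv (t : K) {k : ℕ} (hk : k < n) :
    natExt (opTinv t : Fin n → Module.End K (PV K n μ)) k =
      genInv t (natExt (opT t : Fin n → Module.End K (PV K n μ))) k := by
  rw [natExt_of_lt _ hk, genInv, natExt_of_lt _ hk]
  rfl

theorem opXi_eq (q t : K) {k : ℕ} (hk : k < n + 1) :
    (opXi q t ⟨k, hk⟩ : Module.End K (PV K n μ)) = t ^ ((k : ℤ) - (n : ℤ)) •
      ((rightProd (((List.finRange n).drop k).reverse.map (opT t)) : Module.End K (PV K n μ)) *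
        (opW q t * chainR t (natExt (opT t)) k)) := by
  rw [opXi, rightProd_append, rightProd_append, filter_lt_finRange, filter_ge_finRange,
    rightProd_reverse_take_map _ (by omega), chainR,
    chainQ_congr fun i hi => natExt_opTinv t (show i < n by omega)]
  rfl

theorem affineHeckeRel (G : Generic μ q t) :
    AffineHeckeRel n q t (natExt (opT t : Fin n → Module.End K (PV K n μ)))
      (opW q t) (natExt (mulX K μ)) (natExt (opXi q t)) where
  quad i hi := by
    rw [natExt_of_lt _ hi]
    exact LinearMap.ext fun v => opT_quad G _ v
  braid i hi := by
    rw [natExt_of_lt _ hi, natExt_of_lt _ (show i < n by omega)]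
    exact LinearMap.ext fun v => opT_braid G rfl v
  comm i j hij hj := by
    rw [natExt_of_lt _ hj, natExt_of_lt _ (show i < n by omega)]
    exact LinearMap.ext fun v => opT_comm G hij v
  ht := G.ht
  mul_w i hi := by
    rw [natExt_of_lt _ hi, natExt_of_lt _ (show i < n by omega)]
    exact LinearMap.ext fun v => opT_opW G rfl v
  mul_ww m hm := by
    rw [natExt_of_lt _ (show m < n by omega), natExt_of_lt _ (show 0 < n by omega)]
    exact LinearMap.ext fun v => opT_opW_opW G hm.symm rfl v
  xi_last := by
    rw [natExt_of_lt _ (Nat.lt_succ_self n), opXi_eq, List.drop_eq_nil_of_le (by simp), sub_self,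
      zpow_zero, one_smul]
    exact one_mul _
  xi_step i hi := by
    -- The recursion for ξ_i cancels an inverse generator, which already needs the Hecke relations.
    have H : HeckeRel n t (natExt (opT t : Fin n → Module.End K (PV K n μ))) := {
      quad := fun i hi => by
        rw [natExt_of_lt _ hi]
        exact LinearMap.ext fun v => opT_quad G _ v
      braid := fun i hi => by
        rw [natExt_of_lt _ hi, natExt_of_lt _ (show i < n by omega)]
        exact LinearMap.ext fun v => opT_braid G rfl v
      comm := fun i j hij hj => by
        rw [natExt_of_lt _ hj, natExt_of_lt _ (show i < n by omega)]
        exact LinearMap.ext fun v => opT_comm G hij v }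
    rw [natExt_of_lt _ (show i < n + 1 by omega), natExt_of_lt _ (show i + 1 < n + 1 by omega),
      opXi_eq, opXi_eq, rightProd_reverse_drop_map _ hi, chainR_succ, mul_smul_comm,
      smul_mul_assoc, smul_smul, ← natExt_of_lt (opT t) hi]
    simp only [mul_assoc]
    rw [H.genInv_mul G.ht hi, mul_one]
    congr 1
    rw [← zpow_neg_one, ← zpow_add₀ G.ht]
    congr 1
    push_cast
    ring
  inv_x i hi := by
    rw [genInv, natExt_of_lt _ hi, natExt_of_lt _ (show i < n + 1 by omega),
      natExt_of_lt _ (show i + 1 < n + 1 by omega), smul_mul_assoc]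
    congr 1
    refine LinearMap.ext fun f => ?_
    have := opT_mulX_succ t ⟨i, hi⟩ f
    simp only [Module.End.mul_apply, LinearMap.add_apply, LinearMap.smul_apply,
      Module.End.one_apply]
    exact (eq_sub_iff_add_eq.1 this)
  x_comm i hi := by
    rw [natExt_of_lt _ (show i < n by omega), natExt_of_lt _ (show n < n + 1 by omega)]
    exact LinearMap.ext fun f => opT_mulX_of_ne t (by simp [Fin.ext_iff]; omega)
      (by simp [Fin.ext_iff]; omega) f
  xx_comm m hm := by
    have hm' : m < n := by omega
    rw [natExt_of_lt _ (show m < n by omega), natExt_of_lt _ (show n < n + 1 by omega),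
      natExt_of_lt _ (show m < n + 1 by omega)]
    refine LinearMap.ext fun f => ?_
    have e : (⟨n, by omega⟩ : Fin (n + 1)) = (⟨m, hm'⟩ : Fin n).succ := Fin.ext hm
    rw [e]
    change opT t ⟨m, hm'⟩ (mulX K μ _ (mulX K μ (⟨m, hm'⟩ : Fin n).castSucc f)) =
      mulX K μ _ (mulX K μ (⟨m, hm'⟩ : Fin n).castSucc (opT t ⟨m, hm'⟩ f))
    rw [opT_mulX_succ, opT_mulX_castSucc, map_add, map_smul, mulX_comm, mulX_comm _ _ f]
    abel
  w_x_zero := by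
    rw [natExt_of_lt _ (show 0 < n + 1 by omega), natExt_of_lt _ (show n < n + 1 by omega)]
    exact LinearMap.ext fun f => opW_mulX_zero q t f
  w_x_succ i hi := by
    rw [natExt_of_lt _ (show i < n + 1 by omega), natExt_of_lt _ (show i + 1 < n + 1 by omega)]
    exact LinearMap.ext fun f => opW_mulX_succ q t ⟨i, hi⟩ f

end OperatorRelations

end VVMac

namespace VVMac

/-! ### Joint eigenvectors of the Cherednik operators -/

section Eigen

variable {K : Type*} [Field K] {n : ℕ} {μ : YoungDiagram} {q t : K}

/-- The spectral value with given exponents. -/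
def zval (q t : K) (x : ℕ × ℤ) : K := q ^ x.1 * t ^ x.2

theorem Generic.zval_ne_zero (G : Generic μ q t) (x : ℕ × ℤ) : zval q t x ≠ 0 :=
  mul_ne_zero (pow_ne_zero _ G.hq) (zpow_ne_zero _ G.ht)

theorem Generic.zval_ratio (G : Generic μ q t) (x y : ℕ × ℤ) :
    zval q t y / zval q t x = q ^ ((y.1 : ℤ) - x.1) * t ^ (y.2 - x.2) := by
  rw [zval, zval, zpow_sub₀ G.hq, zpow_sub₀ G.ht, zpow_natCast, zpow_natCast]
  rw [mul_div_mul_comm]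

/-- The form in which genericity is applied: e = 0 separates spectra and avoids the pole of u, e = 1
and e = -1 avoid its zeros. -/
theorem Generic.zval_ratio_ne (G : Generic μ q t) {x y : ℕ × ℤ} {e : ℤ}
    (h : y.1 ≠ x.1 ∨ y.2 - x.2 ≠ e)
    (hb : |y.2 - x.2 - e| ≤ (μ.rowLen 0 : ℤ) + (μ.colLen 0 : ℤ) - 1) :
    zval q t y / zval q t x ≠ t ^ e := by
  rw [G.zval_ratio]
  intro h'
  refine G.hqt ((y.1 : ℤ) - x.1) (y.2 - x.2 - e) ?_ hb ?_
  · intro h0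
    rw [Prod.mk.injEq] at h0
    omega
  · rw [zpow_sub₀ G.ht, ← mul_div_assoc, h', div_self (zpow_ne_zero _ G.ht)]

theorem Generic.u_ne_zero (G : Generic μ q t) (S S' : RSYT n μ) {k : ℕ} (hk : k ≠ 0)
    (i j : Fin (n + 1)) : u t (q ^ k * t ^ (S.content i - S'.content j)) ≠ 0 := by
  have hb := RSYT.content_sub_content_lt S S' i j
  have key : ∀ e : ℤ, |e| ≤ 1 → q ^ k * t ^ (S.content i - S'.content j) ≠ t ^ e := by
    intro e he h'
    refine G.hqt k (S.content i - S'.content j - e) (by simp [hk]) ?_ ?_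
    · rw [abs_le] at *
      have := abs_le.1 ((le_sub_iff_add_le.2 hb))
      omega
    · rw [zpow_sub₀ G.ht, ← mul_div_assoc, zpow_natCast, h', div_self (zpow_ne_zero _ G.ht)]
  have k1 := key 1 (by norm_num)
  have k2 := key (-1) (by norm_num)
  have k3 := key 0 (by norm_num)
  rw [zpow_one] at k1
  rw [zpow_neg_one] at k2
  rw [zpow_zero] at k3
  refine div_ne_zero (mul_ne_zero (sub_ne_zero.2 k1.symm) (sub_ne_zero.2 ?_))
    (pow_ne_zero _ (sub_ne_zero.2 k3.symm))
  intro h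
  exact k2 (eq_inv_of_mul_eq_one_right h.symm)

theorem Generic.zval_ratio_ne_one (G : Generic μ q t) (α : Fin (n + 1) → ℕ) (S : RSYT n μ)
    (i : Fin n) : zval q t (zvec α S i.succ) / zval q t (zvec α S i.castSucc) ≠ 1 := by
  have hb := abs_zvec_sub α α S S i.succ i.castSucc
  rw [← zpow_zero t]
  refine G.zval_ratio_ne ?_ (by rw [sub_zero]; omega)
  by_cases h : α i.castSucc = α i.succ
  · right
    obtain ⟨j, hj⟩ := exists_rank_eq h
    simp only [zvec, hj, rank_succ_eq h hj]
    have := S.content_sub_ne_zero j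
    omega
  · left
    exact Ne.symm h

/-- Along an arrow either the degrees differ or the contents differ by at least 2, so the ratio is
none of 1, t, t⁻¹. Hence every arrow can be reversed. -/
theorem Generic.u_ratio_ne_zero (G : Generic μ q t) {α : Fin (n + 1) → ℕ} {S : RSYT n μ}
    {i : Fin n} (h : Prec (zvec α S i.castSucc) (zvec α S i.succ)) :
    u t (zval q t (zvec α S i.succ) / zval q t (zvec α S i.castSucc)) ≠ 0 := by
  have hb := abs_zvec_sub α α S S i.succ i.castSucc
  have h1 := G.zval_ratio_ne_one α S i
  have h2 : zval q t (zvec α S i.succ) / zval q t (zvec α S i.castSucc) ≠ t ^ (1 : ℤ) := by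
    refine G.zval_ratio_ne ?_ ?_
    · rcases h with h | h <;> omega
    · rw [abs_le]
      have := abs_le.1 (le_sub_iff_add_le.2 hb)
      omega
  have h3 : zval q t (zvec α S i.succ) / zval q t (zvec α S i.castSucc) ≠ t ^ (-1 : ℤ) := by
    refine G.zval_ratio_ne ?_ ?_
    · rcases h with h | h <;> omega
    · rw [abs_le]
      have := abs_le.1 (le_sub_iff_add_le.2 hb)
      omega
  rw [zpow_one] at h2
  rw [zpow_neg_one] at h3
  refine div_ne_zero (mul_ne_zero (sub_ne_zero.2 h2.symm) (sub_ne_zero.2 ?_))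
    (pow_ne_zero _ (sub_ne_zero.2 h1.symm))
  intro h
  exact h3 (eq_inv_of_mul_eq_one_right h.symm)

theorem stepPoly_eq (q t : K) (α : Fin (n + 1) → ℕ) (S : RSYT n μ) (i : Fin n) (f : PV K n μ) :
    stepPoly q t α S i f =
      inter t (opT t i) (zval q t (zvec α S i.succ) / zval q t (zvec α S i.castSucc)) f := rfl

/-- Joint eigenvectors of the Cherednik operators. -/
def IsEigen (q t : K) (z : Fin (n + 1) → ℕ × ℤ) (f : PV K n μ) : Prop :=
  ∀ i, opXi q t i f = zval q t (z i) • f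

theorem chainP_one_tmul (t : K) (k : ℕ) (v : V K n μ) :
    (chainP (natExt (opT t : Fin n → Module.End K (PV K n μ))) k) (1 ⊗ₜ v) =
      1 ⊗ₜ (chainP (natExt (tauT t : Fin n → Module.End K (V K n μ))) k) v := by
  induction k with
  | zero => rfl
  | succ k ih =>
    rw [chainP, chainP, Module.End.mul_apply, Module.End.mul_apply, ih]
    by_cases h : k < n
    · rw [natExt_of_lt _ h, natExt_of_lt _ h, opT_one_tmul]
    · rw [natExt, natExt, dif_neg h, dif_neg h]
      rfl

theorem opXi_step (G : Generic μ q t) (i : Fin n) (f : PV K n μ) :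
    opT t i (opXi q t i.succ (opT t i f)) = t • opXi q t i.castSucc f := by
  have h := LinearMap.congr_fun ((affineHeckeRel (n := n) G).mul_xi_mul i.isLt) f
  rw [natExt_val, natExt_of_lt _ (show (i : ℕ) + 1 < n + 1 by omega),
    natExt_of_lt _ (show (i : ℕ) < n + 1 by omega)] at h
  exact h

theorem opXi_last_chainP (G : Generic μ q t) (f : PV K n μ) :
    opXi q t (Fin.last n) ((chainP (natExt (opT t : Fin n → Module.End K (PV K n μ))) n) f) =
      opW q t f := by
  have h1 := (affineHeckeRel (n := n) G).xi_last
  rw [natExt_of_lt _ (Nat.lt_succ_self n)] at h1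
  have h2 := LinearMap.congr_fun ((affineHeckeRel (n := n) G).chainR_mul_chainP G.ht le_rfl) f
  change (opXi q t (⟨n, Nat.lt_succ_self n⟩ : Fin (n + 1)) : Module.End K (PV K n μ)) _ = _
  rw [h1, Module.End.mul_apply, ← Module.End.mul_apply (chainR _ _ _), h2]
  rfl

theorem opXi_last_one_tmul (G : Generic μ q t) (v : V K n μ) :
    opXi q t (Fin.last n) (1 ⊗ₜ v : PV K n μ) = 1 ⊗ₜ v := by
  have h := LinearMap.congr_fun ((heckeRel_tau (n := n) G).chainP_mul_chainR G.ht le_rfl) v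
  rw [Module.End.mul_apply, ← tauOmega_eq] at h
  -- The preimage of `v` under τ(ω): on constants w acts as τ(ω), and ξ_N first undoes it.
  set v' := (chainR t (natExt (tauT t : Fin n → Module.End K (V K n μ))) n) v
  have h2 := opXi_last_chainP G (1 ⊗ₜ v' : PV K n μ)
  rw [chainP_one_tmul, ← tauOmega_eq, opW_one_tmul, h] at h2
  exact h2

theorem inter_opT_const (G : Generic μ q t) (i : Fin n) (S : RSYT n μ) {b : ℤ}
    (hb : b = S.content i.castSucc - S.content i.succ) :
    inter t (opT t i) (t ^ (-b)) (const S : PV K n μ) = exchCoef t b • const (S.exch i) := by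
  have h := inter_tauT G i S hb
  rw [inter] at h
  rw [inter, const, opT_one_tmul, ← TensorProduct.tmul_smul, ← TensorProduct.tmul_add, h,
    TensorProduct.tmul_smul]
  rfl

/-- Descending from ξ_N, which fixes constants. The intertwiner produces a multiple of the exchanged
tableau, on which ξ_{i+1} is known by induction; this determines ξ_{i+1} T_i on S, and T_i ξ_{i+1}
T_i = t ξ_i yields ξ_i. -/
theorem opXi_const (G : Generic μ q t) (i : Fin (n + 1)) (S : RSYT n μ) :
    opXi q t i (const S : PV K n μ) = t ^ S.content i • const S := by
  induction i using Fin.reverseInduction generalizing S with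
  | last => rw [RSYT.content_last, zpow_zero, one_smul, const, opXi_last_one_tmul G]
  | cast i ih =>
    have ht := G.ht
    have h0 := S.content_sub_ne_zero i
    have hle := RSYT.content_sub_content_lt S S i.castSucc i.succ
    obtain ⟨b, hb⟩ : ∃ b, b = S.content i.castSucc - S.content i.succ := ⟨_, rfl⟩
    rw [← hb] at h0 hle
    have hne : t ^ (-b) ≠ 1 := G.zpow_ne_one (by omega) (by rw [abs_neg]; omega)
    have e1 : t ^ (-b) - 1 ≠ 0 := sub_ne_zero.2 hne
    -- Either the exchange is genuine and moves the content of `i` to `i + 1`, or the coefficient is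
    -- zero.
    have hex : opXi q t i.succ (exchCoef t b • (const (S.exch i) : PV K n μ)) =
        t ^ S.content i.castSucc • exchCoef t b • const (S.exch i) := by
      by_cases h2 : 2 ≤ |b|
      · rw [map_smul, ih, RSYT.content_exch S i (hb ▸ h2), Equiv.swap_apply_right, smul_comm]
      · rw [exchCoef_of_abs ht h0 h2, zero_smul, map_zero, smul_zero]
    rw [← inter_opT_const G i S hb, inter, map_add, map_smul, ih] at hex
    have hB : bpar t (t ^ (-b)) * (t ^ S.content i.castSucc - t ^ S.content i.succ) =
        -(t - 1) * t ^ S.content i.castSucc := by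
      have : t ^ S.content i.succ = t ^ S.content i.castSucc * t ^ (-b) := by
        rw [← zpow_add₀ ht]
        congr 1
        omega
      rw [this, bpar]
      field_simp
      ring
    have h3 : opXi q t i.succ (opT t i (const S)) = t ^ S.content i.castSucc •
        (opT t i (const S) - (t - 1) • const S) := by
      rw [← sub_eq_zero] at hex ⊢
      rw [← hex]
      have : (bpar t (t ^ (-b)) * (t ^ S.content i.castSucc - t ^ S.content i.succ)) •
        (const S : PV K n μ) = (-(t - 1) * t ^ S.content i.castSucc) • const S := by rw [hB]
      rw [← sub_eq_zero] at this
      rw [← sub_eq_zero, ← this]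
      module
    have h4 := opXi_step G i (const S)
    rw [h3, map_smul, map_sub, map_smul, opT_quad G, add_sub_cancel_left, smul_comm] at h4
    exact (smul_right_injective _ ht h4).symm

theorem IsEigen.inter (G : Generic μ q t) {z : Fin (n + 1) → ℕ × ℤ} {f : PV K n μ}
    (hf : IsEigen q t z f) (i : Fin n)
    (hz : zval q t (z i.succ) / zval q t (z i.castSucc) ≠ 1) :
    IsEigen q t (z ∘ Equiv.swap i.castSucc i.succ)
      (inter t (opT t i) (zval q t (z i.succ) / zval q t (z i.castSucc)) f) := by
  have H := affineHeckeRel (n := n) G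
  have hlt : (i : ℕ) < n := i.isLt
  have h := H.inter_eigen i.isLt (f := f) (a := zval q t (z i.castSucc))
    (b := zval q t (z i.succ)) (G.zval_ne_zero _) hz
    (by rw [natExt_of_lt _ (show (i : ℕ) < n + 1 by omega)]; exact hf i.castSucc)
    (by rw [natExt_of_lt _ (show (i : ℕ) + 1 < n + 1 by omega)]; exact hf i.succ)
  rw [natExt_val, natExt_of_lt _ (show (i : ℕ) < n + 1 by omega),
    natExt_of_lt _ (show (i : ℕ) + 1 < n + 1 by omega)] at h
  intro j
  by_cases h1 : j = i.castSucc
  · rw [h1, Function.comp_apply, Equiv.swap_apply_left]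
    exact h.1
  by_cases h2 : j = i.succ
  · rw [h2, Function.comp_apply, Equiv.swap_apply_right]
    exact h.2
  · have hc := LinearMap.congr_fun (H.mul_xi (i := i) (j := j) hlt (by omega)
      (fun h => h1 (Fin.ext h)) (fun h => h2 (Fin.ext h))) f
    rw [natExt_val, natExt_val] at hc
    simp only [Module.End.mul_apply] at hc
    rw [Function.comp_apply, Equiv.swap_apply_of_ne_of_ne h1 h2, VVMac.inter, map_add, map_smul,
      ← hc, hf j, map_smul, smul_add, smul_comm]

/-- The rotation of spectral exponents along the affine arrows. -/
def rot (z : Fin (n + 1) → ℕ × ℤ) : Fin (n + 1) → ℕ × ℤ :=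
  Fin.snoc (α := fun _ => ℕ × ℤ) (fun i : Fin n => z i.succ) ((z 0).1 + 1, (z 0).2)

@[simp] theorem rot_castSucc (z : Fin (n + 1) → ℕ × ℤ) (k : Fin n) :
    rot z k.castSucc = z k.succ := by simp [rot]

@[simp] theorem rot_last (z : Fin (n + 1) → ℕ × ℤ) :
    rot z (Fin.last n) = ((z 0).1 + 1, (z 0).2) := by simp [rot]

theorem zvec_affine (α : Fin (n + 1) → ℕ) (S : RSYT n μ) :
    zvec (affine α) S = rot (zvec α S) := by
  funext k
  refine Fin.lastCases ?_ (fun k => ?_) k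
  · rw [zvec_affine_last, rot_last]
  · rw [zvec_affine_castSucc, rot_castSucc]

theorem IsEigen.affine (G : Generic μ q t) {z : Fin (n + 1) → ℕ × ℤ} {f : PV K n μ}
    (hf : IsEigen q t z f) : IsEigen q t (rot z) (mulXN K n μ (opW q t f)) := by
  have H := affineHeckeRel (n := n) G
  have e0 : natExt (mulX K μ) n = (mulXN K n μ : Module.End K (PV K n μ)) :=
    natExt_of_lt _ (Nat.lt_succ_self n)
  intro j
  refine Fin.lastCases ?_ (fun k => ?_) j
  · have h := LinearMap.congr_fun H.xi_last_mul_xw f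
    rw [e0, natExt_of_lt _ (Nat.lt_succ_self n), natExt_of_lt _ (Nat.succ_pos n)] at h
    simp only [Module.End.mul_apply, LinearMap.smul_apply] at h
    refine h.trans ?_
    rw [show (⟨0, Nat.succ_pos n⟩ : Fin (n + 1)) = 0 from rfl, hf 0, map_smul, map_smul, smul_smul,
      rot_last, zval, zval, pow_succ']
    simp only [mul_assoc]
  · have hlt : (k : ℕ) < n := k.isLt
    have h := LinearMap.congr_fun (H.xi_mul_xw k.isLt) f
    rw [e0, natExt_of_lt _ (show (k : ℕ) < n + 1 by omega),
      natExt_of_lt _ (show (k : ℕ) + 1 < n + 1 by omega)] at h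
    simp only [Module.End.mul_apply] at h
    refine h.trans ?_
    rw [show (⟨(k : ℕ) + 1, _⟩ : Fin (n + 1)) = k.succ from rfl, hf k.succ, map_smul, map_smul,
      rot_castSucc]

/-- A product of generators after w is t^n ξ_1, which multiplies f by a nonzero scalar. -/
theorem opW_ne_zero (G : Generic μ q t) {z : Fin (n + 1) → ℕ × ℤ} {f : PV K n μ}
    (hf : IsEigen q t z f) (h0 : f ≠ 0) : opW q t f ≠ 0 := by
  intro h
  have H := affineHeckeRel (n := n) G
  have h1 := LinearMap.congr_fun H.chainQ_mul_w f
  rw [Module.End.mul_apply, h, map_zero, natExt_of_lt _ (Nat.succ_pos n), LinearMap.smul_apply]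
    at h1
  have h2 := hf 0
  rw [eq_comm, smul_eq_zero] at h1
  rcases h1 with h1 | h1
  · exact pow_ne_zero n G.ht h1
  · rw [show (0 : Fin (n + 1)) = ⟨0, Nat.succ_pos n⟩ from rfl, h1, eq_comm, smul_eq_zero] at h2
    exact h2.elim (G.zval_ne_zero _) h0

theorem divXN_mulXN (f : PV K n μ) : divXN K n μ (mulXN K n μ f) = f := by
  induction f using TensorProduct.induction_on with
  | zero => simp
  | tmul p v =>
    rw [mulXN, divXN, TensorProduct.map_tmul, TensorProduct.map_tmul]
    congr 1
    exact MvPolynomial.X_mul_divMonomial _ _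
  | add f g hf hg => rw [map_add, map_add, hf, hg]

theorem mulXN_injective : Function.Injective (mulXN K n μ) :=
  Function.LeftInverse.injective divXN_mulXN

theorem const_ne_zero (S : RSYT n μ) : (const S : PV K n μ) ≠ 0 := by
  intro h
  have := congrArg ((TensorProduct.lid K K).toLinearMap ∘ₗ
    TensorProduct.map (MvPolynomial.lcoeff K 0) (Finsupp.lapply S)) h
  simp [const] at this

end Eigen

/-! ### Existence, eigenvalues and nonvanishing of the nodes -/

section Nodes

variable {K : Type*} [Field K] {n : ℕ} {μ : YoungDiagram} {q t : K}

/-- The nodes of the Yang–Baxter graph in terms of spectral exponents. -/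
def ZNode (q t : K) (z : Fin (n + 1) → ℕ × ℤ) (f : PV K n μ) : Prop :=
  ∃ α S, zvec α S = z ∧ YBNode q t α S f

variable (μ) in
/-- The spectral exponents of labels. -/
def IsLabel (z : Fin (n + 1) → ℕ × ℤ) : Prop := ∃ α, ∃ S : RSYT n μ, zvec α S = z

theorem IsLabel.swap {z : Fin (n + 1) → ℕ × ℤ} (hz : IsLabel μ z) {i : Fin n}
    (h : Prec (z i.castSucc) (z i.succ) ∨ Prec (z i.succ) (z i.castSucc)) :
    IsLabel μ (z ∘ Equiv.swap i.castSucc i.succ) := by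
  obtain ⟨α, S, rfl⟩ := hz
  exact exists_zvec_swap h

/-- The two finite arrows are treated as one from here on: only the exponent vectors decide which of
them is meant, and `zvec_injective` identifies its end. -/
theorem YBNode.of_swap {α β : Fin (n + 1) → ℕ} {S S' : RSYT n μ} {f : PV K n μ} {i : Fin n}
    (hf : YBNode q t α S f) (h : Prec (zvec α S i.castSucc) (zvec α S i.succ))
    (hz : zvec β S' = zvec α S ∘ Equiv.swap i.castSucc i.succ) :
    YBNode q t β S' (stepPoly q t α S i f) := by
  rcases h with h | ⟨h1, h2⟩
  · rw [← zvec_swapAt (i := i) (by simpa [zvec] using h.ne)] at hz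
    obtain ⟨rfl, rfl⟩ := zvec_injective hz
    exact YBNode.step α S' f i h hf
  · have h1' : α i.castSucc = α i.succ := h1
    obtain ⟨j, hj⟩ := exists_rank_eq h1'
    simp only [zvec, hj, rank_succ_eq h1' hj] at h2
    rw [← zvec_exch h1' hj S (h2.trans (le_abs_self _))] at hz
    obtain ⟨rfl, rfl⟩ := zvec_injective hz
    exact YBNode.exch β S f i j h1' hj h2 hf

theorem ZNode.isLabel {z : Fin (n + 1) → ℕ × ℤ} {f : PV K n μ} (h : ZNode q t z f) :
    IsLabel μ z := by
  obtain ⟨α, S, hz, -⟩ := h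
  exact ⟨α, S, hz⟩

theorem ZNode.swap {z : Fin (n + 1) → ℕ × ℤ} {f : PV K n μ} (hf : ZNode q t z f) {i : Fin n}
    (h : Prec (z i.castSucc) (z i.succ)) :
    ZNode q t (z ∘ Equiv.swap i.castSucc i.succ)
      (inter t (opT t i) (zval q t (z i.succ) / zval q t (z i.castSucc)) f) := by
  obtain ⟨α, S, rfl, hf⟩ := hf
  obtain ⟨β, S', hz⟩ := exists_zvec_swap (Or.inl h)
  exact ⟨β, S', hz, hf.of_swap h hz⟩

theorem ZNode.affine {z : Fin (n + 1) → ℕ × ℤ} {f : PV K n μ} (hf : ZNode q t z f) :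
    ZNode q t (rot z) (mulXN K n μ (opW q t f)) := by
  obtain ⟨α, S, rfl, hf⟩ := hf
  exact ⟨_, S, zvec_affine α S, YBNode.affine α S f hf⟩

theorem YBNode.cases_zvec {α : Fin (n + 1) → ℕ} {S : RSYT n μ} {f : PV K n μ}
    (h : YBNode q t α S f) :
    (α = (fun _ => 0) ∧ f = const S) ∨
    (∃ (i : Fin n) (β : _) (S' : RSYT n μ) (g : PV K n μ), YBNode q t β S' g ∧
      Prec (zvec β S' i.castSucc) (zvec β S' i.succ) ∧
      zvec α S = zvec β S' ∘ Equiv.swap i.castSucc i.succ ∧ f = stepPoly q t β S' i g) ∨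
    ∃ (β : _) (g : PV K n μ), YBNode q t β S g ∧ α = VVMac.affine β ∧
      f = mulXN K n μ (opW q t g) := by
  cases h with
  | root => exact Or.inl ⟨rfl, rfl⟩
  | step α S f i hi hf =>
    exact Or.inr (Or.inl ⟨i, α, S, f, hf, Or.inl hi, zvec_swapAt hi.ne S, rfl⟩)
  | exch α S f i j hi hj hc hf =>
    refine Or.inr (Or.inl ⟨i, α, S, f, hf, Or.inr ⟨hi, ?_⟩,
      zvec_exch hi hj S (hc.trans (le_abs_self _)), rfl⟩)
    simpa only [zvec, hj, rank_succ_eq hi hj] using hc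
  | affine α S f hf => exact Or.inr (Or.inr ⟨α, f, hf, rfl, rfl⟩)

/-- Walk backwards: undo an affine arrow if the last part is positive, otherwise undo a swap at a
descent. If neither is possible the composition is weakly increasing and ends in 0, hence zero.
Tableau exchanges are not needed since every tableau is a root. -/
theorem exists_node (q t : K) (α : Fin (n + 1) → ℕ) (S : RSYT n μ) :
    ∃ f : PV K n μ, YBNode q t α S f := by
  induction α, S using label_induction with
  | h α S h1 h2 =>
    by_cases h0 : 0 < α (Fin.last n)
    · obtain ⟨β, rfl⟩ := exists_affine_eq h0
      obtain ⟨f, hf⟩ := h2 β rfl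
      exact ⟨_, YBNode.affine β S f hf⟩
    · by_cases hm : ∃ i : Fin n, α i.succ < α i.castSucc
      · obtain ⟨i, hi⟩ := hm
        have hi' : (swapAt α i) i.castSucc < (swapAt α i) i.succ := by
          simpa [swapAt] using hi
        have hz := zvec_swapAt hi'.ne S
        rw [swapAt_swapAt] at hz
        obtain ⟨f, hf⟩ := h1 (swapAt α i) S i (Or.inl hi') hz
        have := YBNode.step _ S f i hi' hf
        rw [swapAt_swapAt] at this
        exact ⟨_, this⟩
      · push Not at hm
        have hmono : Monotone α := Fin.monotone_iff_le_succ.2 hm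
        have : α = fun _ => 0 := by
          funext i
          have := hmono (Fin.le_last i)
          omega
        rw [this]
        exact ⟨_, YBNode.root S⟩

theorem IsLabel.exists_node {z : Fin (n + 1) → ℕ × ℤ} (hz : IsLabel μ z) (q t : K) :
    ∃ f : PV K n μ, ZNode q t z f := by
  obtain ⟨α, S, rfl⟩ := hz
  obtain ⟨f, hf⟩ := VVMac.exists_node q t α S
  exact ⟨f, α, S, rfl, hf⟩

theorem YBNode.isEigen (G : Generic μ q t) {α : Fin (n + 1) → ℕ} {S : RSYT n μ} {f : PV K n μ}
    (h : YBNode q t α S f) : IsEigen q t (zvec α S) f := by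
  have key : ∀ {α β : Fin (n + 1) → ℕ} {S S' : RSYT n μ} {i : Fin n} {f : PV K n μ},
      zvec α S = zvec β S' ∘ Equiv.swap i.castSucc i.succ → IsEigen q t (zvec β S') f →
      IsEigen q t (zvec α S) (stepPoly q t β S' i f) := by
    intro α β S S' i f hz ih
    rw [hz]
    exact ih.inter G i (G.zval_ratio_ne_one _ _ _)
  induction h with
  | root S =>
    intro i
    rw [opXi_const G, zval, zvec, rank_of_antitone (fun _ _ _ => le_rfl), pow_zero, one_mul]
  | step α S f i hi hf ih => exact key (zvec_swapAt hi.ne S) ih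
  | exch α S f i j hi hj hc hf ih =>
    exact key (zvec_exch hi hj S (hc.trans (le_abs_self _))) ih
  | affine α S f hf ih =>
    rw [zvec_affine]
    exact ih.affine G

/-- The opposite intertwiner brings the new polynomial back to u times the old one, and u ≠ 0 along
an arrow. -/
theorem YBNode.ne_zero (G : Generic μ q t) {α : Fin (n + 1) → ℕ} {S : RSYT n μ} {f : PV K n μ}
    (h : YBNode q t α S f) : f ≠ 0 := by
  have key : ∀ {α : Fin (n + 1) → ℕ} {S : RSYT n μ} {i : Fin n} {f : PV K n μ},
      Prec (zvec α S i.castSucc) (zvec α S i.succ) → f ≠ 0 → stepPoly q t α S i f ≠ 0 := by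
    intro α S i f h hf h0
    have := inter_inter_inv (T := opT t i) (f := f) (div_ne_zero (G.zval_ne_zero _)
      (G.zval_ne_zero _)) (G.zval_ratio_ne_one α S i) (opT_quad G i f)
    rw [← stepPoly_eq, h0, inter, map_zero, smul_zero, add_zero, eq_comm, smul_eq_zero] at this
    exact this.elim (G.u_ratio_ne_zero h) hf
  induction h with
  | root S => exact const_ne_zero S
  | step α S f i hi hf ih => exact key (Or.inl hi) ih
  | exch α S f i j hi hj hc hf ih =>
    exact key (Or.inr ⟨hi, by simpa only [zvec, hj, rank_succ_eq hi hj] using hc⟩) ih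
  | affine α S f hf ih =>
    intro h
    rw [← map_zero (mulXN K n μ)] at h
    exact opW_ne_zero G (hf.isEigen G) ih (mulXN_injective h)

end Nodes

end VVMac

namespace VVMac

/-! ### Independence of the path -/

section Uniqueness

variable {K : Type*} [Field K] {n : ℕ} {μ : YoungDiagram} {q t : K}

theorem opT_mulXN_opW (G : Generic μ q t) {i j : Fin n} (hij : i.succ = j.castSucc)
    (f : PV K n μ) :
    opT t i (mulXN K n μ (opW q t f)) = mulXN K n μ (opW q t (opT t j f)) := by
  have hv := congrArg Fin.val hij
  simp only [Fin.val_succ, Fin.val_castSucc] at hv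
  have hj := j.isLt
  rw [← mulX_last, opT_mulX_of_ne t (by simp [Fin.ext_iff]; omega) (by simp [Fin.ext_iff]; omega),
    opT_opW G hij]

theorem opT_mulXN_opW_sq (G : Generic μ q t) {i j : Fin n} (hi : (i : ℕ) + 1 = n)
    (hj : (j : ℕ) = 0) (f : PV K n μ) :
    opT t i (mulXN K n μ (opW q t (mulXN K n μ (opW q t f)))) =
      mulXN K n μ (opW q t (mulXN K n μ (opW q t (opT t j f)))) := by
  have h := LinearMap.congr_fun ((affineHeckeRel (n := n) G).mul_xw_sq (m := i) hi.symm) f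
  rw [natExt_of_lt _ (Nat.lt_succ_self n), natExt_val, ← hj, natExt_val] at h
  exact h

/-- Both predecessors have a common predecessor `w`, in which both exchanges are undone. Starting
from a node at `w`, the two paths differ by the order of two commuting intertwiners. -/
theorem swap_swap_far {i k : Fin n} (hik : (i : ℕ) + 1 < k) {z z₁ z₂ : Fin (n + 1) → ℕ × ℤ}
    (G : Generic μ q t) {f₁ f₂ : PV K n μ} (hf₁ : ZNode q t z₁ f₁)
    (h₁ : Prec (z₁ i.castSucc) (z₁ i.succ)) (h₂ : Prec (z₂ k.castSucc) (z₂ k.succ))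
    (e₁ : z = z₁ ∘ Equiv.swap i.castSucc i.succ) (e₂ : z = z₂ ∘ Equiv.swap k.castSucc k.succ)
    (u₁ : ∀ g, ZNode q t z₁ g → g = f₁) (u₂ : ∀ g, ZNode q t z₂ g → g = f₂) :
    inter t (opT t i) (zval q t (z₁ i.succ) / zval q t (z₁ i.castSucc)) f₁ =
      inter t (opT t k) (zval q t (z₂ k.succ) / zval q t (z₂ k.castSucc)) f₂ := by
  have n1 : i.castSucc ≠ k.castSucc := by simp [Fin.ext_iff]; omega
  have n2 : i.castSucc ≠ k.succ := by simp [Fin.ext_iff]; omega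
  have n3 : i.succ ≠ k.castSucc := by simp [Fin.ext_iff]; omega
  have n4 : i.succ ≠ k.succ := by simp [Fin.ext_iff]; omega
  have ez₁ : z₁ = z ∘ Equiv.swap i.castSucc i.succ := by
    rw [e₁]; funext j; simp
  have ez₂ : z₂ = z ∘ Equiv.swap k.castSucc k.succ := by
    rw [e₂]; funext j; simp
  have a1 : z₁ i.castSucc = z i.succ := by simp [ez₁]
  have a2 : z₁ i.succ = z i.castSucc := by simp [ez₁]
  have a3 : z₁ k.castSucc = z k.castSucc := by
    simp [ez₁, Equiv.swap_apply_of_ne_of_ne n1.symm n3.symm]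
  have a4 : z₁ k.succ = z k.succ := by
    simp [ez₁, Equiv.swap_apply_of_ne_of_ne n2.symm n4.symm]
  have b1 : z₂ k.castSucc = z k.succ := by simp [ez₂]
  have b2 : z₂ k.succ = z k.castSucc := by simp [ez₂]
  have b3 : z₂ i.castSucc = z i.castSucc := by
    simp [ez₂, Equiv.swap_apply_of_ne_of_ne n1 n2]
  have b4 : z₂ i.succ = z i.succ := by
    simp [ez₂, Equiv.swap_apply_of_ne_of_ne n3 n4]
  rw [b1, b2] at h₂
  rw [a1, a2] at h₁
  have hw : IsLabel μ (z₁ ∘ Equiv.swap k.castSucc k.succ) :=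
    hf₁.isLabel.swap (Or.inr (by rwa [a3, a4]))
  set w := z₁ ∘ Equiv.swap k.castSucc k.succ with hwdef
  obtain ⟨h, hh⟩ := hw.exists_node q t
  have c1 : w k.castSucc = z k.succ := by simp [hwdef, a4]
  have c2 : w k.succ = z k.castSucc := by simp [hwdef, a3]
  have c3 : w i.castSucc = z i.succ := by
    simp [hwdef, Equiv.swap_apply_of_ne_of_ne n1 n2, a1]
  have c4 : w i.succ = z i.castSucc := by
    simp [hwdef, Equiv.swap_apply_of_ne_of_ne n3 n4, a2]
  have hd : (Equiv.swap i.castSucc i.succ).Disjoint (Equiv.swap k.castSucc k.succ) := by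
    refine Equiv.Perm.disjoint_swap_swap ?_
    simp [n1, n2, n3, n4]
    simp [Fin.ext_iff]
  have d1 : w ∘ Equiv.swap k.castSucc k.succ = z₁ := by
    rw [hwdef]; funext j; simp
  have d2 : w ∘ Equiv.swap i.castSucc i.succ = z₂ := by
    rw [hwdef, ez₁, ez₂]
    funext j
    have := Equiv.congr_fun hd.commute.eq (Equiv.swap i.castSucc i.succ j)
    simp only [Equiv.Perm.mul_apply, Equiv.swap_apply_self] at this
    simp only [Function.comp_apply]
    rw [this]
  have g1 := hh.swap (i := k) (by rwa [c1, c2])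
  have g2 := hh.swap (i := i) (by rwa [c3, c4])
  rw [d1] at g1
  rw [d2] at g2
  rw [← u₁ _ g1, ← u₂ _ g2, a1, a2, b1, b2, c1, c2, c3, c4]
  simp only [inter, map_add, map_smul, opT_comm G hik]
  module

/-- The three pairs involved decrease along the positions of `z`, so the vector `w` with these three
pairs reversed is still a label, and two chains of three arrows lead from it to `z`. Their agreement
is the Yang–Baxter equation. -/
theorem swap_swap_near {i k : Fin n} (hik : i.succ = k.castSucc)
    {z z₁ z₂ : Fin (n + 1) → ℕ × ℤ}
    (G : Generic μ q t) {f₁ f₂ : PV K n μ} (hf₁ : ZNode q t z₁ f₁) (hf₂ : ZNode q t z₂ f₂)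
    (h₁ : Prec (z₁ i.castSucc) (z₁ i.succ)) (h₂ : Prec (z₂ k.castSucc) (z₂ k.succ))
    (e₁ : z = z₁ ∘ Equiv.swap i.castSucc i.succ) (e₂ : z = z₂ ∘ Equiv.swap k.castSucc k.succ)
    (u₁ : ∀ g, ZNode q t z₁ g → g = f₁) (u₂ : ∀ g, ZNode q t z₂ g → g = f₂) :
    inter t (opT t i) (zval q t (z₁ i.succ) / zval q t (z₁ i.castSucc)) f₁ =
      inter t (opT t k) (zval q t (z₂ k.succ) / zval q t (z₂ k.castSucc)) f₂ := by
  have hv := congrArg Fin.val hik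
  simp only [Fin.val_succ, Fin.val_castSucc] at hv
  obtain ⟨a, ha⟩ : ∃ a, a = i.castSucc := ⟨_, rfl⟩
  obtain ⟨b, hb⟩ : ∃ b, b = i.succ := ⟨_, rfl⟩
  obtain ⟨c, hc⟩ : ∃ c, c = k.succ := ⟨_, rfl⟩
  have hb' : b = k.castSucc := hb.trans hik
  have nab : a ≠ b := by rw [ha, hb]; simp [Fin.ext_iff]
  have nbc : b ≠ c := by rw [hb, hc]; simp [Fin.ext_iff]; omega
  have nac : a ≠ c := by rw [ha, hc]; simp [Fin.ext_iff]; omega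
  rw [← ha, ← hb] at h₁ e₁ ⊢
  rw [← hb', ← hc] at h₂ e₂ ⊢
  have sab := Equiv.swap_apply_of_ne_of_ne nac.symm nbc.symm
  have sbc := Equiv.swap_apply_of_ne_of_ne nab nac
  have ez₁ : z₁ = z ∘ Equiv.swap a b := by
    rw [e₁]; funext j; simp
  have ez₂ : z₂ = z ∘ Equiv.swap b c := by
    rw [e₂]; funext j; simp
  have a1 : z₁ a = z b := by simp [ez₁]
  have a2 : z₁ b = z a := by simp [ez₁]
  have a3 : z₁ c = z c := by simp [ez₁, sab]
  have b1 : z₂ a = z a := by simp [ez₂, sbc]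
  have b2 : z₂ b = z c := by simp [ez₂]
  have b3 : z₂ c = z b := by simp [ez₂]
  rw [b2, b3] at h₂
  rw [a1, a2] at h₁
  have sw : ∀ {y : Fin (n + 1) → ℕ × ℤ}, IsLabel μ y → Prec (y b) (y a) →
      IsLabel μ (y ∘ Equiv.swap a b) := by
    intro y hy h
    rw [ha, hb] at *
    exact hy.swap (Or.inr h)
  have sw' : ∀ {y : Fin (n + 1) → ℕ × ℤ}, IsLabel μ y → Prec (y c) (y b) →
      IsLabel μ (y ∘ Equiv.swap b c) := by
    intro y hy h
    rw [hb', hc] at *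
    exact hy.swap (Or.inr h)
  have up : ∀ {y : Fin (n + 1) → ℕ × ℤ} {f : PV K n μ}, ZNode q t y f → Prec (y a) (y b) →
      ZNode q t (y ∘ Equiv.swap a b)
        (inter t (opT t i) (zval q t (y b) / zval q t (y a)) f) := by
    intro y f hy h
    rw [ha, hb] at *
    exact hy.swap h
  have up' : ∀ {y : Fin (n + 1) → ℕ × ℤ} {f : PV K n μ}, ZNode q t y f → Prec (y b) (y c) →
      ZNode q t (y ∘ Equiv.swap b c)
        (inter t (opT t k) (zval q t (y c) / zval q t (y b)) f) := by
    intro y f hy h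
    rw [hb', hc] at *
    exact hy.swap h
  have l1 := sw' hf₁.isLabel (by rw [a2, a3]; exact h₂.trans h₁)
  have l2 := sw l1 (by simpa [sbc, a1, a3] using h₂)
  set y := z₁ ∘ Equiv.swap b c with hy
  have y1 : y a = z b := by simp [hy, sbc, a1]
  have y2 : y b = z c := by simp [hy, a3]
  have y3 : y c = z a := by simp [hy, a2]
  set w := y ∘ Equiv.swap a b with hw
  have w1 : w a = z c := by simp [hw, y2]
  have w2 : w b = z b := by simp [hw, y1]
  have w3 : w c = z a := by simp [hw, sab, y3]
  obtain ⟨h, hh⟩ := l2.exists_node q t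
  have p1 := up hh (by rwa [w1, w2])
  have p2 := up' p1 (by simpa [sab, w1, w3] using h₂.trans h₁)
  have p1' := up' hh (by rwa [w2, w3])
  have p2' := up p1' (by simpa [sbc, w1, w3] using h₂.trans h₁)
  have v1 : (w ∘ Equiv.swap a b) ∘ Equiv.swap b c = z₁ := by
    rw [hw, hy]; funext j; simp
  have v2 : (w ∘ Equiv.swap b c) ∘ Equiv.swap a b = z₂ := by
    have hs : Equiv.swap a b * Equiv.swap b c * Equiv.swap a b =
        Equiv.swap b c * Equiv.swap a b * Equiv.swap b c := by
      rw [Equiv.swap_mul_swap_mul_swap nab nac, Equiv.swap_comm a b, Equiv.swap_comm b c,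
        Equiv.swap_mul_swap_mul_swap nbc.symm nac.symm, Equiv.swap_comm]
    rw [hw, hy, ez₁, ez₂]
    funext j
    have := Equiv.congr_fun hs (Equiv.swap b c (Equiv.swap a b j))
    simp only [Equiv.Perm.mul_apply, Equiv.swap_apply_self] at this
    simp only [Function.comp_apply]
    rw [this]
  rw [v1] at p2
  rw [v2] at p2'
  rw [← u₁ _ p2, ← u₂ _ p2', a1, a2, b2, b3]
  simp only [Function.comp_apply, Equiv.swap_apply_left, Equiv.swap_apply_right, sab, sbc,
    w1, w2, w3]
  have r1 : zval q t (z b) / zval q t (z c) ≠ 1 := by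
    obtain ⟨α, S, hS⟩ := hf₂.isLabel
    have := G.zval_ratio_ne_one α S k
    rwa [hS, ← hb', ← hc, b2, b3] at this
  have r2 : zval q t (z a) / zval q t (z b) ≠ 1 := by
    obtain ⟨α, S, hS⟩ := hf₁.isLabel
    have := G.zval_ratio_ne_one α S i
    rwa [hS, ← hb, ← ha, a1, a2] at this
  have hmul : zval q t (z a) / zval q t (z c) =
      zval q t (z b) / zval q t (z c) * (zval q t (z a) / zval q t (z b)) := by
    have g1 := G.zval_ne_zero (z b)
    have g2 := G.zval_ne_zero (z c)
    field_simp
  -- Positions `a` and `c` are not adjacent, but in the intermediate label `y` the same two pairs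
  -- are neighbours.
  have r3 : zval q t (z a) / zval q t (z c) ≠ 1 := by
    obtain ⟨α, S, hS⟩ := l1
    have := G.zval_ratio_ne_one α S k
    rwa [hS, ← hb', ← hc, y2, y3] at this
  rw [hmul] at r3 ⊢
  exact (yang_baxter_iff r1 r2 r3 (opT_quad G i h) (opT_quad G k h)).2 (opT_braid G hik h)

/-- Below the last index, an exchange after the rotation is the exchange one place further on before
it. At the last index two rotations have to be undone, after which the exchange happens at the first
two positions. -/
theorem swap_affine {i : Fin n} {z₁ z₂ : Fin (n + 1) → ℕ × ℤ}
    (G : Generic μ q t) {f₁ f₂ : PV K n μ} (hf₁ : ZNode q t z₁ f₁) (hf₂ : ZNode q t z₂ f₂)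
    (h₁ : Prec (z₁ i.castSucc) (z₁ i.succ))
    (e₁ : rot z₂ = z₁ ∘ Equiv.swap i.castSucc i.succ)
    (u₁ : ∀ g, ZNode q t z₁ g → g = f₁) (u₂ : ∀ g, ZNode q t z₂ g → g = f₂) :
    inter t (opT t i) (zval q t (z₁ i.succ) / zval q t (z₁ i.castSucc)) f₁ =
      mulXN K n μ (opW q t f₂) := by
  have ez₁ : z₁ = rot z₂ ∘ Equiv.swap i.castSucc i.succ := by
    rw [e₁]; funext j; simp
  have a1 : z₁ i.castSucc = rot z₂ i.succ := by simp [ez₁]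
  have a2 : z₁ i.succ = rot z₂ i.castSucc := by simp [ez₁]
  by_cases hi : (i : ℕ) + 1 < n
  · obtain ⟨k, hk⟩ : ∃ k : Fin n, i.succ = k.castSucc := ⟨⟨i + 1, hi⟩, rfl⟩
    have hv := congrArg Fin.val hk
    simp only [Fin.val_succ, Fin.val_castSucc] at hv
    rw [hk, rot_castSucc] at a1
    rw [rot_castSucc, hk] at a2
    rw [a1, hk, a2] at h₁
    have hw := hf₂.isLabel.swap (Or.inr h₁)
    set w := z₂ ∘ Equiv.swap k.castSucc k.succ with hwdef
    have w1 : w k.castSucc = z₂ k.succ := by simp [hwdef]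
    have w2 : w k.succ = z₂ k.castSucc := by simp [hwdef]
    obtain ⟨h, hh⟩ := hw.exists_node q t
    have p1 := hh.affine
    have p2 := hh.swap (i := k) (by rwa [w1, w2])
    have v1 : rot w = z₁ := by
      rw [ez₁]
      funext j
      refine Fin.lastCases ?_ (fun j => ?_) j
      · have n1 : (0 : Fin (n + 1)) ≠ k.castSucc := by simp [Fin.ext_iff]; omega
        have n2 : (0 : Fin (n + 1)) ≠ k.succ := by simp [Fin.ext_iff]
        have n3 : Fin.last n ≠ i.castSucc := by simp [Fin.ext_iff]; omega
        have n4 : Fin.last n ≠ i.succ := by simp [Fin.ext_iff]; omega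
        rw [rot_last, Function.comp_apply, Equiv.swap_apply_of_ne_of_ne n3 n4, rot_last, hwdef,
          Function.comp_apply, Equiv.swap_apply_of_ne_of_ne n1 n2]
      · rw [rot_castSucc, hwdef, Function.comp_apply, Function.comp_apply]
        by_cases g1 : j = i
        · rw [g1, hk, Equiv.swap_apply_left, ← hk, Equiv.swap_apply_left, hk, rot_castSucc]
        by_cases g2 : j = k
        · rw [g2, Equiv.swap_apply_right, hk, Equiv.swap_apply_right, rot_castSucc, hk]
        · rw [Equiv.swap_apply_of_ne_of_ne, Equiv.swap_apply_of_ne_of_ne, rot_castSucc] <;>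
            simp only [ne_eq, Fin.ext_iff, Fin.val_succ, Fin.val_castSucc] at * <;> omega
    have v2 : w ∘ Equiv.swap k.castSucc k.succ = z₂ := by
      rw [hwdef]; funext j; simp
    rw [v1] at p1
    rw [v2] at p2
    rw [← u₁ _ p1, ← u₂ _ p2, a1, hk, a2, w1, w2, inter, inter, opT_mulXN_opW G hk, map_add,
      map_smul, map_add, map_smul]
  · have hin : (i : ℕ) + 1 = n := by omega
    have hl : i.succ = Fin.last n := Fin.ext (by simpa using hin)
    obtain ⟨m, rfl⟩ : ∃ m, n = m + 1 := ⟨i, hin.symm⟩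
    rw [hl, rot_last] at a1
    rw [rot_castSucc] at a2
    -- The penultimate pair of `z₁` has just been raised by the rotation, so its degree is positive,
    -- and the last pair of `z₁` is larger for `Prec`. Hence `z₂` is itself the end of an affine
    -- arrow.
    have hz₂ : 0 < (z₂ i.succ).1 := by
      rw [← a2]
      rw [a1] at h₁
      rcases h₁ with h | h
      · omega
      · have := h.1
        simp only at this
        omega
    obtain ⟨α, S, hS, hα⟩ := hf₂
    subst hS
    rw [hl] at hz₂
    obtain ⟨β, rfl⟩ := exists_affine_eq (α := α) hz₂
    rw [zvec_affine] at *
    set z₃ := zvec β S with hz₃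
    have k0 : ((0 : Fin (m + 1)).castSucc : Fin (m + 2)) = 0 := rfl
    have a1' : z₁ i.castSucc = ((z₃ (0 : Fin (m + 1)).succ).1 + 1,
        (z₃ (0 : Fin (m + 1)).succ).2) := by
      rw [a1, ← k0, rot_castSucc]
    have a2' : z₁ i.succ = ((z₃ 0).1 + 1, (z₃ 0).2) := by
      rw [a2, hl, rot_last]
    have h3 : Prec (z₃ (0 : Fin (m + 1)).succ) (z₃ (0 : Fin (m + 1)).castSucc) := by
      rw [a1', a2'] at h₁
      simp only [Prec] at h₁ ⊢
      rw [k0]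
      omega
    have hw := (show IsLabel μ z₃ from ⟨β, S, rfl⟩).swap (Or.inr h3)
    set w := z₃ ∘ Equiv.swap (0 : Fin (m + 1)).castSucc (0 : Fin (m + 1)).succ with hwdef
    have w1 : w (0 : Fin (m + 1)).castSucc = z₃ (0 : Fin (m + 1)).succ := by simp [hwdef]
    have w2 : w (0 : Fin (m + 1)).succ = z₃ (0 : Fin (m + 1)).castSucc := by simp [hwdef]
    obtain ⟨h, hh⟩ := hw.exists_node q t
    have p1 := hh.affine.affine
    have p2 := (hh.swap (i := (0 : Fin (m + 1))) (by rwa [w1, w2])).affine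
    have v2 : w ∘ Equiv.swap (0 : Fin (m + 1)).castSucc (0 : Fin (m + 1)).succ = z₃ := by
      rw [hwdef]; funext j; simp
    have v1 : rot (rot w) = z₁ := by
      rw [ez₁]
      funext j
      refine Fin.lastCases ?_ (fun j => ?_) j
      · rw [rot_last, ← k0, rot_castSucc, w2, Function.comp_apply, hl, Equiv.swap_apply_right,
          rot_castSucc, hl, rot_last, k0]
      · rw [rot_castSucc, Function.comp_apply]
        by_cases g1 : j = i
        · rw [g1, Equiv.swap_apply_left, hl, rot_last, rot_last, ← k0, w1, rot_castSucc]
        · have n1 : j.succ ≠ Fin.last (m + 1) := by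
            rw [← hl]
            simpa using g1
          have n2 : j.castSucc ≠ i.castSucc := by simpa using g1
          have n3 : j.castSucc ≠ i.succ := by
            rw [hl]
            exact (Fin.castSucc_lt_last j).ne
          obtain ⟨l, hl'⟩ : ∃ l : Fin (m + 1), j.succ = l.castSucc :=
            ⟨(j.succ).castPred n1, by simp⟩
          have n4 : l.succ ≠ (0 : Fin (m + 1)).castSucc := Fin.succ_ne_zero l
          have n5 : l.succ ≠ (0 : Fin (m + 1)).succ := by
            have := congrArg Fin.val hl'
            simp only [Fin.val_succ, Fin.val_castSucc] at this
            rw [ne_eq, Fin.ext_iff, Fin.val_succ, Fin.val_succ]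
            simp only [Fin.val_zero]
            omega
          rw [Equiv.swap_apply_of_ne_of_ne n2 n3, rot_castSucc, hl', rot_castSucc, rot_castSucc,
            hwdef, Function.comp_apply, Equiv.swap_apply_of_ne_of_ne n4 n5]
    rw [v1] at p1
    rw [v2] at p2
    -- Both pairs have passed through the end once, so both values carry the same extra factor q.
    have hr : zval q t (z₁ i.succ) / zval q t (z₁ i.castSucc) =
        zval q t (z₃ (0 : Fin (m + 1)).castSucc) / zval q t (z₃ (0 : Fin (m + 1)).succ) := by
      rw [a1', a2', k0, zval, zval, zval, zval, pow_succ', pow_succ', mul_assoc, mul_assoc,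
        mul_div_mul_left _ _ G.hq]
    rw [hr, ← u₁ _ p1, ← u₂ _ p2, w1, w2, inter, inter, opT_mulXN_opW_sq G hin (j := (0 : Fin (m + 1))) rfl]
    simp only [map_add, map_smul]

/-- The predecessors have unique polynomials by induction, so only the two last arrows need to be
compared. -/
theorem YBNode.unique (G : Generic μ q t) {α : Fin (n + 1) → ℕ} {S : RSYT n μ} {f g : PV K n μ}
    (hf : YBNode q t α S f) (hg : YBNode q t α S g) : f = g := by
  induction α, S using label_induction generalizing f g with
  | h α S h1 h2 =>
    have toU : ∀ {β : Fin (n + 1) → ℕ} {S' : RSYT n μ} {f : PV K n μ},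
        (∀ {f g : PV K n μ}, YBNode q t β S' f → YBNode q t β S' g → f = g) →
        YBNode q t β S' f → ∀ g, ZNode q t (zvec β S') g → g = f := by
      rintro β S' f h hf g ⟨γ, R, hz, hg⟩
      obtain ⟨rfl, rfl⟩ := zvec_injective hz
      exact h hg hf
    have root_affine : ∀ {β : Fin (n + 1) → ℕ}, (fun _ => 0) ≠ VVMac.affine β := by
      intro β h
      have := congrFun h (Fin.last n)
      rw [affine_last] at this
      omega
    -- Over the zero composition a label is both a root and possibly the end of a tableau exchange.
    -- The two agree because the coefficient of the exchanged tableau is normalized to 1 when the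
    -- content difference is at least 2.
    have root_swap : ∀ {i : Fin n} {β : Fin (n + 1) → ℕ} {S' : RSYT n μ} {g : PV K n μ},
        α = (fun _ => 0) → YBNode q t β S' g → Prec (zvec β S' i.castSucc) (zvec β S' i.succ) →
        zvec α S = zvec β S' ∘ Equiv.swap i.castSucc i.succ →
        stepPoly q t β S' i g = const S := by
      intro i β S' g h0 hg hp hz
      have hβ : β = fun _ => 0 := by
        funext k
        have := congrArg Prod.fst (congrFun hz (Equiv.swap i.castSucc i.succ k))
        simpa [zvec, h0] using this.symm
      obtain rfl : g = const S' := h1 β S' i hp hz hg (hβ ▸ YBNode.root S')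
      subst hβ
      have hr : ∀ k, rank (fun _ : Fin (n + 1) => 0) k = k :=
        rank_of_antitone fun _ _ _ => le_rfl
      have hb : 2 ≤ S'.content i.castSucc - S'.content i.succ := by
        rcases hp with h | h
        · exact absurd h (lt_irrefl _)
        · simpa [zvec, hr] using h.2
      have hS : S = S'.exch i := by
        rw [← zvec_exch (j := i) rfl (hr _) S' (hb.trans (le_abs_self _))] at hz
        exact (zvec_injective hz).2
      have := inter_opT_const G i S' rfl
      rw [exchCoef, if_pos hb, one_smul, ← hS] at this
      rw [stepPoly_eq, ← this, zval, zval, zvec, zvec, hr, hr, pow_zero, one_mul, one_mul,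
        ← zpow_sub₀ G.ht, neg_sub]
    have swap_swap : ∀ {i k : Fin n} {β γ : Fin (n + 1) → ℕ} {S₁ S₂ : RSYT n μ}
        {f g : PV K n μ}, i < k → YBNode q t β S₁ f → YBNode q t γ S₂ g →
        Prec (zvec β S₁ i.castSucc) (zvec β S₁ i.succ) →
        Prec (zvec γ S₂ k.castSucc) (zvec γ S₂ k.succ) →
        zvec α S = zvec β S₁ ∘ Equiv.swap i.castSucc i.succ →
        zvec α S = zvec γ S₂ ∘ Equiv.swap k.castSucc k.succ →
        stepPoly q t β S₁ i f = stepPoly q t γ S₂ k g := by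
      intro i k β γ S₁ S₂ f g hik hf hg hp₁ hp₂ hz₁ hz₂
      rw [Fin.lt_def] at hik
      by_cases hlt : (i : ℕ) + 1 < k
      · rw [stepPoly_eq, stepPoly_eq]
        exact swap_swap_far (z₁ := zvec β S₁) (z₂ := zvec γ S₂) hlt G ⟨β, S₁, rfl, hf⟩ hp₁ hp₂ hz₁ hz₂
          (toU (h1 _ _ i hp₁ hz₁) hf) (toU (h1 _ _ k hp₂ hz₂) hg)
      · rw [stepPoly_eq, stepPoly_eq]
        exact swap_swap_near (z₁ := zvec β S₁) (z₂ := zvec γ S₂) (Fin.ext (by simp; omega)) G ⟨β, S₁, rfl, hf⟩ ⟨γ, S₂, rfl, hg⟩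
          hp₁ hp₂ hz₁ hz₂ (toU (h1 _ _ i hp₁ hz₁) hf) (toU (h1 _ _ k hp₂ hz₂) hg)
    have swap_aff : ∀ {i : Fin n} {β γ : Fin (n + 1) → ℕ} {S₁ : RSYT n μ}
        {f g : PV K n μ}, YBNode q t β S₁ f → YBNode q t γ S g →
        Prec (zvec β S₁ i.castSucc) (zvec β S₁ i.succ) →
        zvec α S = zvec β S₁ ∘ Equiv.swap i.castSucc i.succ → α = VVMac.affine γ →
        stepPoly q t β S₁ i f = mulXN K n μ (opW q t g) := by
      intro i β γ S₁ f g hf hg hp hz hα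
      have hz' := hz
      rw [hα, zvec_affine] at hz'
      rw [stepPoly_eq]
      exact swap_affine (z₁ := zvec β S₁) (z₂ := zvec γ S) G ⟨β, S₁, rfl, hf⟩ ⟨γ, S, rfl, hg⟩ hp hz'
        (toU (h1 _ _ i hp hz) hf) (toU (h2 _ hα) hg)
    rcases hf.cases_zvec with ⟨a0, rfl⟩ | ⟨i, β, S₁, f₁, a1, a2, a3, rfl⟩ | ⟨β, f₁, a1, a2, rfl⟩
    · rcases hg.cases_zvec with ⟨b0, rfl⟩ | ⟨k, γ, S₂, g₁, b1, b2, b3, rfl⟩ | ⟨γ, g₁, b1, b2, rfl⟩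
      · rfl
      · exact (root_swap a0 b1 b2 b3).symm
      · exact absurd (a0.symm.trans b2) root_affine
    · rcases hg.cases_zvec with ⟨b0, rfl⟩ | ⟨k, γ, S₂, g₁, b1, b2, b3, rfl⟩ | ⟨γ, g₁, b1, b2, rfl⟩
      · exact root_swap b0 a1 a2 a3
      · rcases lt_trichotomy i k with h | rfl | h
        · exact swap_swap h a1 b1 a2 b2 a3 b3
        · have hz : zvec β S₁ = zvec γ S₂ := by
            have h := a3.symm.trans b3
            funext j
            simpa using congrFun h (Equiv.swap i.castSucc i.succ j)
          obtain ⟨rfl, rfl⟩ := zvec_injective hz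
          rw [h1 _ _ i a2 a3 a1 b1]
        · exact (swap_swap h b1 a1 b2 a2 b3 a3).symm
      · exact swap_aff a1 b1 a2 a3 b2
    · rcases hg.cases_zvec with ⟨b0, rfl⟩ | ⟨k, γ, S₂, g₁, b1, b2, b3, rfl⟩ | ⟨γ, g₁, b1, b2, rfl⟩
      · exact absurd (b0.symm.trans a2) root_affine
      · exact (swap_aff b1 a1 b2 b3 a2).symm
      · obtain rfl := affine_injective (a2.symm.trans b2)
        rw [h2 _ a2 a1 b1]

end Uniqueness

end VVMac

namespace VVMac

/-! ### Independence of joint eigenvectors -/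

section Separation

variable {K W ι J : Type*} [Field K] [AddCommGroup W] [Module K W]

theorem linearIndependent_of_joint_eigenvectors {ξ : J → Module.End K W} {M : ι → W}
    {ζ : ι → J → K} (heig : ∀ x j, ξ j (M x) = ζ x j • M x) (hne : ∀ x, M x ≠ 0)
    (hsep : ∀ x y, x ≠ y → ∃ j, ζ x j ≠ ζ y j) : LinearIndependent K M := by
  classical
  -- E is a product of operators ξ_j - ζ_a(j), one for each a in s, with j chosen to separate a from
  -- y.
  have key : ∀ (s : Finset ι) (y : ι), y ∉ s → ∃ (E : Module.End K W) (c : ι → K),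
      (∀ x, E (M x) = c x • M x) ∧ c y ≠ 0 ∧ ∀ x ∈ s, c x = 0 := by
    intro s y hy
    induction s using Finset.induction_on with
    | empty => exact ⟨1, fun _ => 1, by simp, one_ne_zero, by simp⟩
    | insert a s ha ih =>
      rw [Finset.mem_insert, not_or] at hy
      obtain ⟨E, c, h1, h2, h3⟩ := ih hy.2
      obtain ⟨j, hj⟩ := hsep y a hy.1
      refine ⟨(ξ j - ζ a j • 1) * E, fun x => c x * (ζ x j - ζ a j), fun x => ?_,
        mul_ne_zero h2 (sub_ne_zero.2 hj), fun x hx => ?_⟩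
      · rw [Module.End.mul_apply, h1, map_smul, LinearMap.sub_apply, heig, LinearMap.smul_apply,
          Module.End.one_apply]
        module
      · rcases Finset.mem_insert.1 hx with rfl | hx
        · simp
        · simp [h3 x hx]
  rw [linearIndependent_iff']
  intro s g hg y hy
  obtain ⟨E, c, h1, h2, h3⟩ := key (s.erase y) y (Finset.notMem_erase y s)
  have h4 := congrArg E hg
  rw [map_zero, map_sum, Finset.sum_eq_single y] at h4
  · rw [map_smul, h1, smul_smul, smul_eq_zero] at h4
    exact (mul_eq_zero.1 (h4.resolve_right (hne y))).resolve_right h2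
  · intro x hx hxy
    rw [map_smul, h1, h3 x (Finset.mem_erase.2 ⟨hxy, hx⟩), zero_smul, smul_zero]
  · exact fun h => absurd hy h

end Separation

/-! ### The Macdonald basis and the Dunkl operator -/

section Basis

variable {K : Type*} [Field K] {n : ℕ} {μ : YoungDiagram} {q t : K}

open MvPolynomial

theorem ybNode_macdonald (q t : K) (α : Fin (n + 1) → ℕ) (S : RSYT n μ) :
    YBNode q t α S (macdonald q t α S) :=
  Classical.epsilon_spec (exists_node q t α S)

theorem ybNode_iff (G : Generic μ q t) (α : Fin (n + 1) → ℕ) (S : RSYT n μ) (f : PV K n μ) :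
    YBNode q t α S f ↔ f = macdonald q t α S :=
  ⟨fun h => h.unique G (ybNode_macdonald q t α S), fun h => h ▸ ybNode_macdonald q t α S⟩

theorem isEigen_macdonald (G : Generic μ q t) (α : Fin (n + 1) → ℕ) (S : RSYT n μ) :
    IsEigen q t (zvec α S) (macdonald q t α S) :=
  (ybNode_macdonald q t α S).isEigen G

theorem macdonald_affine (G : Generic μ q t) (α : Fin (n + 1) → ℕ) (S : RSYT n μ) :
    macdonald q t (affine α) S = mulXN K n μ (opW q t (macdonald q t α S)) :=
  ((ybNode_iff G _ _ _).1 (YBNode.affine α S _ (ybNode_macdonald q t α S))).symm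

theorem macdonald_zero (G : Generic μ q t) (S : RSYT n μ) :
    macdonald q t (fun _ => 0) S = const S :=
  ((ybNode_iff G _ _ _).1 (YBNode.root S)).symm

theorem macdonald_swap (G : Generic μ q t) {α β : Fin (n + 1) → ℕ} {S S' : RSYT n μ} {i : Fin n}
    (h : Prec (zvec α S i.castSucc) (zvec α S i.succ))
    (hz : zvec β S' = zvec α S ∘ Equiv.swap i.castSucc i.succ) :
    macdonald q t β S' = inter t (opT t i)
      (zval q t (zvec α S i.succ) / zval q t (zvec α S i.castSucc)) (macdonald q t α S) :=
  ((ybNode_iff G _ _ _).1 ((ybNode_macdonald q t α S).of_swap h hz)).symm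

theorem Generic.zval_injective (G : Generic μ q t) {x y : ℕ × ℤ}
    (hb : |y.2 - x.2| ≤ (μ.rowLen 0 : ℤ) + (μ.colLen 0 : ℤ) - 1)
    (h : zval q t x = zval q t y) : x = y := by
  by_contra hne
  refine G.zval_ratio_ne (x := x) (y := y) (e := 0) ?_ (by rwa [sub_zero]) ?_
  · by_contra hcon
    push Not at hcon
    exact hne (Prod.ext hcon.1.symm (by omega))
  · rw [h, div_self (G.zval_ne_zero y), zpow_zero]

theorem exists_zval_ne (G : Generic μ q t) {α β : Fin (n + 1) → ℕ} {S S' : RSYT n μ}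
    {z z' : Fin (n + 1) → ℕ × ℤ} (σ σ' : Equiv.Perm (Fin (n + 1))) (hz : z = zvec α S ∘ σ)
    (hz' : z' = zvec β S' ∘ σ') (h : z ≠ z') : ∃ i, zval q t (z i) ≠ zval q t (z' i) := by
  by_contra hcon
  push Not at hcon
  refine h (funext fun i => G.zval_injective ?_ (hcon i))
  have := abs_zvec_sub β α S' S (σ' i) (σ i)
  rw [hz, hz', Function.comp_apply, Function.comp_apply]
  omega

theorem linearIndependent_macdonald (G : Generic μ q t) :
    LinearIndependent K (fun x : (Fin (n + 1) → ℕ) × RSYT n μ => macdonald q t x.1 x.2) := by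
  refine linearIndependent_of_joint_eigenvectors (ξ := fun i => opXi q t i)
    (ζ := fun x i => zval q t (zvec x.1 x.2 i)) (fun x i => isEigen_macdonald G x.1 x.2 i)
    (fun x => (ybNode_macdonald q t x.1 x.2).ne_zero G) fun x y hxy => ?_
  refine exists_zval_ne G 1 1 rfl rfl fun h => hxy ?_
  obtain ⟨h1, h2⟩ := zvec_injective h
  exact Prod.ext h1 h2

variable (K n μ) in
/-- The basis of `P_τ` given by monomials and tableaux. -/
noncomputable def monoBasis : Module.Basis ((Fin (n + 1) →₀ ℕ) × RSYT n μ) K (PV K n μ) :=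
  (basisMonomials (Fin (n + 1)) K).tensorProduct Finsupp.basisSingleOne

theorem monoBasis_apply (x : (Fin (n + 1) →₀ ℕ) × RSYT n μ) :
    monoBasis K n μ x = monomial x.1 1 ⊗ₜ Finsupp.single x.2 1 := by
  rw [monoBasis, Module.Basis.tensorProduct_apply']
  simp

variable (K n μ) in
/-- The vectors of degree at most `m`. -/
noncomputable def degLE (m : ℕ) : Submodule K (PV K n μ) :=
  Submodule.span K (monoBasis K n μ '' {x | x.1.degree ≤ m})

theorem tmul_mem_degLE {m : ℕ} {p : MvPolynomial (Fin (n + 1)) K} (hp : p.totalDegree ≤ m)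
    (v : V K n μ) : p ⊗ₜ v ∈ degLE K n μ m := by
  rw [degLE, Module.Basis.mem_span_image]
  intro x hx
  rw [Finset.mem_coe, Finsupp.mem_support_iff, monoBasis,
    Module.Basis.tensorProduct_repr_tmul_apply] at hx
  have h : p.coeff x.1 ≠ 0 := by
    intro h
    apply hx
    simp only [smul_eq_mul]
    rw [show (basisMonomials (Fin (n + 1)) K).repr p x.1 = p.coeff x.1 from rfl, h]
    simp
  refine le_trans ?_ hp
  exact le_totalDegree (mem_support_iff.2 h)

theorem map_mem_degLE {A : PV K n μ →ₗ[K] PV K n μ} {m m' : ℕ}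
    (h : ∀ (p : MvPolynomial (Fin (n + 1)) K) v, p.IsHomogeneous p.totalDegree →
      p.totalDegree ≤ m → A (p ⊗ₜ v) ∈ degLE K n μ m')
    {f : PV K n μ} (hf : f ∈ degLE K n μ m) : A f ∈ degLE K n μ m' := by
  have : degLE K n μ m ≤ (degLE K n μ m').comap A := by
    rw [degLE, Submodule.span_le]
    rintro _ ⟨x, hx, rfl⟩
    have hd : (monomial x.1 (1 : K)).totalDegree = x.1.degree := by
      rw [totalDegree_monomial _ one_ne_zero]
      rfl
    rw [monoBasis_apply]
    refine h _ _ ?_ ?_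
    · rw [hd]
      exact isHomogeneous_monomial _ rfl
    · rw [hd]
      exact hx
  exact this hf

theorem totalDegree_X_mul_divDiff_le (i : Fin n) (p : MvPolynomial (Fin (n + 1)) K) :
    (X i.succ * divDiff i p).totalDegree ≤ p.totalDegree := by
  by_cases h0 : divDiff i p = 0
  · simp [h0]
  · have h1 := congrArg totalDegree (X_sub_X_mul_divDiff i p)
    rw [totalDegree_mul_of_isDomain (X_sub_X_ne_zero i) h0] at h1
    have h2 : (p - rename (Equiv.swap i.castSucc i.succ) p).totalDegree ≤ p.totalDegree :=
      (totalDegree_sub _ _).trans (max_le le_rfl (totalDegree_rename_le _ _))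
    have h3 : 1 ≤ (X i.castSucc - X i.succ : MvPolynomial (Fin (n + 1)) K).totalDegree := by
      have hs : Finsupp.single i.castSucc 1 ∈
          (X i.castSucc - X i.succ : MvPolynomial (Fin (n + 1)) K).support := by
        have hne : Finsupp.single i.succ 1 ≠ Finsupp.single i.castSucc 1 := fun h => by
          have := Finsupp.single_left_injective one_ne_zero h
          simp [Fin.ext_iff] at this
        rw [mem_support_iff, coeff_sub]
        simp [coeff_X, hne]
      have := le_totalDegree hs
      simpa using this
    have h4 := totalDegree_mul (X i.succ) (divDiff i p)
    rw [totalDegree_X] at h4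
    omega

theorem opT_mem_degLE (t : K) (i : Fin n) {m : ℕ} {f : PV K n μ} (hf : f ∈ degLE K n μ m) :
    opT t i f ∈ degLE K n μ m := by
  refine map_mem_degLE (fun p v _ hp => ?_) hf
  rw [opT_tmul]
  exact Submodule.add_mem _
    (tmul_mem_degLE ((totalDegree_smul_le _ _).trans
      ((totalDegree_X_mul_divDiff_le i p).trans hp)) v)
    (tmul_mem_degLE ((totalDegree_rename_le _ _).trans hp) _)

theorem opW_mem_degLE (q t : K) {m : ℕ} {f : PV K n μ} (hf : f ∈ degLE K n μ m) :
    opW q t f ∈ degLE K n μ m := by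
  refine map_mem_degLE (fun p v hp hm => ?_) hf
  rw [opW, TensorProduct.map_tmul]
  refine tmul_mem_degLE ?_ _
  refine le_trans (IsHomogeneous.totalDegree_le (n := 1 * p.totalDegree)
    (IsHomogeneous.aeval hp _ fun k => ?_)) (by omega)
  refine Fin.cases ?_ (fun k => ?_) k
  · rw [Fin.cons_zero]
    have := (isHomogeneous_C (Fin (n + 1)) q).mul (isHomogeneous_X K (Fin.last n))
    rwa [zero_add] at this
  · rw [Fin.cons_succ]
    exact isHomogeneous_X _ _

theorem mulXN_mem_degLE {m : ℕ} {f : PV K n μ} (hf : f ∈ degLE K n μ m) :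
    mulXN K n μ f ∈ degLE K n μ (m + 1) := by
  refine map_mem_degLE (fun p v _ hm => ?_) hf
  rw [← mulX_last, mulX_tmul]
  refine tmul_mem_degLE ((totalDegree_mul _ _).trans ?_) v
  rw [totalDegree_X]
  omega

theorem YBNode.mem_degLE {α : Fin (n + 1) → ℕ} {S : RSYT n μ} {f : PV K n μ}
    (h : YBNode q t α S f) : f ∈ degLE K n μ (∑ i, α i) := by
  have key : ∀ {α : Fin (n + 1) → ℕ} {S : RSYT n μ} {i : Fin n} {m : ℕ} {f : PV K n μ},
      f ∈ degLE K n μ m → stepPoly q t α S i f ∈ degLE K n μ m := fun hf =>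
    Submodule.add_mem _ (opT_mem_degLE t _ hf) (Submodule.smul_mem _ _ hf)
  induction h with
  | root S => exact tmul_mem_degLE (by simp) _
  | step α S f i hi hf ih =>
    have : ∑ k, swapAt α i k = ∑ k, α k :=
      Equiv.sum_comp (Equiv.swap i.castSucc i.succ) α
    rw [this]
    exact key ih
  | exch α S f i j hi hj hc hf ih => exact key ih
  | affine α S f hf ih =>
    rw [sum_affine]
    exact mulXN_mem_degLE (opW_mem_degLE q t ih)

/-- No leading terms are needed. The M_{α,S} with |α| ≤ m lie in the space of degree at most m, are
independent, and are indexed by the same finite set as its basis of monomials and tableaux. -/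
theorem span_macdonald (G : Generic μ q t) :
    Submodule.span K (Set.range
      (fun x : (Fin (n + 1) → ℕ) × RSYT n μ => macdonald q t x.1 x.2)) = ⊤ := by
  have key : ∀ m, degLE K n μ m ≤ Submodule.span K (Set.range
      (fun x : (Fin (n + 1) → ℕ) × RSYT n μ => macdonald q t x.1 x.2)) := by
    intro m
    let I : Set ((Fin (n + 1) →₀ ℕ) × RSYT n μ) := {x | x.1.degree ≤ m}
    have hfin : I.Finite := by
      refine ((Finsupp.finite_of_degree_le (σ := Fin (n + 1)) m).prod Set.finite_univ).subset ?_
      intro x hx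
      exact ⟨hx, Set.mem_univ _⟩
    have : Fintype I := hfin.fintype
    let b : I → PV K n μ := fun x => monoBasis K n μ x
    let M : I → PV K n μ := fun x => macdonald q t (x.1.1 : Fin (n + 1) → ℕ) x.1.2
    have hb : LinearIndependent K b :=
      (monoBasis K n μ).linearIndependent.comp _ Subtype.val_injective
    have hM : LinearIndependent K M := by
      refine (linearIndependent_macdonald (n := n) G).comp
        (fun x : I => ((x.1.1 : Fin (n + 1) → ℕ), x.1.2)) ?_
      intro x y hxy
      rw [Prod.mk.injEq] at hxy
      exact Subtype.ext (Prod.ext (DFunLike.coe_injective hxy.1) hxy.2)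
    have hbm : degLE K n μ m = Submodule.span K (Set.range b) := by
      rw [degLE, Set.image_eq_range]
    have hle : Submodule.span K (Set.range M) ≤ Submodule.span K (Set.range b) := by
      rw [← hbm, Submodule.span_le]
      rintro _ ⟨x, rfl⟩
      have h1 := (ybNode_macdonald q t (x.1.1 : Fin (n + 1) → ℕ) x.1.2).mem_degLE
      have h2 : ∑ i, (x.1.1 : Fin (n + 1) → ℕ) i ≤ m := by
        have : x.1.1.degree ≤ m := x.2
        rwa [Finsupp.degree_eq_sum] at this
      refine (Submodule.span_mono (Set.image_mono ?_) : degLE K n μ _ ≤ degLE K n μ m) h1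
      intro y hy
      exact le_trans hy h2
    have : FiniteDimensional K (Submodule.span K (Set.range b)) :=
      FiniteDimensional.span_of_finite K (Set.finite_range b)
    have heq := Submodule.eq_of_le_of_finrank_eq hle
      ((finrank_span_eq_card hM).trans (finrank_span_eq_card hb).symm)
    rw [hbm, ← heq]
    refine Submodule.span_mono ?_
    rintro _ ⟨x, rfl⟩
    exact ⟨((x.1.1 : Fin (n + 1) → ℕ), x.1.2), rfl⟩
  rw [eq_top_iff, ← (monoBasis K n μ).span_eq, Submodule.span_le]
  rintro _ ⟨x, rfl⟩
  exact key x.1.degree (Submodule.subset_span ⟨x, le_refl x.1.degree, rfl⟩)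

/-- The Macdonald polynomials as a basis. -/
noncomputable def macBasis (G : Generic μ q t) :
    Module.Basis ((Fin (n + 1) → ℕ) × RSYT n μ) K (PV K n μ) :=
  Module.Basis.mk (linearIndependent_macdonald G) (span_macdonald G).ge

theorem macBasis_apply (G : Generic μ q t) (x : (Fin (n + 1) → ℕ) × RSYT n μ) :
    macBasis G x = macdonald q t x.1 x.2 := by
  rw [macBasis, Module.Basis.mk_apply]

/-- Every joint eigenvector has the spectral vector of a label. -/
theorem exists_label_of_isEigen (G : Generic μ q t) {α : Fin (n + 1) → ℕ} {S : RSYT n μ}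
    {f : PV K n μ} (σ : Equiv.Perm (Fin (n + 1))) (hf : IsEigen q t (zvec α S ∘ σ) f)
    (h0 : f ≠ 0) : ∃ β, ∃ S' : RSYT n μ, zvec β S' = zvec α S ∘ σ := by
  by_contra hcon
  push Not at hcon
  -- With a spectrum belonging to no label, f could be adjoined to the Macdonald polynomials as a
  -- further independent vector, although these already span.
  let v : Option ((Fin (n + 1) → ℕ) × RSYT n μ) → PV K n μ := fun x =>
    x.elim f fun x => macdonald q t x.1 x.2
  let z : Option ((Fin (n + 1) → ℕ) × RSYT n μ) → Fin (n + 1) → ℕ × ℤ := fun x =>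
    x.elim (zvec α S ∘ σ) fun x => zvec x.1 x.2
  have hli : LinearIndependent K v := by
    refine linearIndependent_of_joint_eigenvectors (ξ := fun i => opXi q t i)
      (ζ := fun x i => zval q t (z x i)) ?_ ?_ ?_
    · rintro (_ | x) i
      · exact hf i
      · exact isEigen_macdonald G x.1 x.2 i
    · rintro (_ | x)
      · exact h0
      · exact (ybNode_macdonald q t x.1 x.2).ne_zero G
    · rintro (_ | x) (_ | y) hxy
      · exact absurd rfl hxy
      · exact exists_zval_ne G σ 1 rfl rfl (hcon y.1 y.2).symm
      · exact exists_zval_ne G 1 σ rfl rfl (hcon x.1 x.2)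
      · refine exists_zval_ne G 1 1 rfl rfl fun h => hxy ?_
        obtain ⟨h1, h2⟩ := zvec_injective h
        exact congrArg some (Prod.ext h1 h2)
  refine (linearIndependent_option.1 hli).2 ?_
  have : v ∘ some = fun x : (Fin (n + 1) → ℕ) × RSYT n μ => macdonald q t x.1 x.2 := rfl
  rw [this, span_macdonald G]
  exact Submodule.mem_top

/-- A nonzero value would be a joint eigenvector whose exponents are those of no label. This covers
neighbours whose tableau entries share a row or a column. -/
theorem inter_macdonald_eq_zero (G : Generic μ q t) {α : Fin (n + 1) → ℕ} {S : RSYT n μ}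
    {i : Fin n} (h : ∀ (β : Fin (n + 1) → ℕ) (S' : RSYT n μ),
      zvec β S' ≠ zvec α S ∘ Equiv.swap i.castSucc i.succ) :
    inter t (opT t i) (zval q t (zvec α S i.succ) / zval q t (zvec α S i.castSucc))
      (macdonald q t α S) = 0 := by
  by_contra h0
  obtain ⟨β, S', hz⟩ := exists_label_of_isEigen G _
    ((isEigen_macdonald G α S).inter G i (G.zval_ratio_ne_one α S i)) h0
  exact h β S' hz

/-- A final 0 loses to every other position, so it is paired with the entry of content 0 and has
spectral value 1. Hence D_N kills the corresponding polynomial. -/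
theorem rank_last_of_zero {α : Fin (n + 1) → ℕ} (h : α (Fin.last n) = 0) :
    rank α (Fin.last n) = Fin.last n := by
  have : (Finset.univ.filter fun k => Beats α k (Fin.last n)) =
      Finset.univ.erase (Fin.last n) := by
    ext k
    simp only [Finset.mem_filter, Finset.mem_univ, true_and, Finset.mem_erase, and_true]
    simp only [Beats, h]
    constructor
    · rintro (h1 | h1)
      · rintro rfl
        omega
      · exact h1.2.ne
    · intro h1
      have := Fin.lt_last_iff_ne_last.2 h1
      rcases Nat.eq_zero_or_pos (α k) with h2 | h2
      · exact Or.inr ⟨h2, this⟩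
      · exact Or.inl h2
  apply Fin.ext
  rw [rank_val, this, Finset.card_erase_of_mem (Finset.mem_univ _)]
  simp

theorem zval_last_of_zero {α : Fin (n + 1) → ℕ} (h : α (Fin.last n) = 0) (S : RSYT n μ)
    (q t : K) : zval q t (zvec α S (Fin.last n)) = 1 := by
  rw [zval, zvec, rank_last_of_zero h, RSYT.content_last, h, pow_zero, zpow_zero, one_mul]

theorem opD_macdonald_of_zero (G : Generic μ q t) {α : Fin (n + 1) → ℕ}
    (h : α (Fin.last n) = 0) (S : RSYT n μ) : opD q t (macdonald q t α S) = 0 := by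
  rw [opD, LinearMap.comp_apply, LinearMap.sub_apply, isEigen_macdonald G,
    zval_last_of_zero h, one_smul, LinearMap.id_apply, sub_self, map_zero]

theorem opD_macdonald_affine (G : Generic μ q t) (α : Fin (n + 1) → ℕ) (S : RSYT n μ) :
    opD q t (macdonald q t (affine α) S) =
      (1 - zval q t (zvec (affine α) S (Fin.last n))) • opW q t (macdonald q t α S) := by
  rw [opD, LinearMap.comp_apply, LinearMap.sub_apply, isEigen_macdonald G, LinearMap.id_apply,
    macdonald_affine G]
  rw [map_sub, map_smul, divXN_mulXN]
  module

/-- Divisibility is checked on the Macdonald basis: the difference is zero if the last part is zero,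
and otherwise M itself is a multiple of x_N by the affine arrow. -/
theorem mulXN_opD (G : Generic μ q t) (f : PV K n μ) :
    mulXN K n μ (opD q t f) = f - opXi q t (Fin.last n) f := by
  have h : mulXN K n μ ∘ₗ opD q t = LinearMap.id - opXi q t (Fin.last n) := by
    refine (macBasis G).ext fun x => ?_
    rw [macBasis_apply, LinearMap.comp_apply, LinearMap.sub_apply, LinearMap.id_apply]
    obtain ⟨α, S⟩ := x
    rcases Nat.eq_zero_or_pos (α (Fin.last n)) with h | h
    · rw [opD_macdonald_of_zero G h, isEigen_macdonald G, zval_last_of_zero h, one_smul, sub_self,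
        map_zero]
    · obtain ⟨β, rfl⟩ := exists_affine_eq h
      rw [opD_macdonald_affine G, isEigen_macdonald G, map_smul, ← macdonald_affine G]
      module
  exact LinearMap.congr_fun h f

end Basis

end VVMac

namespace VVMac

/-! ### The norm as a function of the exponent vector -/

section NormValues

variable {K : Type*} [Field K] {n : ℕ} {μ : YoungDiagram} {q t : K}

theorem prod_eq_mul_prod_of_eq_off {ι : Type*} [Fintype ι] [DecidableEq ι] {f g : ι → K} {a : ι}
    {c : K} (ha : f a = c * g a) (h : ∀ x, x ≠ a → f x = g x) : ∏ x, f x = c * ∏ x, g x := by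
  rw [← Finset.mul_prod_erase _ f (Finset.mem_univ a),
    ← Finset.mul_prod_erase _ g (Finset.mem_univ a), ha, mul_assoc]
  congr 2
  exact Finset.prod_congr rfl fun x hx => h x (Finset.ne_of_mem_erase hx)

theorem prod_pair_comp (σ : Equiv.Perm (Fin (n + 1))) (F : Fin (n + 1) × Fin (n + 1) → K) :
    ∏ p, F p = ∏ p : Fin (n + 1) × Fin (n + 1), F (σ p.1, σ p.2) :=
  (Equiv.prod_comp (Equiv.prodCongr σ σ) F).symm

/-- The product `∏_{k=1}^d u(q^k t^c)`. -/
def gapProd (q t : K) (d : ℕ) (c : ℤ) : K := ∏ k ∈ Finset.range d, u t (q ^ (k + 1) * t ^ c)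

theorem gapProd_zero (q t : K) (c : ℤ) : gapProd q t 0 c = 1 := Finset.prod_range_zero _

theorem gapProd_succ (q t : K) (d : ℕ) (c : ℤ) :
    gapProd q t (d + 1) c = u t (q ^ (d + 1) * t ^ c) * gapProd q t d c := by
  rw [gapProd, Finset.prod_range_succ, mul_comm, gapProd]

/-- With z = q^k t^c one has t (1 - z t⁻¹)(1 - z t) = (t - z)(1 - t z), so each factor of the
quotient takes one t and becomes u(z). -/
theorem qPoch_ratio (ht : t ≠ 0) (q : K) (d : ℕ) (c : ℤ) :
    t ^ d * (qPoch q (q * t ^ (c - 1)) d * qPoch q (q * t ^ (c + 1)) d /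
      qPoch q (q * t ^ c) d ^ 2) = gapProd q t d c := by
  rw [qPoch, qPoch, qPoch, gapProd, ← Finset.prod_mul_distrib, ← Finset.prod_pow,
    ← Finset.prod_div_distrib, ← Finset.card_range d, ← Finset.prod_const, Finset.card_range,
    ← Finset.prod_mul_distrib]
  refine Finset.prod_congr rfl fun k _ => ?_
  rw [u, ← mul_div_assoc]
  congr 1
  · rw [zpow_sub_one₀ ht, zpow_add_one₀ ht]
    field_simp
    ring
  · ring

/-- The norm of a Macdonald polynomial up to the factor coming from the tableau, as a function of
the spectral exponents. -/
def specNorm (q t : K) (z : Fin (n + 1) → ℕ × ℤ) : K :=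
  ((1 - q) ^ (∑ i, (z i).1))⁻¹ * (∏ i, qPoch q (q * t ^ (z i).2) (z i).1) *
    ∏ p : Fin (n + 1) × Fin (n + 1),
      gapProd q t ((z p.1).1 - (z p.2).1 - if p.2 < p.1 then 1 else 0) ((z p.1).2 - (z p.2).2)

/-- In `specNorm` the truncated difference makes a pair contribute only if its first member has the
larger degree, and the top factor u is left out when that member stands to the right. The exchange
brings it to the left at exactly one pair and restores that factor. -/
theorem specNorm_swap (q t : K) (z : Fin (n + 1) → ℕ × ℤ) {i : Fin n}
    (h : (z i.castSucc).1 ≤ (z i.succ).1) :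
    specNorm q t (z ∘ Equiv.swap i.castSucc i.succ) =
      (if (z i.castSucc).1 < (z i.succ).1 then
        u t (q ^ ((z i.succ).1 - (z i.castSucc).1) * t ^ ((z i.succ).2 - (z i.castSucc).2))
        else 1) * specNorm q t z := by
  have hlt : i.castSucc < i.succ := Fin.castSucc_lt_succ
  simp only [specNorm, Function.comp_apply]
  rw [Equiv.sum_comp (Equiv.swap i.castSucc i.succ) fun j => (z j).1,
    Equiv.prod_comp (Equiv.swap i.castSucc i.succ) fun j => qPoch q (q * t ^ (z j).2) (z j).1,
    mul_left_comm]
  congr 1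
  rw [prod_pair_comp (Equiv.swap i.castSucc i.succ)]
  simp only [Equiv.swap_apply_self]
  refine prod_eq_mul_prod_of_eq_off (a := (i.succ, i.castSucc)) ?_ ?_
  · simp only [Equiv.swap_apply_left, Equiv.swap_apply_right]
    rw [if_neg hlt.not_gt, if_pos hlt, Nat.sub_zero]
    split_ifs with h'
    · obtain ⟨d, hd⟩ : ∃ d, (z i.succ).1 - (z i.castSucc).1 = d + 1 :=
        ⟨(z i.succ).1 - (z i.castSucc).1 - 1, by omega⟩
      rw [hd, gapProd_succ, Nat.add_sub_cancel]
    · rw [show (z i.succ).1 - (z i.castSucc).1 = 0 by omega, one_mul]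
  · rintro ⟨a, b⟩ hab
    by_cases hab' : a = i.castSucc ∧ b = i.succ
    · obtain ⟨rfl, rfl⟩ := hab'
      rw [show (z i.castSucc).1 - (z i.succ).1 = 0 by omega, Nat.zero_sub, Nat.zero_sub]
    · have : Equiv.swap i.castSucc i.succ b < Equiv.swap i.castSucc i.succ a ↔ b < a :=
        swap_lt_swap_iff i (fun h => hab (Prod.ext h.2 h.1)) fun h => hab' ⟨h.2, h.1⟩
      simp only [this]

/-- The pair product is invariant: when the first position moves to the end, the degree it gains
compensates the 1 that is subtracted for members standing to the right. Only the degree and one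
Pochhammer factor change. -/
theorem specNorm_rot (q t : K) (z : Fin (n + 1) → ℕ × ℤ) :
    specNorm q t (rot z) = (1 - q ^ ((z 0).1 + 1) * t ^ (z 0).2) / (1 - q) * specNorm q t z := by
  have e1 : ∑ i, (rot z i).1 = ∑ i, (z i).1 + 1 := by
    rw [Fin.sum_univ_castSucc, Fin.sum_univ_succ]
    simp only [rot_castSucc, rot_last]
    ring
  have e2 : ∏ i, qPoch q (q * t ^ (rot z i).2) (rot z i).1 =
      (1 - q ^ ((z 0).1 + 1) * t ^ (z 0).2) * ∏ i, qPoch q (q * t ^ (z i).2) (z i).1 := by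
    rw [Fin.prod_univ_castSucc, Fin.prod_univ_succ]
    simp only [rot_castSucc, rot_last]
    rw [qPoch, Finset.prod_range_succ, qPoch]
    ring
  have e3 : ∏ p : Fin (n + 1) × Fin (n + 1),
      gapProd q t ((rot z p.1).1 - (rot z p.2).1 - if p.2 < p.1 then 1 else 0)
        ((rot z p.1).2 - (rot z p.2).2) =
      ∏ p : Fin (n + 1) × Fin (n + 1),
        gapProd q t ((z p.1).1 - (z p.2).1 - if p.2 < p.1 then 1 else 0)
          ((z p.1).2 - (z p.2).2) := by
    rw [prod_pair_comp (finRotate (n + 1)).symm]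
    refine Finset.prod_congr rfl fun p _ => ?_
    obtain ⟨k, l⟩ := p
    refine Fin.cases ?_ (fun k => ?_) k <;> refine Fin.cases ?_ (fun l => ?_) l <;>
      simp only [finRotate_symm_zero, finRotate_symm_succ, rot_castSucc, rot_last, lt_irrefl,
        if_false, Fin.succ_lt_succ_iff, Fin.castSucc_lt_castSucc_iff, Fin.succ_pos,
        Fin.castSucc_lt_last, if_true, Fin.not_lt_zero, (Fin.castSucc_lt_last _).not_gt,
        Nat.sub_self]
    · congr 1
      omega
    · congr 1
  rw [specNorm, specNorm, e1, e2, e3, pow_succ, mul_inv]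
  ring

theorem normS_exch (S : RSYT n μ) (j : Fin n)
    (h : 2 ≤ S.content j.castSucc - S.content j.succ) :
    normS t (S.exch j) = u t (t ^ (S.content j.succ - S.content j.castSucc)) * normS t S := by
  have hlt : j.castSucc < j.succ := Fin.castSucc_lt_succ
  rw [normS, normS, Finset.prod_filter, Finset.prod_filter,
    prod_pair_comp (Equiv.swap j.castSucc j.succ)]
  simp only [RSYT.content_exch S j (h.trans (le_abs_self _)), Equiv.swap_apply_self]
  refine prod_eq_mul_prod_of_eq_off (a := (j.succ, j.castSucc)) ?_ ?_
  · simp only [Equiv.swap_apply_left, Equiv.swap_apply_right]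
    rw [if_pos ⟨hlt, h⟩, if_neg fun h' => hlt.not_gt h'.1, mul_one]
  · rintro ⟨a, b⟩ hab
    by_cases hab' : a = j.castSucc ∧ b = j.succ
    · obtain ⟨rfl, rfl⟩ := hab'
      rw [if_neg fun h' => ?_, if_neg fun h' => ?_]
      · have := h'.2
        simp only at this
        omega
      · have := h'.1
        simp only [Equiv.swap_apply_left, Equiv.swap_apply_right] at this
        exact hlt.not_gt this
    · have : Equiv.swap j.castSucc j.succ a < Equiv.swap j.castSucc j.succ b ↔ a < b :=
        swap_lt_swap_iff j hab' fun h => hab (Prod.ext h.1 h.2)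
      simp only [this]

/-- k(λ) is the sum of λ_i - λ_j over i < j, so the power of t can be distributed over the pairs. -/
theorem zpow_kExp (t : K) {lam : Fin (n + 1) → ℕ} (h : Antitone lam) :
    t ^ kExp lam = ∏ p ∈ (Finset.univ : Finset (Fin (n + 1) × Fin (n + 1))).filter
      (fun p => p.1 < p.2), t ^ (lam p.1 - lam p.2) := by
  have e : kExp lam = ((∑ p ∈ (Finset.univ : Finset (Fin (n + 1) × Fin (n + 1))).filter
      (fun p => p.1 < p.2), (lam p.1 - lam p.2) : ℕ) : ℤ) := by
    have h1 : ((∑ p ∈ (Finset.univ : Finset (Fin (n + 1) × Fin (n + 1))).filter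
        (fun p => p.1 < p.2), (lam p.1 - lam p.2) : ℕ) : ℤ) =
        ∑ p ∈ (Finset.univ : Finset (Fin (n + 1) × Fin (n + 1))).filter
        (fun p => p.1 < p.2), ((lam p.1 : ℤ) - lam p.2) := by
      rw [Nat.cast_sum]
      refine Finset.sum_congr rfl fun p hp => ?_
      rw [Nat.cast_sub (h (Finset.mem_filter.1 hp).2.le)]
    rw [h1, Finset.sum_sub_distrib, Finset.sum_filter, Finset.sum_filter, Fintype.sum_prod_type,
      Fintype.sum_prod_type_right, ← Finset.sum_sub_distrib, kExp]
    refine Finset.sum_congr rfl fun i _ => ?_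
    simp only
    rw [← Finset.sum_filter, ← Finset.sum_filter, Finset.sum_const, Finset.sum_const,
      Finset.filter_lt_eq_Ioi, Finset.filter_gt_eq_Iio, Fin.card_Ioi, Fin.card_Iio]
    have := i.isLt
    rw [nsmul_eq_mul, nsmul_eq_mul, ← sub_mul, show n + 1 - 1 - (i : ℕ) = n - i by omega,
      Nat.cast_sub (by omega)]
    ring
  rw [e, zpow_natCast, Finset.prod_pow_eq_pow_sum]

theorem normPart_eq (ht : t ≠ 0) (q : K) {lam : Fin (n + 1) → ℕ} (h : Antitone lam)
    (S : RSYT n μ) :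
    normPart q t lam S = normS t S * (((1 - q) ^ (∑ i, lam i))⁻¹ *
      (∏ i, qPoch q (q * t ^ S.content i) (lam i)) * ∏ p : Fin (n + 1) × Fin (n + 1),
        gapProd q t (lam p.1 - lam p.2) (S.content p.1 - S.content p.2)) := by
  have e : t ^ kExp lam * (∏ p ∈ (Finset.univ : Finset (Fin (n + 1) × Fin (n + 1))).filter
      (fun p => p.1 < p.2),
      qPoch q (q * t ^ (S.content p.1 - S.content p.2 - 1)) (lam p.1 - lam p.2) *
        qPoch q (q * t ^ (S.content p.1 - S.content p.2 + 1)) (lam p.1 - lam p.2) /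
        qPoch q (q * t ^ (S.content p.1 - S.content p.2)) (lam p.1 - lam p.2) ^ 2) =
      ∏ p : Fin (n + 1) × Fin (n + 1),
        gapProd q t (lam p.1 - lam p.2) (S.content p.1 - S.content p.2) := by
    rw [zpow_kExp t h, ← Finset.prod_mul_distrib, Finset.prod_filter]
    refine Finset.prod_congr rfl fun p _ => ?_
    split_ifs with hp
    · exact qPoch_ratio ht q _ _
    · have := h (not_lt.1 hp)
      rw [Nat.sub_eq_zero_of_le this, gapProd_zero]
  rw [← e, normPart]
  ring

/-- The norm of the Macdonald polynomial `M_{α,S}`. -/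
noncomputable def macNorm (q t : K) (α : Fin (n + 1) → ℕ) (S : RSYT n μ) : K :=
  (scrE q t α S)⁻¹ * normPart q t (plus α) S

/-- Reindexing the products for α⁺ along the rank permutation turns them into products over the
positions of α. Division by the nonzero 𝓔(α, S) removes the top factor of each inverted pair, as
`specNorm` prescribes. -/
theorem macNorm_eq (G : Generic μ q t) (α : Fin (n + 1) → ℕ) (S : RSYT n μ) :
    macNorm q t α S = normS t S * specNorm q t (zvec α S) := by
  have e0 : scrE q t α S = ∏ p : Fin (n + 1) × Fin (n + 1), if p.2 < p.1 ∧ α p.2 < α p.1 then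
      u t (q ^ (α p.1 - α p.2) * t ^ ((zvec α S p.1).2 - (zvec α S p.2).2)) else 1 := by
    rw [scrE, Finset.prod_filter, ← Equiv.prod_comp (Equiv.prodComm _ _)]
    rfl
  have h0 : scrE q t α S ≠ 0 := by
    refine Finset.prod_ne_zero_iff.2 fun p hp => ?_
    have := (Finset.mem_filter.1 hp).2.2
    exact G.u_ne_zero S S (by omega) _ _
  have e1 : ∑ i, plus α i = ∑ i, α i := by
    rw [← Equiv.sum_comp (rankEquiv α)]
    exact Finset.sum_congr rfl fun i _ => plus_rank α i
  have e2 : ∏ i, qPoch q (q * t ^ S.content i) (plus α i) =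
      ∏ i, qPoch q (q * t ^ (zvec α S i).2) (zvec α S i).1 := by
    rw [← Equiv.prod_comp (rankEquiv α)]
    refine Finset.prod_congr rfl fun i _ => ?_
    rw [rankEquiv_apply, plus_rank]
    rfl
  have e3 : ∏ p : Fin (n + 1) × Fin (n + 1),
      gapProd q t (plus α p.1 - plus α p.2) (S.content p.1 - S.content p.2) =
      scrE q t α S * ∏ p : Fin (n + 1) × Fin (n + 1),
      gapProd q t ((zvec α S p.1).1 - (zvec α S p.2).1 - if p.2 < p.1 then 1 else 0)
        ((zvec α S p.1).2 - (zvec α S p.2).2) := by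
    rw [prod_pair_comp (rankEquiv α), e0, ← Finset.prod_mul_distrib]
    refine Finset.prod_congr rfl fun p _ => ?_
    simp only [rankEquiv_apply, plus_rank, zvec]
    by_cases hp : p.2 < p.1
    · by_cases hα : α p.2 < α p.1
      · obtain ⟨d, hd⟩ : ∃ d, α p.1 - α p.2 = d + 1 := ⟨α p.1 - α p.2 - 1, by omega⟩
        rw [if_pos ⟨hp, hα⟩, if_pos hp, hd, gapProd_succ, Nat.add_sub_cancel]
      · rw [if_neg fun h => hα h.2, show α p.1 - α p.2 = 0 by omega, Nat.zero_sub, one_mul]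
    · rw [if_neg fun h => hp h.1, if_neg hp, one_mul, Nat.sub_zero]
  rw [macNorm, normPart_eq G.ht q (plus_antitone α), e1, e2, e3, specNorm]
  have e4 : ∑ i, (zvec α S i).1 = ∑ i, α i := rfl
  rw [e4]
  field_simp

theorem macNorm_of_antitone {lam : Fin (n + 1) → ℕ} (h : Antitone lam) (q t : K)
    (S : RSYT n μ) : macNorm q t lam S = normPart q t lam S := by
  have : scrE q t lam S = 1 := by
    rw [scrE, Finset.filter_false_of_mem, Finset.prod_empty]
    rintro p - ⟨h1, h2⟩
    exact absurd (h h1.le) h2.not_ge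
  rw [macNorm, this, inv_one, one_mul, plus_of_antitone h]

theorem macNorm_zero (q t : K) (S : RSYT n μ) : macNorm q t (fun _ => 0) S = normS t S := by
  rw [macNorm_of_antitone antitone_const, normPart]
  simp [kExp, qPoch]

theorem macNorm_exch (G : Generic μ q t) (α : Fin (n + 1) → ℕ) {i j : Fin n} (S : RSYT n μ)
    (h : α i.castSucc = α i.succ) (hj : rank α i.castSucc = j.castSucc)
    (hS : 2 ≤ S.content j.castSucc - S.content j.succ) :
    macNorm q t α (S.exch j) =
      u t (t ^ (S.content j.succ - S.content j.castSucc)) * macNorm q t α S := by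
  rw [macNorm_eq G, macNorm_eq G, zvec_exch h hj S (hS.trans (le_abs_self _)), normS_exch S j hS,
    specNorm_swap q t (zvec α S) (i := i) h.le,
    if_neg (show ¬ (zvec α S i.castSucc).1 < (zvec α S i.succ).1 from not_lt.2 h.ge), one_mul,
    mul_assoc]

/-- For equal parts the factor u comes from `normS`, for unequal parts from `specNorm`; in both
cases it is u at the spectral ratio. -/
theorem macNorm_swap (G : Generic μ q t) {α β : Fin (n + 1) → ℕ} {S S' : RSYT n μ} {i : Fin n}
    (h : Prec (zvec α S i.castSucc) (zvec α S i.succ))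
    (hz : zvec β S' = zvec α S ∘ Equiv.swap i.castSucc i.succ) :
    macNorm q t β S' =
      u t (zval q t (zvec α S i.succ) / zval q t (zvec α S i.castSucc)) * macNorm q t α S := by
  rw [G.zval_ratio]
  rcases h with h | ⟨h1, h2⟩
  · have h' : α i.castSucc < α i.succ := h
    obtain ⟨-, rfl⟩ := zvec_injective (hz.trans (zvec_swapAt h'.ne S).symm)
    rw [macNorm_eq G, macNorm_eq G, hz, specNorm_swap q t _ h.le, if_pos h, ← zpow_natCast,
      Nat.cast_sub h.le]
    ring
  · have h' : α i.castSucc = α i.succ := h1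
    obtain ⟨j, hj⟩ := exists_rank_eq h'
    have e1 : (zvec α S i.castSucc).2 = S.content j.castSucc := by rw [zvec, hj]
    have e2 : (zvec α S i.succ).2 = S.content j.succ := by rw [zvec, rank_succ_eq h' hj]
    rw [e1, e2] at h2
    obtain ⟨rfl, rfl⟩ := zvec_injective
      (hz.trans (zvec_exch h' hj S (h2.trans (le_abs_self _))).symm)
    rw [macNorm_exch G _ S h' hj h2, e1, e2, h1, sub_self, zpow_zero, one_mul]

theorem macNorm_affine (G : Generic μ q t) (α : Fin (n + 1) → ℕ) (S : RSYT n μ) :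
    macNorm q t (affine α) S =
      (1 - q ^ (α 0 + 1) * t ^ S.content (rank α 0)) / (1 - q) * macNorm q t α S := by
  rw [macNorm_eq G, macNorm_eq G, zvec_affine, specNorm_rot, mul_left_comm]
  rfl

end NormValues

end VVMac

namespace VVMac

/-! ### The form and its adjointness properties -/

section BilinearForm

variable {K : Type*} [Field K] {n : ℕ} {μ : YoungDiagram} {q t : K}

/-- The bilinear form for which the Macdonald polynomials are orthogonal with norms `macNorm`. -/
noncomputable def macForm (G : Generic μ q t) : LinearMap.BilinForm K (PV K n μ) :=
  (macBasis G).constr K fun x => macNorm q t x.1 x.2 • (macBasis G).coord x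

open Classical in
theorem macForm_apply (G : Generic μ q t) (x y : (Fin (n + 1) → ℕ) × RSYT n μ) :
    macForm G (macdonald q t x.1 x.2) (macdonald q t y.1 y.2) =
      if x = y then macNorm q t x.1 x.2 else 0 := by
  rw [← macBasis_apply G, ← macBasis_apply G, macForm, Module.Basis.constr_basis,
    LinearMap.smul_apply, Module.Basis.coord_apply, Module.Basis.repr_self, smul_eq_mul,
    Finsupp.single_apply]
  simp only [eq_comm (a := y), mul_ite, mul_one, mul_zero]

theorem isMacdonaldForm_macForm (G : Generic μ q t) :
    IsMacdonaldForm q t (macForm (n := n) G) where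
  partition lam S h := by
    rw [macForm_apply G (lam, S) (lam, S), if_pos rfl, macNorm_of_antitone h]
  composition α S := by
    rw [macForm_apply G (α, S) (α, S), if_pos rfl, macForm_apply G (plus α, S) (plus α, S),
      if_pos rfl, macNorm_of_antitone (plus_antitone α), macNorm]
  orthogonal α β S S' h := by
    rw [macForm_apply G (α, S) (β, S'), if_neg h]

theorem IsMacdonaldForm.apply_self {B : LinearMap.BilinForm K (PV K n μ)}
    (hB : IsMacdonaldForm q t B) (α : Fin (n + 1) → ℕ) (S : RSYT n μ) :
    B (macdonald q t α S) (macdonald q t α S) = macNorm q t α S := by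
  rw [hB.composition, hB.partition _ _ (plus_antitone α), macNorm]

theorem bilin_ext (G : Generic μ q t) {B B' : LinearMap.BilinForm K (PV K n μ)}
    (h : ∀ (α β : Fin (n + 1) → ℕ) (S S' : RSYT n μ),
      B (macdonald q t α S) (macdonald q t β S') = B' (macdonald q t α S) (macdonald q t β S')) :
    B = B' := by
  refine (macBasis G).ext fun x => (macBasis G).ext fun y => ?_
  rw [macBasis_apply, macBasis_apply]
  exact h _ _ _ _

theorem existsUnique_isMacdonaldForm (G : Generic μ q t) :
    ∃! B : LinearMap.BilinForm K (PV K n μ), IsMacdonaldForm q t B := by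
  refine ⟨macForm G, isMacdonaldForm_macForm G, fun B hB => bilin_ext G fun α β S S' => ?_⟩
  by_cases h : (α, S) = (β, S')
  · obtain ⟨rfl, rfl⟩ := Prod.mk.inj h
    rw [hB.apply_self, (isMacdonaldForm_macForm G).apply_self]
  · rw [hB.orthogonal _ _ _ _ h, (isMacdonaldForm_macForm G).orthogonal _ _ _ _ h]

/-- Adjointness of two operators can be tested on the Macdonald polynomials. -/
theorem adjoint_ext (G : Generic μ q t) {B : LinearMap.BilinForm K (PV K n μ)}
    {A A' : PV K n μ →ₗ[K] PV K n μ}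
    (h : ∀ (α β : Fin (n + 1) → ℕ) (S S' : RSYT n μ),
      B (A (macdonald q t α S)) (macdonald q t β S') =
        B (macdonald q t α S) (A' (macdonald q t β S'))) (f g : PV K n μ) :
    B (A f) g = B f (A' g) := by
  have : B ∘ₗ A = B.compl₂ A' := bilin_ext G h
  exact LinearMap.congr_fun (LinearMap.congr_fun this f) g

variable {B : LinearMap.BilinForm K (PV K n μ)}

theorem IsMacdonaldForm.symm (G : Generic μ q t) (hB : IsMacdonaldForm q t B) (f g : PV K n μ) :
    B f g = B g f := by
  have : B = B.flip := bilin_ext G fun α β S S' => by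
    rw [LinearMap.BilinForm.flip_apply]
    by_cases h : (α, S) = (β, S')
    · obtain ⟨rfl, rfl⟩ := Prod.mk.inj h
      rfl
    · rw [hB.orthogonal _ _ _ _ h, hB.orthogonal _ _ _ _ (Ne.symm h)]
  exact LinearMap.congr_fun (LinearMap.congr_fun this f) g

theorem inter_macdonald_swap (G : Generic μ q t) {α β : Fin (n + 1) → ℕ} {S S' : RSYT n μ}
    {i : Fin n} (h : Prec (zvec α S i.castSucc) (zvec α S i.succ))
    (hz : zvec β S' = zvec α S ∘ Equiv.swap i.castSucc i.succ) :
    inter t (opT t i) (zval q t (zvec β S' i.succ) / zval q t (zvec β S' i.castSucc))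
      (macdonald q t β S') =
      u t (zval q t (zvec α S i.succ) / zval q t (zvec α S i.castSucc)) • macdonald q t α S := by
  rw [macdonald_swap G h hz, hz, Function.comp_apply, Function.comp_apply,
    Equiv.swap_apply_left, Equiv.swap_apply_right, ← inv_div]
  exact inter_inter_inv (div_ne_zero (G.zval_ne_zero _) (G.zval_ne_zero _))
    (G.zval_ratio_ne_one α S i) (opT_quad G i _)

/-- The intertwiner sends M_{α,S} to a multiple of the Macdonald polynomial with exchanged exponents
if there is one, and to zero otherwise. -/
theorem IsMacdonaldForm.apply_inter_eq_zero (G : Generic μ q t) (hB : IsMacdonaldForm q t B)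
    {α β : Fin (n + 1) → ℕ} {S S' : RSYT n μ} {i : Fin n}
    (h : zvec β S' ≠ zvec α S ∘ Equiv.swap i.castSucc i.succ) :
    B (inter t (opT t i) (zval q t (zvec α S i.succ) / zval q t (zvec α S i.castSucc))
      (macdonald q t α S)) (macdonald q t β S') = 0 := by
  by_cases hp : ∃ γ, ∃ R : RSYT n μ, zvec γ R = zvec α S ∘ Equiv.swap i.castSucc i.succ
  · obtain ⟨γ, R, hz⟩ := hp
    have hne : (γ, R) ≠ (β, S') := by
      rintro h'
      obtain ⟨rfl, rfl⟩ := Prod.mk.inj h'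
      exact h hz
    rcases prec_of_zvec_swap hz with hp | hp
    · rw [← macdonald_swap G hp hz, hB.orthogonal _ _ _ _ hne]
    · have hz' : zvec α S = zvec γ R ∘ Equiv.swap i.castSucc i.succ := by
        rw [hz, Function.comp_assoc]
        funext k
        simp
      have hp' : Prec (zvec γ R i.castSucc) (zvec γ R i.succ) := by
        rwa [hz, Function.comp_apply, Function.comp_apply, Equiv.swap_apply_left,
          Equiv.swap_apply_right]
      rw [inter_macdonald_swap G hp' hz', map_smul, LinearMap.smul_apply,
        hB.orthogonal _ _ _ _ hne, smul_zero]
  · push Not at hp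
    rw [inter_macdonald_eq_zero G hp, map_zero, LinearMap.zero_apply]

/-- One side is the norm of the new polynomial, the other is u times the norm of the old one. -/
theorem IsMacdonaldForm.apply_inter (G : Generic μ q t) (hB : IsMacdonaldForm q t B)
    {α β : Fin (n + 1) → ℕ} {S S' : RSYT n μ} {i : Fin n}
    (h : Prec (zvec α S i.castSucc) (zvec α S i.succ))
    (hz : zvec β S' = zvec α S ∘ Equiv.swap i.castSucc i.succ) :
    B (inter t (opT t i) (zval q t (zvec α S i.succ) / zval q t (zvec α S i.castSucc))
        (macdonald q t α S)) (macdonald q t β S') =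
      B (macdonald q t α S)
        (inter t (opT t i) (zval q t (zvec β S' i.succ) / zval q t (zvec β S' i.castSucc))
          (macdonald q t β S')) := by
  rw [← macdonald_swap G h hz, inter_macdonald_swap G h hz, map_smul, hB.apply_self,
    hB.apply_self, macNorm_swap G h hz, smul_eq_mul]

theorem IsMacdonaldForm.selfAdjoint_T (G : Generic μ q t) (hB : IsMacdonaldForm q t B)
    (i : Fin n) (f g : PV K n μ) : B (opT t i f) g = B f (opT t i g) := by
  refine adjoint_ext G (fun α β S S' => ?_) f g
  have key : B (inter t (opT t i) (zval q t (zvec α S i.succ) / zval q t (zvec α S i.castSucc))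
        (macdonald q t α S)) (macdonald q t β S') =
      B (macdonald q t α S)
        (inter t (opT t i) (zval q t (zvec β S' i.succ) / zval q t (zvec β S' i.castSucc))
          (macdonald q t β S')) := by
    have hcomp : ∀ {z z' : Fin (n + 1) → ℕ × ℤ}, z' = z ∘ Equiv.swap i.castSucc i.succ →
        z = z' ∘ Equiv.swap i.castSucc i.succ := by
      rintro z _ rfl
      funext k
      simp
    by_cases hz : zvec β S' = zvec α S ∘ Equiv.swap i.castSucc i.succ
    · rcases prec_of_zvec_swap hz with hp | hp
      · exact hB.apply_inter G hp hz
      · have hp' : Prec (zvec β S' i.castSucc) (zvec β S' i.succ) := by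
          rwa [hz, Function.comp_apply, Function.comp_apply, Equiv.swap_apply_left,
            Equiv.swap_apply_right]
        rw [hB.symm G, ← hB.apply_inter G hp' (hcomp hz), hB.symm G]
    · rw [hB.apply_inter_eq_zero G hz, hB.symm G,
        hB.apply_inter_eq_zero G fun h => hz (hcomp h)]
  rw [inter, inter, map_add, map_add, LinearMap.add_apply, map_smul, map_smul,
    LinearMap.smul_apply] at key
  -- Passing from intertwiners to T_i: the scalar terms agree on the diagonal and vanish off it by
  -- orthogonality.
  by_cases h : (α, S) = (β, S')
  · obtain ⟨rfl, rfl⟩ := Prod.mk.inj h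
    exact add_right_cancel key
  · rwa [hB.orthogonal _ _ _ _ h, smul_zero, smul_zero, add_zero, add_zero] at key

theorem IsMacdonaldForm.selfAdjoint_xi (G : Generic μ q t) (hB : IsMacdonaldForm q t B)
    (i : Fin (n + 1)) (f g : PV K n μ) : B (opXi q t i f) g = B f (opXi q t i g) := by
  refine adjoint_ext G (fun α β S S' => ?_) f g
  rw [isEigen_macdonald G, isEigen_macdonald G, map_smul, map_smul, LinearMap.smul_apply]
  by_cases h : (α, S) = (β, S')
  · obtain ⟨rfl, rfl⟩ := Prod.mk.inj h
    rfl
  · rw [hB.orthogonal _ _ _ _ h, smul_zero, smul_zero]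

theorem opWstar_eq (G : Generic μ q t) (f : PV K n μ) :
    opWstar q t f = (chainQ (natExt (opT t : Fin n → Module.End K (PV K n μ))) n)
      (opXi q t (Fin.last n) f) := by
  have h := (affineHeckeRel (n := n) G).xi_last
  rw [natExt_of_lt _ (Nat.lt_succ_self n)] at h
  have h1 := rightProd_reverse_take_map (opT t : Fin n → Module.End K (PV K n μ)) le_rfl
  have h2 := rightProd_reverse_take_map (opTinv t : Fin n → Module.End K (PV K n μ)) le_rfl
  rw [List.take_of_length_le (by simp)] at h1 h2
  rw [opWstar, rightProd_append, rightProd_append, h1, h2,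
    chainQ_congr fun i hi => natExt_opTinv t hi]
  have h3 : (opXi q t (Fin.last n) : Module.End K (PV K n μ)) =
    opW q t * chainR t (natExt (opT t)) n := h
  rw [h3]
  rfl

/-- w is the product of all T_i followed by ξ_N. All factors are self-adjoint, so reversing their
order gives the adjoint, which is w* by `opWstar_eq`. -/
theorem IsMacdonaldForm.adjoint_W (G : Generic μ q t) (hB : IsMacdonaldForm q t B)
    (f g : PV K n μ) : B (opW q t f) g = B f (opWstar q t g) := by
  have key : ∀ k ≤ n, ∀ f g : PV K n μ,
      B ((chainP (natExt (opT t : Fin n → Module.End K (PV K n μ))) k) f) g =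
        B f ((chainQ (natExt (opT t : Fin n → Module.End K (PV K n μ))) k) g) := by
    intro k hk
    induction k with
    | zero => exact fun _ _ => rfl
    | succ k ih =>
      intro f g
      rw [chainP, chainQ, Module.End.mul_apply, Module.End.mul_apply, natExt_of_lt _ hk,
        hB.selfAdjoint_T G, ih (by omega)]
  rw [← opXi_last_chainP G, hB.selfAdjoint_xi G, key n le_rfl, opWstar_eq G]

theorem IsMacdonaldForm.dunkl (G : Generic μ q t) (hB : IsMacdonaldForm q t B) (f g : PV K n μ) :
    B (opD q t f) g = (1 - q) * B f (mulXN K n μ (opW q t (opWstar q t g))) := by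
  have key : B ∘ₗ opD q t =
      (1 - q) • B.compl₂ (mulXN K n μ ∘ₗ opW q t ∘ₗ opWstar q t) := by
    refine (macBasis G).ext fun x => LinearMap.ext fun g => ?_
    obtain ⟨γ, S⟩ := x
    rw [macBasis_apply, LinearMap.comp_apply]
    simp only [LinearMap.smul_apply, LinearMap.compl₂_apply, LinearMap.comp_apply]
    generalize hg : opWstar q t g = g'
    rcases Nat.eq_zero_or_pos (γ (Fin.last n)) with h | h
    · rw [opD_macdonald_of_zero G h, map_zero, LinearMap.zero_apply]
      -- Everything of the form x_N (g w) is a combination of polynomials whose last part is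
      -- positive, hence orthogonal to one whose last part is zero.
      have : B (macdonald q t γ S) ∘ₗ mulXN K n μ ∘ₗ opW q t = 0 := by
        refine (macBasis G).ext fun y => ?_
        rw [macBasis_apply, LinearMap.comp_apply, LinearMap.comp_apply, ← macdonald_affine G,
          hB.orthogonal, LinearMap.zero_apply]
        intro h'
        have := congrFun (congrArg Prod.fst h') (Fin.last n)
        simp only [h, affine_last] at this
        omega
      have := LinearMap.congr_fun this g'
      simp only [LinearMap.comp_apply, LinearMap.zero_apply] at this
      rw [this, smul_zero]
    · obtain ⟨β, rfl⟩ := exists_affine_eq h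
      rw [opD_macdonald_affine G, map_smul, LinearMap.smul_apply, hB.adjoint_W G, hg]
      -- After w is moved across as w*, what remains is that the affine arrow is an injection on
      -- labels whose norm ratio is (1 - ζ)/(1 - q).
      have : (1 - zval q t (zvec (affine β) S (Fin.last n))) • B (macdonald q t β S) =
          (1 - q) • (B (macdonald q t (affine β) S) ∘ₗ mulXN K n μ ∘ₗ opW q t) := by
        refine (macBasis G).ext fun y => ?_
        obtain ⟨δ, S'⟩ := y
        rw [macBasis_apply, LinearMap.smul_apply, LinearMap.smul_apply, LinearMap.comp_apply,
          LinearMap.comp_apply, ← macdonald_affine G]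
        by_cases hy : (β, S) = (δ, S')
        · obtain ⟨rfl, rfl⟩ := Prod.mk.inj hy
          have hq : 1 - q ≠ 0 := sub_ne_zero.2 (G.q_ne_one S).symm
          rw [hB.apply_self, hB.apply_self, macNorm_affine G, zvec_affine_last, zval, smul_eq_mul,
            smul_eq_mul, ← mul_assoc, mul_div_cancel₀ _ hq]
          rfl
        · rw [hB.orthogonal _ _ _ _ hy, hB.orthogonal, smul_zero, smul_zero]
          intro h'
          obtain ⟨h1, h2⟩ := Prod.mk.inj h'
          exact hy (Prod.ext (affine_injective h1) h2)
      exact LinearMap.congr_fun this g'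
  exact LinearMap.congr_fun (LinearMap.congr_fun key f) g

theorem IsMacdonaldForm.formPostulates (G : Generic μ q t) (hB : IsMacdonaldForm q t B) :
    FormPostulates q t B where
  symm := hB.symm G
  const_self S := by rw [← macdonald_zero G, hB.apply_self, macNorm_zero]
  const_ne S S' h := by
    rw [← macdonald_zero G, ← macdonald_zero G, hB.orthogonal]
    exact fun h' => h (Prod.mk.inj h').2
  selfAdjoint_T := hB.selfAdjoint_T G
  selfAdjoint_xi := hB.selfAdjoint_xi G _
  dunkl := hB.dunkl G

end BilinearForm

end VVMac

theorem mainTheorem3 {K : Type*} [Field K] (n : ℕ) (μ : YoungDiagram) (hμ : μ.card = n + 1)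
    (q t : K) (hq : q ≠ 0) (ht : t ≠ 0)
    (hqt : ∀ a b : ℤ, (a, b) ≠ (0, 0) →
      |b| ≤ (μ.rowLen 0 : ℤ) + (μ.colLen 0 : ℤ) - 1 → q ^ a * t ^ b ≠ 1) :
    -- all paths of the Yang–Baxter graph that end at `(α, S)` produce the polynomial `M_{α,S}`
    (∀ (α : Fin (n + 1) → ℕ) (S : VVMac.RSYT n μ) (f : VVMac.PV K n μ),
      VVMac.YBNode q t α S f ↔ f = VVMac.macdonald q t α S) ∧
    -- the Macdonald polynomials are simultaneous eigenfunctions of the Cherednik operators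
    (∀ (α : Fin (n + 1) → ℕ) (S : VVMac.RSYT n μ) (i : Fin (n + 1)),
      VVMac.opXi q t i (VVMac.macdonald q t α S) =
        VVMac.zeta q t α S i • VVMac.macdonald q t α S) ∧
    -- they form a basis of `P_τ`
    (LinearIndependent K (fun x : (Fin (n + 1) → ℕ) × VVMac.RSYT n μ =>
        VVMac.macdonald q t x.1 x.2) ∧
      Submodule.span K (Set.range (fun x : (Fin (n + 1) → ℕ) × VVMac.RSYT n μ =>
        VVMac.macdonald q t x.1 x.2)) = ⊤) ∧
    -- `f - f ξ_N` is divisible by `x_N`, so that `f D_N` is the exact quotient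
    (∀ f : VVMac.PV K n μ, VVMac.mulXN K n μ (VVMac.opD q t f) =
      f - VVMac.opXi q t (Fin.last n) f) ∧
    -- the form is well defined
    (∃! B : LinearMap.BilinForm K (VVMac.PV K n μ), VVMac.IsMacdonaldForm q t B) ∧
    ∀ B : LinearMap.BilinForm K (VVMac.PV K n μ), VVMac.IsMacdonaldForm q t B →
      VVMac.FormPostulates q t B ∧
      (∀ (α : Fin (n + 1) → ℕ) (S : VVMac.RSYT n μ) (i j : Fin n),
        α i.castSucc = α i.succ → VVMac.rank α i.castSucc = j.castSucc →
        ∀ m : ℤ, m = S.content j.castSucc - S.content j.succ → 2 ≤ m →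
        B (VVMac.macdonald q t α (S.exch j)) (VVMac.macdonald q t α (S.exch j)) =
          (1 - t ^ (1 - m)) * (t - t ^ (-m)) / (1 - t ^ (-m)) ^ 2 *
            B (VVMac.macdonald q t α S) (VVMac.macdonald q t α S)) ∧
      (∀ (α : Fin (n + 1) → ℕ) (S : VVMac.RSYT n μ),
        B (VVMac.macdonald q t (VVMac.affine α) S) (VVMac.macdonald q t (VVMac.affine α) S) =
          (1 - q ^ (α 0 + 1) * t ^ S.content (VVMac.rank α 0)) / (1 - q) *
            B (VVMac.macdonald q t α S) (VVMac.macdonald q t α S)) := by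
  have G : VVMac.Generic μ q t := ⟨hq, ht, hqt⟩
  refine ⟨fun α S f => VVMac.ybNode_iff G α S f, fun α S i => VVMac.isEigen_macdonald G α S i,
    ⟨VVMac.linearIndependent_macdonald G, VVMac.span_macdonald G⟩, VVMac.mulXN_opD G,
    VVMac.existsUnique_isMacdonaldForm G, fun B hB => ⟨hB.formPostulates G, ?_, fun α S => ?_⟩⟩
  · intro α S i j h hj m hm hm2
    rw [hB.apply_self, hB.apply_self, VVMac.macNorm_exch G α S h hj (hm ▸ hm2), VVMac.u,
      show S.content j.succ - S.content j.castSucc = -m by omega, sub_eq_add_neg 1 m,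
      zpow_add₀ ht, zpow_one, mul_comm (t - t ^ (-m))]
  · rw [hB.apply_self, hB.apply_self, VVMac.macNorm_affine G]
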